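/- A metrical task system (MTS) $\mathcal M=(\mathcal X,\mathcal L)$ consists of a nonempty finite pseudo-metric space $(\mathcal X,d)$ with $N$ points (states) and diameter $D=\max_{x,y}d(x,y)$, and a set $\mathcal L\subseteq[0,1]^{\mathcal X}$ of loss vectors. In each round $t=1,\dots,T$ a randomized online algorithm, which knows the horizon $T$ in advance, first sees $l_t\in\mathcal L$ and then chooses a state $i_t\in\mathcal X$; the sequence of losses is fixed in advance (oblivious adversary). An online algorithm (one for each $T$) has competitive ratio $\alpha$ if there is $\beta>0$, independent of $T$, such that for all $T$ and all $l_1,\dots,l_T\in\mathcal L$ $$\mathbb E\Big[\sum_{t=1}^T l_t(i_t)+\sum_{t=2}^T d(i_t,i_{t-1})\Big]\le \alpha\min_{i_1^*,\dots,i_T^*\in\mathcal X}\Big(\sum_{t=1}^T l_t(i^*_t)+\sum_{t=2}^T d(i^*_t,i^*_{t-1})\Big)+\beta .$$ Its regret on an interval $I=\{t_0+1,\dots,t_0+k\}\subseteq[T]$ is at most $R$ if for all $l_1,\dots,l_T\in\mathcal L$ $$\mathbb E\Big[\sum_{t\in I} l_t(i_t)+\sum_{t\in I\setminus\{t_0+1\}}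 d(i_t,i_{t-1})\Big]\le \min_{x\in\mathcal X}\sum_{t\in I} l_t(x)+R .$$ **Corollary.** There are a universal constant $C>0$ and a single randomized procedure with the following property. Let $\mathcal A_{\mathrm{base}}$ be an online algorithm for an MTS $\mathcal M$ with competitive ratio $\alpha\ge1$. Let $\mathcal A$ be the online algorithm that runs $\mathcal A_{\mathrm{base}}$ as a black box and the procedure on top of it: in each round the procedure, which knows $N$, $T$, $D$ and has access to $d$, is given $l_t$ and the current state of $\mathcal A_{\mathrm{base}}$, and determines the state $i_t$ of $\mathcal A$. Then: 1. $\mathcal A$ has competitive ratio $\alpha$. 2. For every $T$ and every interval $I\subseteq[T]$, the regret of $\mathcal A$ on $I$ is at most $$C\Big(D\sqrt{|I|\log T}+\sqrt{(D+1)\,|I|\,\log(NT)}\Big).$$ 3. In each round the procedure (that is, the computation of $\mathcal A$ on top of that of $\mathcal A_{\mathrm{base}}$) takes at most $C\,N\log(T+1)$ units of time, for all losses and all outcomes of the randomness, on a random access machine with real and integer arrays on which arithmetic operations, comparisons, array accesses, exponentiation, the error function and the draw of a uniform number from $[0,1]$ each take one unit of time. -/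

import Mathlib

open MeasureTheory

universe u w

noncomputable section

/-! ### Metrical task systems and randomized online algorithms -/

/-- A metrical task system on the finite pseudo-metric space `X`: a collection of loss vectors in
`[0,1]^X`. Moving from `x` to `y` costs `dist x y`. -/
structure MTS (X : Type u) where
  losses : Set (X → ℝ)
  bounded : ∀ l ∈ losses, ∀ x, 0 ≤ l x ∧ l x ≤ 1

/-- A randomized online algorithm for `M`: it draws a seed `ω` before the first round, and in round
`t` (rounds are numbered from `0`) it moves to the state `act l t ω`, which may depend on the seed
and on the losses of the rounds `0, …, t` only. -/
structure OnlineAlgorithm {X : Type u} (M : MTS X) where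
  Seed : Type w
  [measurableSpace : MeasurableSpace Seed]
  law : Measure Seed
  [isProbability : IsProbabilityMeasure law]
  act : (ℕ → M.losses) → ℕ → Seed → X
  causal : ∀ (l l' : ℕ → M.losses) (t : ℕ), (∀ s ≤ t, l s = l' s) → act l t = act l' t
  measurable_act : ∀ (l : ℕ → M.losses) (t : ℕ) (x : X), MeasurableSet {ω | act l t ω = x}

attribute [instance] OnlineAlgorithm.measurableSpace OnlineAlgorithm.isProbability

/-- The cost of the state sequence `p` on the interval of the `k` rounds `a, …, a + k - 1`:
the losses of all these rounds, and the movement costs of all but the first of them. -/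
def pathCost {X : Type u} [PseudoMetricSpace X] {M : MTS X} (l : ℕ → M.losses) (p : ℕ → X)
    (a k : ℕ) : ℝ :=
  ∑ t ∈ Finset.Ico a (a + k), (l t : X → ℝ) (p t)
    + ∑ t ∈ Finset.Ico (a + 1) (a + k), dist (p t) (p (t - 1))

/-- The expected cost of an online algorithm on the rounds `a, …, a + k - 1`. -/
def OnlineAlgorithm.expectedCost {X : Type u} [PseudoMetricSpace X] {M : MTS X}
    (A : OnlineAlgorithm.{u, w} M) (l : ℕ → M.losses) (a k : ℕ) : ℝ :=
  ∫ ω, pathCost l (fun t => A.act l t ω) a k ∂A.law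

/-- `A T` is the algorithm for the (known) horizon `T`. The family has competitive ratio `α` if,
up to an additive constant independent of `T`, its expected cost on every loss sequence is at most
`α` times the cost of every (hence of the best) offline state sequence. -/
def HasCompetitiveRatio {X : Type u} [PseudoMetricSpace X] {M : MTS X}
    (A : ℕ → OnlineAlgorithm.{u, w} M) (α : ℝ) : Prop :=
  ∃ β : ℝ, 0 < β ∧ ∀ (T : ℕ) (l : ℕ → M.losses) (p : ℕ → X),
    (A T).expectedCost l 0 T ≤ α * pathCost l p 0 T + β

/-- `A` has regret at most `R` on the rounds `a, …, a + k - 1`, against every fixed state. -/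
def OnlineAlgorithm.RegretLE {X : Type u} [PseudoMetricSpace X] {M : MTS X}
    (A : OnlineAlgorithm.{u, w} M) (a k : ℕ) (R : ℝ) : Prop :=
  ∀ (l : ℕ → M.losses) (x : X),
    A.expectedCost l a k ≤ ∑ t ∈ Finset.Ico a (a + k), (l t : X → ℝ) x + R

/-! ### A randomized real random access machine

Programs work on finitely many integer arrays and finitely many real arrays (a scalar is entry `0`
of an array). Arithmetic, comparison, exponentiation, the error function, an array access and the
draw of a uniform number from `[0,1]` each take one unit of time. Real numbers are never converted
to integers. -/

/-- The memory, the number of uniform numbers drawn so far, and the time used so far. -/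
@[ext] structure Store where
  int : ℕ → ℕ → ℕ
  real : ℕ → ℕ → ℝ
  drawn : ℕ
  time : ℕ

/-- Integer expressions; `get a i` is the entry `i` of the integer array `a`. -/
inductive IExp where
  | lit (n : ℕ)
  | get (a : ℕ) (i : IExp)
  | add (i j : IExp)
  | sub (i j : IExp)
  | mul (i j : IExp)

/-- Real expressions; `get a i` is the entry `i` of the real array `a`. -/
inductive RExp where
  | ofInt (i : IExp)
  | get (a : ℕ) (i : IExp)
  | add (x y : RExp)
  | sub (x y : RExp)
  | mul (x y : RExp)
  | div (x y : RExp)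
  | exp (x : RExp)
  | pow (x y : RExp)
  | erf (x : RExp)

inductive Test where
  | intLE (i j : IExp)
  | realLE (x y : RExp)
  | not (b : Test)

/-- Programs. `draw a i` stores a fresh uniform number in entry `i` of the real array `a`;
`loop n b c` repeats `c` as long as `b` holds, but at most `n` times. -/
inductive Program where
  | skip
  | setInt (a : ℕ) (i v : IExp)
  | setReal (a : ℕ) (i : IExp) (v : RExp)
  | draw (a : ℕ) (i : IExp)
  | seq (c d : Program)
  | ite (b : Test) (c d : Program)
  | loop (n : IExp) (b : Test) (c : Program)

/-- The error function in the normalization `∫₀ˣ exp(-s²/2) ds`. -/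
def errorFunction (x : ℝ) : ℝ := ∫ s in (0 : ℝ)..x, Real.exp (-s ^ 2 / 2)

/-- `x ^ y` for a positive base `x`, and `0` otherwise. -/
def positivePow (x y : ℝ) : ℝ := if 0 < x then x ^ y else 0

def IExp.eval : IExp → Store → ℕ
  | .lit n, _ => n
  | .get a i, s => s.int a (i.eval s)
  | .add i j, s => i.eval s + j.eval s
  | .sub i j, s => i.eval s - j.eval s
  | .mul i j, s => i.eval s * j.eval s

/-- The time to evaluate an integer expression: one unit per node. -/
def IExp.cost : IExp → ℕ
  | .lit _ => 1
  | .get _ i => i.cost + 1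
  | .add i j => i.cost + j.cost + 1
  | .sub i j => i.cost + j.cost + 1
  | .mul i j => i.cost + j.cost + 1

def RExp.eval : RExp → Store → ℝ
  | .ofInt i, s => (i.eval s : ℝ)
  | .get a i, s => s.real a (i.eval s)
  | .add x y, s => x.eval s + y.eval s
  | .sub x y, s => x.eval s - y.eval s
  | .mul x y, s => x.eval s * y.eval s
  | .div x y, s => x.eval s / y.eval s
  | .exp x, s => Real.exp (x.eval s)
  | .pow x y, s => positivePow (x.eval s) (y.eval s)
  | .erf x, s => errorFunction (x.eval s)

/-- The time to evaluate a real expression: one unit per node. -/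
def RExp.cost : RExp → ℕ
  | .ofInt i => i.cost + 1
  | .get _ i => i.cost + 1
  | .add x y => x.cost + y.cost + 1
  | .sub x y => x.cost + y.cost + 1
  | .mul x y => x.cost + y.cost + 1
  | .div x y => x.cost + y.cost + 1
  | .exp x => x.cost + 1
  | .pow x y => x.cost + y.cost + 1
  | .erf x => x.cost + 1

def Test.Holds : Test → Store → Prop
  | .intLE i j, s => i.eval s ≤ j.eval s
  | .realLE x y, s => x.eval s ≤ y.eval s
  | .not b, s => ¬ b.Holds s

/-- The time to evaluate a test: one unit per node. -/
def Test.cost : Test → ℕ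
  | .intLE i j => i.cost + j.cost + 1
  | .realLE x y => x.cost + y.cost + 1
  | .not b => b.cost + 1

def Store.tick (s : Store) (k : ℕ) : Store := { s with time := s.time + k }

def Store.setInt (s : Store) (a i v : ℕ) : Store :=
  { s with int := Function.update s.int a (Function.update (s.int a) i v) }

def Store.setReal (s : Store) (a i : ℕ) (v : ℝ) : Store :=
  { s with real := Function.update s.real a (Function.update (s.real a) i v) }

open Classical in
/-- Repeat `body` while `b` holds, at most `n` times; every evaluation of `b` is paid for. -/
def whileUpTo (b : Test) (body : Store → Store) : ℕ → Store → Store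
  | 0, s => s
  | n + 1, s =>
    if b.Holds s then whileUpTo b body n (body (s.tick b.cost)) else s.tick b.cost

open Classical in
/-- The store after running a program, where `coins` is the sequence of uniform numbers that the
machine draws from. -/
def Program.exec (coins : ℕ → unitInterval) : Program → Store → Store
  | .skip, s => s.tick 1
  | .setInt a i v, s => (s.setInt a (i.eval s) (v.eval s)).tick (i.cost + v.cost + 1)
  | .setReal a i v, s => (s.setReal a (i.eval s) (v.eval s)).tick (i.cost + v.cost + 1)
  | .draw a i, s =>
    { s.setReal a (i.eval s) (coins s.drawn) with
      drawn := s.drawn + 1, time := s.time + i.cost + 1 }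
  | .seq c d, s => d.exec coins (c.exec coins s)
  | .ite b c d, s =>
    if b.Holds s then c.exec coins (s.tick b.cost) else d.exec coins (s.tick b.cost)
  | .loop n b c, s => whileUpTo b (c.exec coins) (n.eval s) (s.tick (n.cost + 1))

/-! ### Running a program on top of a base algorithm

The states are numbered `0, …, N - 1` by `e`. The integer arrays `0` and `1` hold `N` and the
horizon `T`, the real array `0` holds the diameter, and the real array `1` holds the distance matrix
(row by row). In each round the current loss vector is written to the real array `2`, and the
current state of the base algorithm to the integer array `2`; then the program is run, and it has to
leave the number of its new state in the integer array `3`. The memory is kept between rounds. -/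

section Overlay

variable {X : Type u} [Fintype X] [Nonempty X]

/-- The state with number `n`. -/
def decode (e : X ≃ Fin (Fintype.card X)) (n : ℕ) : X :=
  if h : n < Fintype.card X then e.symm ⟨n, h⟩ else Classical.arbitrary X

/-- The store before the first round. -/
def startStore [PseudoMetricSpace X] (e : X ≃ Fin (Fintype.card X)) (T : ℕ) : Store where
  int a i :=
    if a = 0 ∧ i = 0 then Fintype.card X
    else if a = 1 ∧ i = 0 then T
    else 0
  real a i :=
    if a = 0 ∧ i = 0 then Metric.diam (Set.univ : Set X)
    else if a = 1 ∧ i < Fintype.card X * Fintype.card X then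
      dist (decode e (i / Fintype.card X)) (decode e (i % Fintype.card X))
    else 0
  drawn := 0
  time := 0

/-- Write the loss vector `l` and the state `x` of the base algorithm into the store, and restart
the clock. -/
def feed (e : X ≃ Fin (Fintype.card X)) (l : X → ℝ) (x : X) (s : Store) : Store where
  int := Function.update s.int 2 (Function.update (s.int 2) 0 (e x : ℕ))
  real := Function.update s.real 2 (fun i => if i < Fintype.card X then l (decode e i) else 0)
  drawn := s.drawn
  time := 0

/-- The store at the end of the first `t` rounds, when the losses are `l 0, l 1, …` and the base
algorithm is in the states `x 0, x 1, …`. -/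
def runRounds [PseudoMetricSpace X] (P : Program) (e : X ≃ Fin (Fintype.card X)) (T : ℕ)
    (l : ℕ → X → ℝ) (x : ℕ → X) (coins : ℕ → unitInterval) : ℕ → Store
  | 0 => startStore e T
  | t + 1 => P.exec coins (feed e (l t) (x t) (runRounds P e T l x coins t))

/-- The time that the program uses in round `t`. -/
def overheadTime [PseudoMetricSpace X] (P : Program) (e : X ≃ Fin (Fintype.card X)) (T : ℕ)
    (l : ℕ → X → ℝ) (x : ℕ → X) (coins : ℕ → unitInterval) (t : ℕ) : ℕ :=
  (runRounds P e T l x coins (t + 1)).time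

end Overlay

/-! Measurability of the output of a program in the coins. -/

/-- All components of the store depend measurably on `ω`. -/
structure MeasurableStore {Ω : Type w} [MeasurableSpace Ω] (f : Ω → Store) : Prop where
  int : ∀ a i, Measurable fun ω => (f ω).int a i
  real : ∀ a i, Measurable fun ω => (f ω).real a i
  drawn : Measurable fun ω => (f ω).drawn
  time : Measurable fun ω => (f ω).time

section Measurability

variable {Ω : Type w} [MeasurableSpace Ω]

theorem measurable_pick {β : Type*} [MeasurableSpace β] {n : Ω → ℕ} {F : ℕ → Ω → β}
    (hn : Measurable n) (hF : ∀ k, Measurable (F k)) : Measurable fun ω => F (n ω) ω := by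
  have h : Measurable fun p : ℕ × Ω => F p.1 p.2 := measurable_from_prod_countable_right hF
  exact h.comp (hn.prodMk measurable_id)

theorem MeasurableStore.pick {n : Ω → ℕ} {F : ℕ → Ω → Store}
    (hn : Measurable n) (hF : ∀ k, MeasurableStore (F k)) :
    MeasurableStore fun ω => F (n ω) ω where
  int a i := measurable_pick (F := fun k ω => (F k ω).int a i) hn fun k => (hF k).int a i
  real a i := measurable_pick (F := fun k ω => (F k ω).real a i) hn fun k => (hF k).real a i
  drawn := measurable_pick (F := fun k ω => (F k ω).drawn) hn fun k => (hF k).drawn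
  time := measurable_pick (F := fun k ω => (F k ω).time) hn fun k => (hF k).time

open Classical in
theorem MeasurableStore.ite {p : Ω → Prop} {f g : Ω → Store} (hp : MeasurableSet {ω | p ω})
    (hf : MeasurableStore f) (hg : MeasurableStore g) :
    MeasurableStore fun ω => if p ω then f ω else g ω where
  int a i := by
    simpa only [apply_ite Store.int, ite_apply] using (hf.int a i).ite hp (hg.int a i)
  real a i := by
    simpa only [apply_ite Store.real, ite_apply] using (hf.real a i).ite hp (hg.real a i)
  drawn := by simpa only [apply_ite Store.drawn] using hf.drawn.ite hp hg.drawn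
  time := by simpa only [apply_ite Store.time] using hf.time.ite hp hg.time

theorem IExp.measurable_eval (i : IExp) {f : Ω → Store} (hf : MeasurableStore f) :
    Measurable fun ω => i.eval (f ω) := by
  induction i with
  | lit n => exact measurable_const
  | get a i ih => exact measurable_pick (F := fun k ω => (f ω).int a k) ih fun k => hf.int a k
  | add i j hi hj => exact hi.add hj
  | sub i j hi hj => exact hi.sub hj
  | mul i j hi hj => exact hi.mul hj

theorem continuous_errorFunction : Continuous errorFunction := by
  unfold errorFunction
  refine intervalIntegral.continuous_primitive (fun a b => ?_) 0
  exact Continuous.intervalIntegrable (by fun_prop) a b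

theorem RExp.measurable_eval (x : RExp) {f : Ω → Store} (hf : MeasurableStore f) :
    Measurable fun ω => x.eval (f ω) := by
  induction x with
  | ofInt i => exact (measurable_of_countable (fun n : ℕ => (n : ℝ))).comp (i.measurable_eval hf)
  | get a i =>
    exact measurable_pick (F := fun k ω => (f ω).real a k) (i.measurable_eval hf)
      fun k => hf.real a k
  | add x y hx hy => exact hx.add hy
  | sub x y hx hy => exact hx.sub hy
  | mul x y hx hy => exact hx.mul hy
  | div x y hx hy => exact hx.div hy
  | exp x hx => exact hx.exp
  | pow x y hx hy =>
    exact Measurable.ite (measurableSet_lt measurable_const hx) (hx.pow hy) measurable_const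
  | erf x hx => exact continuous_errorFunction.measurable.comp hx

theorem Test.measurableSet_holds (b : Test) {f : Ω → Store} (hf : MeasurableStore f) :
    MeasurableSet {ω | b.Holds (f ω)} := by
  induction b with
  | intLE i j => exact measurableSet_le (i.measurable_eval hf) (j.measurable_eval hf)
  | realLE x y => exact measurableSet_le (x.measurable_eval hf) (y.measurable_eval hf)
  | not b ih => exact ih.compl

theorem MeasurableStore.tick {f : Ω → Store} (hf : MeasurableStore f) (k : ℕ) :
    MeasurableStore fun ω => (f ω).tick k :=
  ⟨hf.int, hf.real, hf.drawn, hf.time.add measurable_const⟩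

theorem measurable_updateEntry {β : Type*} [MeasurableSpace β] {m : Ω → ℕ → ℕ → β} {n : Ω → ℕ}
    {v : Ω → β} (hm : ∀ a i, Measurable fun ω => m ω a i) (hn : Measurable n) (hv : Measurable v)
    (a b j : ℕ) :
    Measurable fun ω => Function.update (m ω) a (Function.update (m ω a) (n ω) (v ω)) b j := by
  by_cases hb : b = a
  · subst hb
    simp only [Function.update_self, Function.update_apply]
    exact Measurable.ite (measurableSet_eq_fun measurable_const hn) hv (hm b j)
  · simpa only [Function.update_of_ne hb] using hm b j

theorem MeasurableStore.setInt {f : Ω → Store} (hf : MeasurableStore f) (a : ℕ) {i v : Ω → ℕ}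
    (hi : Measurable i) (hv : Measurable v) :
    MeasurableStore fun ω => (f ω).setInt a (i ω) (v ω) :=
  ⟨fun b j => measurable_updateEntry hf.int hi hv a b j, hf.real, hf.drawn, hf.time⟩

theorem MeasurableStore.setReal {f : Ω → Store} (hf : MeasurableStore f) (a : ℕ) {i : Ω → ℕ}
    {v : Ω → ℝ} (hi : Measurable i) (hv : Measurable v) :
    MeasurableStore fun ω => (f ω).setReal a (i ω) (v ω) :=
  ⟨hf.int, fun b j => measurable_updateEntry hf.real hi hv a b j, hf.drawn, hf.time⟩

theorem MeasurableStore.whileUpTo (b : Test) {body : Ω → Store → Store}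
    (hbody : ∀ f : Ω → Store, MeasurableStore f → MeasurableStore fun ω => body ω (f ω))
    (n : ℕ) : ∀ f : Ω → Store, MeasurableStore f →
      MeasurableStore fun ω => whileUpTo b (body ω) n (f ω) := by
  induction n with
  | zero => exact fun f hf => hf
  | succ n ih =>
    intro f hf
    exact MeasurableStore.ite (b.measurableSet_holds hf)
      (ih _ (hbody _ (hf.tick b.cost))) (hf.tick b.cost)

theorem Program.measurable_exec (c : Program) {coins : Ω → ℕ → unitInterval}
    (hc : Measurable coins) : ∀ f : Ω → Store, MeasurableStore f →
      MeasurableStore fun ω => c.exec (coins ω) (f ω) := by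
  induction c with
  | skip => exact fun f hf => hf.tick 1
  | setInt a i v =>
    exact fun f hf => (hf.setInt a (i.measurable_eval hf) (v.measurable_eval hf)).tick _
  | setReal a i v =>
    exact fun f hf => (hf.setReal a (i.measurable_eval hf) (v.measurable_eval hf)).tick _
  | draw a i =>
    intro f hf
    have hv : Measurable fun ω => ((coins ω (f ω).drawn : unitInterval) : ℝ) :=
      measurable_subtype_coe.comp (measurable_pick (F := fun k ω => coins ω k) hf.drawn
        fun k => (measurable_pi_apply k).comp hc)
    have h := hf.setReal a (i.measurable_eval hf) hv
    exact ⟨h.int, h.real, hf.drawn.add measurable_const,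
      (hf.time.add measurable_const).add measurable_const⟩
  | seq c d ihc ihd => exact fun f hf => ihd _ (ihc f hf)
  | ite b c d ihc ihd =>
    exact fun f hf => MeasurableStore.ite (b.measurableSet_holds hf)
      (ihc _ (hf.tick b.cost)) (ihd _ (hf.tick b.cost))
  | loop n b c ih =>
    exact fun f hf => MeasurableStore.pick
      (F := fun k ω => _root_.whileUpTo b (c.exec (coins ω)) k ((f ω).tick (n.cost + 1)))
      (n.measurable_eval hf) fun k => MeasurableStore.whileUpTo b ih k _ (hf.tick _)

theorem measurable_runRounds {X : Type u} [Fintype X] [Nonempty X] [PseudoMetricSpace X]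
    (P : Program) (e : X ≃ Fin (Fintype.card X)) (T : ℕ) (l : ℕ → X → ℝ) {x : Ω → ℕ → X}
    (hx : ∀ t y, MeasurableSet {ω | x ω t = y}) {coins : Ω → ℕ → unitInterval}
    (hc : Measurable coins) (t : ℕ) :
    MeasurableStore fun ω => runRounds P e T l (x ω) (coins ω) t := by
  induction t with
  | zero => exact ⟨fun _ _ => measurable_const, fun _ _ => measurable_const, measurable_const,
      measurable_const⟩
  | succ t ih =>
    have hcode : Measurable fun ω => ((e (x ω t) : Fin _) : ℕ) := by
      let _ : MeasurableSpace X := ⊤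
      have h : Measurable fun ω => x ω t := measurable_to_countable' fun y => hx t y
      exact (measurable_of_countable fun y : X => ((e y : Fin _) : ℕ)).comp h
    refine P.measurable_exec hc _ ⟨fun a i => ?_, fun a i => ?_, ih.drawn, measurable_const⟩
    · exact measurable_updateEntry ih.int measurable_const hcode 2 a i
    · by_cases ha : a = 2
      · subst ha
        simp only [feed, Function.update_self]
        exact measurable_const
      · simpa only [feed, Function.update_of_ne ha] using ih.real a i

end Measurability

theorem runRounds_congr {X : Type u} [Fintype X] [Nonempty X] [PseudoMetricSpace X]
    (P : Program) (e : X ≃ Fin (Fintype.card X)) (T : ℕ) {l l' : ℕ → X → ℝ} {x x' : ℕ → X}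
    (coins : ℕ → unitInterval) (t : ℕ) (hl : ∀ s < t, l s = l' s) (hx : ∀ s < t, x s = x' s) :
    runRounds P e T l x coins t = runRounds P e T l' x' coins t := by
  induction t with
  | zero => rfl
  | succ t ih =>
    simp only [runRounds]
    rw [ih (fun s hs => hl s (by omega)) (fun s hs => hx s (by omega)), hl t (by omega),
      hx t (by omega)]

/-- The online algorithm that runs `B` as a black box, runs the program `P` on top of it with
independent uniform coins, and moves to the state that `P` outputs. -/
def overlay {X : Type u} [Fintype X] [Nonempty X] [PseudoMetricSpace X] {M : MTS X}
    (P : Program) (e : X ≃ Fin (Fintype.card X)) (T : ℕ) (B : OnlineAlgorithm.{u, w} M) :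
    OnlineAlgorithm.{u, w} M where
  Seed := B.Seed × (ℕ → unitInterval)
  law := B.law.prod (Measure.infinitePi fun _ => volume)
  act l t ω := decode e
    ((runRounds P e T (fun s => (l s : X → ℝ)) (fun s => B.act l s ω.1) ω.2 (t + 1)).int 3 0)
  causal l l' t h := by
    funext ω
    rw [runRounds_congr P e T ω.2 (t + 1) (fun s hs => by rw [h s (by omega)])
      (fun s hs => congrFun (B.causal l l' s fun r hr => h r (by omega)) ω.1)]
  measurable_act l t x := by
    have h := (measurable_runRounds P e T (fun s => (l s : X → ℝ))
      (x := fun (ω : B.Seed × (ℕ → unitInterval)) s => B.act l s ω.1) (coins := Prod.snd)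
      (fun s y => measurable_fst (B.measurable_act l s y)) measurable_snd (t + 1)).int 3 0
    exact h (MeasurableSet.of_discrete (s := {n | decode e n = x}))

end

/-! The core is a way of adding an expert `e` to a sequence `b` of states at almost no loss against
`b`. One uniform threshold is drawn for all rounds, and `e` is played when a bias has reached it.
The bias starts at a tiny weight `w` and is multiplied in each round by the exponential of a small
multiple of the advantage of `e` over `b`. In terms of the logarithm of the bias, the probability of
`e`, which is the capped bias, is the derivative of a convex potential. By convexity, the
probability of `e` times its advantage is at least the increase of the potential. The probability
changes by a relative amount of at most `θ` per round, so switching costs at most `θ * diam` per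
unit of probability, and the advantage is reduced by exactly this charge. Hence the mixture loses
against `b` only a leak proportional to `w` per round, even across restarts of the bias, where the
accumulated potential pays for the return to `b` (`integral_cost_mix_le`). Since the potential
dominates the scaled logarithm of the bias, the mixture also competes with `e` between two restarts,
at a price proportional to `log (1 / w)` (`integral_cost_mix_le'`).

The experts are perturbed leaders, one for each time scale `2 ^ j`, restarted every `2 ^ j` rounds.
The exponentiated cumulative loss of state `i` is multiplied by the noise `c i + 1 / N`. Because the
current loss is seen before moving, the leader's losses exceed those of a fixed state only by the
logarithmic range of the noise. Given the noise of the other states, `i` leads when its own noise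
lies in an initial interval, and it loses the lead only near the right end of that interval; so the
expected move is at most `2 * η * diam` (`integral_move_leader_le`). One set of noise serves all
scales and all restarts, because only the expected cost of each single leader matters.

The leaders are mixed in from the coarsest to the finest scale. On an aligned block of length `2 ^
j`, the mixture on that scale competes with its leader, whatever the coarser scales do, and all
finer mixtures restart at the beginning of the block, so that they add only their leaks
(`integral_cost_output_le`). For `w = 1 / T ^ 3` all leaks together stay below `12 * (1 + diam)`. On
the whole horizon every scale starts with a restart, so the output costs at most a constant more
than the base algorithm; this preserves the competitive ratio. An arbitrary interval splits into
aligned dyadic blocks whose lengths grow and then shrink geometrically, with at most one diameter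
lost per cut (`interval_le_of_dyadic_le`).

On the machine, each scale keeps a counter, a bias, the two previous states and `N` perturbed
losses, so a round takes time of order `N` times the number of scales. Loop invariants show that the
program outputs exactly this stacked sequence (`runRounds_output`). Fubini then reduces the
expectation to a fixed sequence of the base algorithm. -/

/-! ### Integrals over thresholds -/

theorem measurable_threshold {β : Type*} [MeasurableSpace β] (c : ℝ) (x y : β) :
    Measurable fun u : unitInterval => if (u : ℝ) ≤ c then x else y :=
  Measurable.ite (measurableSet_le measurable_subtype_coe measurable_const) measurable_const
    measurable_const

/-- A bias may exceed `1`, hence the cap. This turns choices made by a threshold into convex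
combinations. -/
theorem integral_threshold {c : ℝ} (hc : 0 ≤ c) (x y : ℝ) :
    ∫ u : unitInterval, (if (u : ℝ) ≤ c then x else y) = min 1 c * x + (1 - min 1 c) * y := by
  have hs : MeasurableSet {u : unitInterval | (u : ℝ) ≤ c} :=
    measurableSet_le measurable_subtype_coe measurable_const
  have hvol : volume.real {u : unitInterval | (u : ℝ) ≤ c} = min 1 c := by
    have himg : Subtype.val '' {u : unitInterval | (u : ℝ) ≤ c} = Set.Icc 0 (min 1 c) := by
      ext v
      simp only [Set.mem_image, Set.mem_ofPred_eq, Subtype.exists, Set.mem_Icc, le_min_iff]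
      constructor
      · rintro ⟨v, hv, h, rfl⟩
        exact ⟨hv.1, hv.2, h⟩
      · rintro ⟨h0, h1, h2⟩
        exact ⟨v, ⟨h0, h1⟩, h2, rfl⟩
    rw [measureReal_def, unitInterval.volume_apply, himg, Real.volume_Icc, sub_zero,
      ENNReal.toReal_ofReal (le_min zero_le_one hc)]
  have hfun : (fun u : unitInterval => if (u : ℝ) ≤ c then x else y)
      = fun u => Set.indicator {u : unitInterval | (u : ℝ) ≤ c} (fun _ => x - y) u + y := by
    funext u
    by_cases h : (u : ℝ) ≤ c <;> simp [Set.indicator, h]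
  rw [hfun, integral_add ((integrable_const _).indicator hs) (integrable_const _),
    integral_indicator_const _ hs, hvol]
  simp
  ring

theorem integrable_threshold (c x y : ℝ) :
    Integrable fun u : unitInterval => if (u : ℝ) ≤ c then x else y := by
  refine Integrable.of_bound (measurable_threshold c x y).aestronglyMeasurable (max ‖x‖ ‖y‖)
    (Filter.Eventually.of_forall fun u => ?_)
  split_ifs
  · exact le_max_left _ _
  · exact le_max_right _ _

/-! ### Products of exponentials that are restarted periodically -/

/-- `w` times the product of the factors `exp (z s)` over the rounds `s` from the last multiple of
`q` until `t`. -/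
noncomputable def accumulate (q : ℕ) (w : ℝ) (z : ℕ → ℝ) : ℕ → ℝ
  | 0 => w * Real.exp (z 0)
  | t + 1 => (if (t + 1) % q = 0 then w else accumulate q w z t) * Real.exp (z (t + 1))

theorem accumulate_restart {q : ℕ} (w : ℝ) (z : ℕ → ℝ) {t : ℕ} (h : t % q = 0) :
    accumulate q w z t = w * Real.exp (z t) := by
  cases t with
  | zero => rfl
  | succ t => simp [accumulate, h]

theorem accumulate_succ {q : ℕ} (w : ℝ) (z : ℕ → ℝ) {t : ℕ} (h : (t + 1) % q ≠ 0) :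
    accumulate q w z (t + 1) = accumulate q w z t * Real.exp (z (t + 1)) := by
  simp [accumulate, h]

theorem accumulate_eq_mul (q : ℕ) (w : ℝ) (z : ℕ → ℝ) (t : ℕ) :
    accumulate q w z t = w * accumulate q 1 z t := by
  induction t with
  | zero => simp [accumulate]
  | succ t ih =>
    by_cases h : (t + 1) % q = 0
    · simp [accumulate, h]
    · rw [accumulate_succ _ _ h, accumulate_succ _ _ h, ih, mul_assoc]

theorem accumulate_pos (q : ℕ) {w : ℝ} (hw : 0 < w) (z : ℕ → ℝ) (t : ℕ) :
    0 < accumulate q w z t := by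
  induction t with
  | zero => exact mul_pos hw (Real.exp_pos _)
  | succ t ih =>
    simp only [accumulate]
    split_ifs
    · exact mul_pos hw (Real.exp_pos _)
    · exact mul_pos ih (Real.exp_pos _)

theorem add_mod_ne_zero {q a i : ℕ} (ha : q ∣ a) (hi : i < q) (hi0 : i ≠ 0) :
    (a + i) % q ≠ 0 := by
  obtain ⟨c, rfl⟩ := ha
  rw [Nat.mul_add_mod, Nat.mod_eq_of_lt hi]
  exact hi0

/-- The only restart in the block is its first round, so the exponents add up. This makes the
logarithm of a bias or of a perturbed loss linear in the data of the block. -/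
theorem accumulate_block {q a : ℕ} (w : ℝ) (z : ℕ → ℝ) (ha : q ∣ a) {k : ℕ} (hk : k < q) :
    accumulate q w z (a + k) = w * Real.exp (∑ t ∈ Finset.Ico a (a + (k + 1)), z t) := by
  induction k with
  | zero => simp [accumulate_restart w z (Nat.mod_eq_zero_of_dvd ha)]
  | succ k ih =>
    have h := add_mod_ne_zero ha hk (Nat.succ_ne_zero k)
    have hacc : accumulate q w z (a + (k + 1))
        = accumulate q w z (a + k) * Real.exp (z (a + (k + 1))) := accumulate_succ w z h
    rw [hacc, ih (by omega), mul_assoc, ← Real.exp_add,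
      ← Nat.add_assoc a (k + 1) 1, Finset.sum_Ico_succ_top (by omega : a ≤ a + (k + 1))]

theorem measurable_accumulate {Ω : Type*} [MeasurableSpace Ω] (q : ℕ) {v : Ω → ℝ}
    {z : Ω → ℕ → ℝ} (hv : Measurable v) (hz : ∀ t, Measurable fun ω => z ω t) (t : ℕ) :
    Measurable fun ω => accumulate q (v ω) (z ω) t := by
  induction t with
  | zero => exact hv.mul (hz 0).exp
  | succ t ih =>
    simp only [accumulate]
    split_ifs
    · exact hv.mul (hz _).exp
    · exact ih.mul (hz _).exp

/-! ### The potential of a bias -/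

/-- The antiderivative of `x ↦ min 1 (exp x)` that vanishes at `-∞`, in terms of `y = exp x`. -/
noncomputable def biasPotential (y : ℝ) : ℝ := if y ≤ 1 then y else 1 + Real.log y

theorem min_one_le_biasPotential {y : ℝ} : min 1 y ≤ biasPotential y := by
  unfold biasPotential
  split_ifs with h
  · exact min_le_right _ _
  · have := Real.log_nonneg (le_of_lt (not_le.1 h))
    exact (min_le_left _ _).trans (by linarith)

theorem one_add_log_le_biasPotential {y : ℝ} (hy : 0 < y) : 1 + Real.log y ≤ biasPotential y := by
  unfold biasPotential
  split_ifs with h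
  · linarith [Real.log_le_sub_one_of_pos hy]
  · exact le_rfl

/-- In the variable `log y` the potential is convex with derivative `min 1 y`, and this is the
tangent inequality at the new point `log y + z`. The new point is the right one because the loss is
seen before the move. -/
theorem biasPotential_sub_le {y : ℝ} (hy : 0 < y) (z : ℝ) :
    biasPotential (y * Real.exp z) - biasPotential y ≤ min 1 (y * Real.exp z) * z := by
  have hlog : Real.log (y * Real.exp z) = Real.log y + z := by
    rw [Real.log_mul hy.ne' (Real.exp_pos z).ne', Real.log_exp]
  have hpos : 0 < y * Real.exp z := mul_pos hy (Real.exp_pos z)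
  have hyz : y = y * Real.exp z * Real.exp (-z) := by
    rw [mul_assoc, ← Real.exp_add, add_neg_cancel, Real.exp_zero, mul_one]
  have h1 : Real.log y ≤ y - 1 := Real.log_le_sub_one_of_pos hy
  set y' := y * Real.exp z with hy'
  unfold biasPotential
  split_ifs with ha hb hb
  · rw [min_eq_right ha]
    have := Real.add_one_le_exp (-z)
    nlinarith
  · rw [min_eq_right ha]
    have hly := Real.log_nonneg (le_of_lt (not_le.1 hb))
    have h3 : 1 - y'⁻¹ ≤ Real.log y' := by
      have := Real.log_le_sub_one_of_pos (inv_pos.2 hpos)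
      rw [Real.log_inv] at this
      linarith
    -- Here `z = log y' - log y` with `log y ≥ 0` and `y' ≤ 1`, so the claim reduces to this
    -- inequality.
    have h4 : y' - 1 ≤ y' * Real.log y' := by
      have := mul_le_mul_of_nonneg_left h3 hpos.le
      rw [mul_sub, mul_inv_cancel₀ hpos.ne'] at this
      linarith
    nlinarith
  · rw [min_eq_left (le_of_lt (not_le.1 ha)), hlog]
    linarith
  · rw [min_eq_left (le_of_lt (not_le.1 ha)), hlog]
    linarith

/-- Capping at `1` does not increase relative changes, and `exp (-z)` lies between `1 - θ` and `1 +
θ`. The resulting switching probability is what the term `K.diam * θ` in `advantage` pays for. -/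
theorem abs_min_one_sub_le {y z θ : ℝ} (hy : 0 < y) (hθ : θ ≤ 1) (hz : |z| ≤ θ / 2) :
    |min 1 (y * Real.exp z) - min 1 y| ≤ θ * min 1 (y * Real.exp z) := by
  have hpos : 0 < y * Real.exp z := mul_pos hy (Real.exp_pos z)
  have hyz : y = y * Real.exp z * Real.exp (-z) := by
    rw [mul_assoc, ← Real.exp_add, add_neg_cancel, Real.exp_zero, mul_one]
  have hz1 := abs_le.1 hz
  set y' := y * Real.exp z with hy'
  have hm : 0 < min 1 y' := lt_min one_pos hpos
  have hlow : 1 - θ ≤ Real.exp (-z) := by linarith [Real.add_one_le_exp (-z)]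
  have hupp : Real.exp (-z) ≤ 1 + θ := by
    have h2 := Real.abs_exp_sub_one_le (x := -z) (by rw [abs_neg]; linarith)
    rw [abs_neg] at h2
    have := (abs_le.1 h2).2
    linarith
  have h0 : 0 ≤ θ := by linarith [abs_nonneg z]
  rw [abs_le]
  constructor
  · have : min 1 y ≤ (1 + θ) * min 1 y' := by
      rw [mul_min_of_nonneg _ _ (by linarith)]
      refine min_le_min (by linarith) ?_
      rw [hyz, mul_comm]
      exact mul_le_mul_of_nonneg_right hupp hpos.le
    linarith
  · have : (1 - θ) * min 1 y' ≤ min 1 y := by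
      rw [mul_min_of_nonneg _ _ (by linarith)]
      refine min_le_min (by linarith) ?_
      rw [hyz, mul_comm y']
      exact mul_le_mul_of_nonneg_right hlow hpos.le
    linarith

/-! ### Tasks whose states are coded by natural numbers -/

/-- A bounded sequence of losses and a bounded movement cost on states coded by numbers. -/
structure CodedTask where
  diam : ℝ
  loss : ℕ → ℕ → ℝ
  move : ℕ → ℕ → ℝ
  loss_nonneg : ∀ t i, 0 ≤ loss t i
  loss_le_one : ∀ t i, loss t i ≤ 1
  move_nonneg : ∀ i j, 0 ≤ move i j
  move_le : ∀ i j, move i j ≤ diam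
  move_self : ∀ i, move i i = 0

namespace CodedTask

theorem diam_nonneg (K : CodedTask) : 0 ≤ K.diam := (K.move_nonneg 0 0).trans (K.move_le 0 0)

/-- The cost of the sequence `p` of states on the rounds `a, …, a + k - 1`. -/
noncomputable def cost (K : CodedTask) (p : ℕ → ℕ) (a k : ℕ) : ℝ :=
  ∑ t ∈ Finset.Ico a (a + k), K.loss t (p t)
    + ∑ t ∈ Finset.Ico (a + 1) (a + k), K.move (p t) (p (t - 1))

variable (K : CodedTask)

theorem cost_zero (p : ℕ → ℕ) (a : ℕ) : K.cost p a 0 = 0 := by simp [cost]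

theorem cost_one (p : ℕ → ℕ) (a : ℕ) : K.cost p a 1 = K.loss a (p a) := by simp [cost]

theorem cost_succ (p : ℕ → ℕ) (a k : ℕ) :
    K.cost p a (k + 2)
      = K.cost p a (k + 1) + (K.loss (a + k + 1) (p (a + k + 1))
        + K.move (p (a + k + 1)) (p (a + k))) := by
  unfold cost
  rw [← Nat.add_assoc a (k + 1) 1, ← Nat.add_assoc a k 1,
    Finset.sum_Ico_succ_top (by omega : a ≤ a + k + 1),
    Finset.sum_Ico_succ_top (by omega : a + 1 ≤ a + k + 1)]
  simp only [Nat.add_sub_cancel]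
  ring

theorem cost_nonneg (p : ℕ → ℕ) (a k : ℕ) : 0 ≤ K.cost p a k :=
  add_nonneg (Finset.sum_nonneg fun _ _ => K.loss_nonneg _ _)
    (Finset.sum_nonneg fun _ _ => K.move_nonneg _ _)

theorem cost_le (p : ℕ → ℕ) (a k : ℕ) : K.cost p a k ≤ (1 + K.diam) * k := by
  have hD := K.diam_nonneg
  match k with
  | 0 => simp [cost_zero]
  | 1 =>
    rw [cost_one]
    have := K.loss_le_one a (p a)
    push_cast
    linarith
  | k + 2 =>
    rw [cost_succ]
    have := cost_le p a (k + 1)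
    have := K.loss_le_one (a + k + 1) (p (a + k + 1))
    have := K.move_le (p (a + k + 1)) (p (a + k))
    push_cast at *
    linarith

/-- Cutting an interval loses only the move across the cut. -/
theorem cost_add_le (p : ℕ → ℕ) (a k n : ℕ) :
    K.cost p a (k + n) ≤ K.cost p a k + K.cost p (a + k) n + K.diam := by
  have hD := K.diam_nonneg
  induction n with
  | zero => simp [cost_zero, hD]
  | succ n ih =>
    cases k with
    | zero => simp [cost_zero, hD]
    | succ k =>
      have h1 := K.cost_succ p a (k + n)
      have h2 : k + 1 + (n + 1) = k + n + 2 := by omega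
      have h3 : k + 1 + n = k + n + 1 := by omega
      rw [h2, h1]
      rw [h3] at ih
      cases n with
      | zero =>
        have := K.move_le (p (a + (k + 0) + 1)) (p (a + (k + 0)))
        simp only [cost_zero, cost_one, zero_add, Nat.add_zero] at *
        rw [← Nat.add_assoc a k 1]
        linarith
      | succ n =>
        rw [K.cost_succ p (a + (k + 1)) n]
        have e1 : a + (k + (n + 1)) + 1 = a + (k + 1) + n + 1 := by omega
        have e2 : a + (k + (n + 1)) = a + (k + 1) + n := by omega
        rw [e1, e2]
        linarith

section RandomPath

variable {Ω : Type*} [MeasurableSpace Ω]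

theorem measurable_loss {p : Ω → ℕ → ℕ} (hp : ∀ t, Measurable fun ω => p ω t) (t : ℕ) :
    Measurable fun ω => K.loss t (p ω t) :=
  (measurable_of_countable (K.loss t)).comp (hp t)

theorem measurable_move {x y : Ω → ℕ} (hx : Measurable x) (hy : Measurable y) :
    Measurable fun ω => K.move (x ω) (y ω) :=
  (measurable_of_countable fun z : ℕ × ℕ => K.move z.1 z.2).comp (hx.prodMk hy)

theorem measurable_cost {p : Ω → ℕ → ℕ} (hp : ∀ t, Measurable fun ω => p ω t) (a k : ℕ) :
    Measurable fun ω => K.cost (p ω) a k :=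
  (Finset.measurable_fun_sum _ fun t _ => K.measurable_loss hp t).add
    (Finset.measurable_fun_sum _ fun t _ => K.measurable_move (hp t) (hp (t - 1)))

variable (μ : Measure Ω) [IsFiniteMeasure μ]

theorem integrable_loss {p : Ω → ℕ → ℕ} (hp : ∀ t, Measurable fun ω => p ω t) (t : ℕ) :
    Integrable (fun ω => K.loss t (p ω t)) μ :=
  Integrable.of_bound (K.measurable_loss hp t).aestronglyMeasurable 1
    (Filter.Eventually.of_forall fun ω => by
      rw [Real.norm_of_nonneg (K.loss_nonneg _ _)]
      exact K.loss_le_one _ _)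

theorem integrable_move {x y : Ω → ℕ} (hx : Measurable x) (hy : Measurable y) :
    Integrable (fun ω => K.move (x ω) (y ω)) μ :=
  Integrable.of_bound (K.measurable_move hx hy).aestronglyMeasurable K.diam
    (Filter.Eventually.of_forall fun ω => by
      rw [Real.norm_of_nonneg (K.move_nonneg _ _)]
      exact K.move_le _ _)

theorem integrable_cost {p : Ω → ℕ → ℕ} (hp : ∀ t, Measurable fun ω => p ω t) (a k : ℕ) :
    Integrable (fun ω => K.cost (p ω) a k) μ :=
  Integrable.of_bound (K.measurable_cost hp a k).aestronglyMeasurable ((1 + K.diam) * k)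
    (Filter.Eventually.of_forall fun ω => by
      rw [Real.norm_of_nonneg (K.cost_nonneg _ _ _)]
      exact K.cost_le _ _ _)

theorem integral_cost_succ {p : Ω → ℕ → ℕ} (hp : ∀ t, Measurable fun ω => p ω t) (a k : ℕ) :
    ∫ ω, K.cost (p ω) a (k + 2) ∂μ
      = ∫ ω, K.cost (p ω) a (k + 1) ∂μ + (∫ ω, K.loss (a + k + 1) (p ω (a + k + 1)) ∂μ
        + ∫ ω, K.move (p ω (a + k + 1)) (p ω (a + k)) ∂μ) := by
  have h : Integrable (fun ω => K.loss (a + k + 1) (p ω (a + k + 1))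
      + K.move (p ω (a + k + 1)) (p ω (a + k))) μ :=
    (K.integrable_loss μ hp _).add (K.integrable_move μ (hp _) (hp _))
  simp only [cost_succ]
  rw [integral_add (K.integrable_cost μ hp _ _) h,
    integral_add (K.integrable_loss μ hp _) (K.integrable_move μ (hp _) (hp _))]

end RandomPath

/-! ### Switching between two sequences of states at a random threshold -/

/-- The state before round `t`; before the first round, this is the state with code `0`. -/
def previous (p : ℕ → ℕ) : ℕ → ℕ
  | 0 => 0
  | t + 1 => p t

/-- The scaled advantage of the sequence `e` over the sequence `b` in round `t`, less a charge for
the switches. -/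
noncomputable def advantage (θ : ℝ) (b e : ℕ → ℕ) (t : ℕ) : ℝ :=
  θ * (K.loss t (b t) + K.move (b t) (previous b t) - (K.loss t (e t) + K.move (e t) (previous e t))
    - K.diam * θ) / (4 * (1 + K.diam))

/-- The probability with which `mix` plays `e` is the bias, capped at `1`. -/
noncomputable def bias (q : ℕ) (w θ : ℝ) (b e : ℕ → ℕ) : ℕ → ℝ :=
  accumulate q w (K.advantage θ b e)

/-- Play `e` in those rounds in which the bias has reached the threshold `v`, and `b` otherwise. -/
noncomputable def mix (q : ℕ) (w θ : ℝ) (b e : ℕ → ℕ) (v : unitInterval) (t : ℕ) : ℕ :=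
  if (v : ℝ) ≤ K.bias q w θ b e t then e t else b t

/-- The difference of costs less the charge is at most `2 * (1 + K.diam)` in absolute value. The
factor `4` in the denominator is chosen to give the `θ / 2` that `abs_min_one_sub_le` requires. -/
theorem abs_advantage_le {θ : ℝ} (h0 : 0 ≤ θ) (h1 : θ ≤ 1) (b e : ℕ → ℕ) (t : ℕ) :
    |K.advantage θ b e t| ≤ θ / 2 := by
  have hD := K.diam_nonneg
  unfold advantage
  have := K.loss_nonneg t (b t)
  have := K.loss_nonneg t (e t)
  have := K.loss_le_one t (b t)
  have := K.loss_le_one t (e t)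
  have := K.move_nonneg (b t) (previous b t)
  have := K.move_nonneg (e t) (previous e t)
  have := K.move_le (b t) (previous b t)
  have := K.move_le (e t) (previous e t)
  have hDθ : K.diam * θ ≤ K.diam := mul_le_of_le_one_right hD h1
  have hDθ0 : 0 ≤ K.diam * θ := mul_nonneg hD h0
  rw [abs_div, abs_of_pos (by linarith : (0 : ℝ) < 4 * (1 + K.diam)), div_le_iff₀ (by linarith),
    abs_mul, abs_of_nonneg h0]
  have : |K.loss t (b t) + K.move (b t) (previous b t)
      - (K.loss t (e t) + K.move (e t) (previous e t)) - K.diam * θ| ≤ 2 * (1 + K.diam) := by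
    rw [abs_le]
    constructor <;> linarith
  nlinarith

section Mix

variable {q : ℕ} {w θ : ℝ} (b e : ℕ → ℕ)

theorem measurable_mix (t : ℕ) : Measurable fun v => K.mix q w θ b e v t :=
  measurable_threshold _ _ _

theorem integral_loss_mix (hw : 0 < w) (t : ℕ) :
    ∫ v, K.loss t (K.mix q w θ b e v t)
      = min 1 (K.bias q w θ b e t) * K.loss t (e t)
        + (1 - min 1 (K.bias q w θ b e t)) * K.loss t (b t) := by
  have hpos : 0 ≤ K.bias q w θ b e t := (accumulate_pos q hw _ t).le
  rw [← integral_threshold hpos]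
  congr 1
  funext v
  unfold mix
  split_ifs <;> rfl

/-- Both rounds use the same threshold, so the mixture changes sides only if the threshold separates
the two capped biases, and then a diameter is charged. Otherwise it makes the move of the sequence
that it follows. -/
theorem integral_move_mix_le (hw : 0 < w) (t : ℕ) :
    ∫ v, K.move (K.mix q w θ b e v (t + 1)) (K.mix q w θ b e v t)
      ≤ min 1 (K.bias q w θ b e (t + 1)) * K.move (e (t + 1)) (e t)
        + (1 - min 1 (K.bias q w θ b e (t + 1))) * K.move (b (t + 1)) (b t)
        + K.diam * |min 1 (K.bias q w θ b e (t + 1)) - min 1 (K.bias q w θ b e t)| := by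
  set c' := K.bias q w θ b e (t + 1) with hc'
  set c := K.bias q w θ b e t with hc
  have hp : 0 ≤ c := (accumulate_pos q hw _ t).le
  have hp' : 0 ≤ c' := (accumulate_pos q hw _ (t + 1)).le
  have habs : ∫ v : unitInterval,
      |(if (v : ℝ) ≤ c' then (1 : ℝ) else 0) - (if (v : ℝ) ≤ c then 1 else 0)|
        = |min 1 c' - min 1 c| := by
    rcases le_total c c' with h | h
    · have h2 : ∀ v : unitInterval,
          |(if (v : ℝ) ≤ c' then (1 : ℝ) else 0) - (if (v : ℝ) ≤ c then 1 else 0)|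
            = (if (v : ℝ) ≤ c' then (1 : ℝ) else 0) - (if (v : ℝ) ≤ c then 1 else 0) := by
        intro v
        refine abs_of_nonneg ?_
        split_ifs <;> first | (exfalso; linarith) | norm_num
      simp only [h2]
      rw [integral_sub (integrable_threshold _ _ _) (integrable_threshold _ _ _),
        integral_threshold hp, integral_threshold hp',
        abs_of_nonneg (sub_nonneg.2 (min_le_min le_rfl h))]
      ring
    · have h2 : ∀ v : unitInterval,
          |(if (v : ℝ) ≤ c' then (1 : ℝ) else 0) - (if (v : ℝ) ≤ c then 1 else 0)|
            = (if (v : ℝ) ≤ c then (1 : ℝ) else 0) - (if (v : ℝ) ≤ c' then 1 else 0) := by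
        intro v
        rw [abs_sub_comm]
        refine abs_of_nonneg ?_
        split_ifs <;> first | (exfalso; linarith) | norm_num
      simp only [h2]
      rw [integral_sub (integrable_threshold _ _ _) (integrable_threshold _ _ _),
        integral_threshold hp, integral_threshold hp', abs_sub_comm,
        abs_of_nonneg (sub_nonneg.2 (min_le_min le_rfl h))]
      ring
  rw [← integral_threshold hp', ← habs, ← integral_const_mul]
  have hi : Integrable fun v : unitInterval => K.diam *
      |(if (v : ℝ) ≤ c' then (1 : ℝ) else 0) - (if (v : ℝ) ≤ c then 1 else 0)| :=
    ((integrable_threshold _ _ _).sub (integrable_threshold _ _ _)).abs.const_mul _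
  rw [← integral_add (integrable_threshold _ _ _) hi]
  refine integral_mono (K.integrable_move _ (K.measurable_mix b e _) (K.measurable_mix b e _))
    ((integrable_threshold _ _ _).add hi) fun v => ?_
  have hD := K.diam_nonneg
  simp only [mix, ← hc, ← hc']
  by_cases h1 : (v : ℝ) ≤ c' <;> by_cases h2 : (v : ℝ) ≤ c <;> simp only [h1, h2, if_true, if_false]
  · simp
  · have := K.move_le (e (t + 1)) (b t)
    have := K.move_nonneg (e (t + 1)) (e t)
    norm_num
    linarith
  · have := K.move_le (b (t + 1)) (e t)
    have := K.move_nonneg (b (t + 1)) (b t)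
    norm_num
    linarith
  · simp

/-- A cruder bound for restarts, where the bias may drop sharply: each of the two rounds in which
`e` is played is charged a diameter, and otherwise the move is that of `b`. -/
theorem integral_move_mix_le' (hw : 0 < w) (t : ℕ) :
    ∫ v, K.move (K.mix q w θ b e v (t + 1)) (K.mix q w θ b e v t)
      ≤ K.move (b (t + 1)) (b t)
        + K.diam * (min 1 (K.bias q w θ b e (t + 1)) + min 1 (K.bias q w θ b e t)) := by
  set c' := K.bias q w θ b e (t + 1) with hc'
  set c := K.bias q w θ b e t with hc
  have hp : 0 ≤ c := (accumulate_pos q hw _ t).le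
  have hp' : 0 ≤ c' := (accumulate_pos q hw _ (t + 1)).le
  have hi : Integrable fun v : unitInterval =>
      (if (v : ℝ) ≤ c' then K.diam else 0) + (if (v : ℝ) ≤ c then K.diam else 0) :=
    (integrable_threshold _ _ _).add (integrable_threshold _ _ _)
  have h := integral_threshold hp K.diam 0
  have h' := integral_threshold hp' K.diam 0
  have hc1 : ∫ _ : unitInterval, K.move (b (t + 1)) (b t) = K.move (b (t + 1)) (b t) := by simp
  have : K.move (b (t + 1)) (b t) + K.diam * (min 1 c' + min 1 c)
      = ∫ v : unitInterval, (K.move (b (t + 1)) (b t)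
        + ((if (v : ℝ) ≤ c' then K.diam else 0) + (if (v : ℝ) ≤ c then K.diam else 0))) := by
    rw [integral_add (integrable_const _) hi,
      integral_add (integrable_threshold _ _ _) (integrable_threshold _ _ _), h, h', hc1]
    ring
  rw [this]
  refine integral_mono (K.integrable_move _ (K.measurable_mix b e _) (K.measurable_mix b e _))
    ((integrable_const _).add hi)
    fun v => ?_
  have hD := K.diam_nonneg
  have := K.move_nonneg (b (t + 1)) (b t)
  simp only [mix, ← hc, ← hc']
  by_cases h1 : (v : ℝ) ≤ c' <;> by_cases h2 : (v : ℝ) ≤ c <;> simp only [h1, h2, if_true, if_false]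
  · linarith [K.move_le (e (t + 1)) (e t)]
  · linarith [K.move_le (e (t + 1)) (b t)]
  · linarith [K.move_le (b (t + 1)) (e t)]
  · linarith

/-- The potential that pays for switching back to `b`. -/
noncomputable def potential (q : ℕ) (w θ : ℝ) (b e : ℕ → ℕ) (t : ℕ) : ℝ :=
  4 * (1 + K.diam) / θ * biasPotential (K.bias q w θ b e t)

/-- The loss per round relative to `b`. -/
noncomputable def leak (w θ : ℝ) : ℝ := w * (4 * (1 + K.diam) / θ + 4 * K.diam)

theorem leak_nonneg (hw : 0 ≤ w) (hθ : 0 ≤ θ) : 0 ≤ K.leak w θ := by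
  have := K.diam_nonneg
  unfold leak
  positivity

theorem bias_restart_le (hw : 0 < w) (h0 : 0 < θ) (h1 : θ ≤ 1) {t : ℕ} (ht : t % q = 0) :
    K.bias q w θ b e t ≤ 2 * w := by
  have hz := abs_le.1 (K.abs_advantage_le h0.le h1 b e t)
  have h2 := Real.abs_exp_sub_one_le (x := K.advantage θ b e t)
    ((K.abs_advantage_le h0.le h1 b e t).trans (by linarith))
  have h3 := (abs_le.1 h2).2
  have h4 := K.abs_advantage_le h0.le h1 b e t
  rw [bias, accumulate_restart _ _ ht]
  nlinarith

/-- The potential inequality in a round at whose beginning the bias is `y`. -/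
theorem potential_step (h0 : 0 < θ) {t : ℕ} {y : ℝ} (hy : 0 < y)
    (hb : K.bias q w θ b e t = y * Real.exp (K.advantage θ b e t)) :
    K.potential q w θ b e t - 4 * (1 + K.diam) / θ * biasPotential y
      ≤ min 1 (K.bias q w θ b e t) * (K.loss t (b t) + K.move (b t) (previous b t)
        - (K.loss t (e t) + K.move (e t) (previous e t)) - K.diam * θ) := by
  have hD := K.diam_nonneg
  have h := biasPotential_sub_le hy (K.advantage θ b e t)
  rw [← hb] at h
  have hη : 0 < 4 * (1 + K.diam) / θ := by positivity
  have h2 := mul_le_mul_of_nonneg_left h hη.le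
  rw [mul_sub] at h2
  refine h2.trans (le_of_eq ?_)
  unfold advantage
  field_simp

/-- Away from restarts, the excess over `b` is at most the capped bias times the cost difference
plus the switching charge, which `potential_step` bounds by minus the increase of the potential. At
a restart the leak collects the potential of the fresh weight `w` and two terms of at most `2 * w *
K.diam`, for switching to `e` and for the move of `b`. -/
theorem integral_cost_step (hw : 0 < w) (hw1 : w ≤ 1) (h0 : 0 < θ) (h1 : θ ≤ 1) (t : ℕ) :
    (∫ v, K.loss (t + 1) (K.mix q w θ b e v (t + 1)))
      + ∫ v, K.move (K.mix q w θ b e v (t + 1)) (K.mix q w θ b e v t)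
      ≤ K.loss (t + 1) (b (t + 1)) + K.move (b (t + 1)) (b t)
        - (K.potential q w θ b e (t + 1) - K.potential q w θ b e t) + K.leak w θ := by
  have hD := K.diam_nonneg
  rw [K.integral_loss_mix b e hw]
  have hg : 0 < min 1 (K.bias q w θ b e (t + 1)) := lt_min one_pos (accumulate_pos q hw _ _)
  by_cases ht : (t + 1) % q = 0
  · have hmove := K.integral_move_mix_le' (q := q) (θ := θ) b e hw t
    have hpot := K.potential_step b e h0 hw (accumulate_restart w (K.advantage θ b e) ht)
    -- The potential accumulated before the restart pays for returning to `b`.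
    have hret : K.diam * min 1 (K.bias q w θ b e t) ≤ K.potential q w θ b e t := by
      have h2 : K.diam ≤ 4 * (1 + K.diam) / θ := by
        rw [le_div_iff₀ h0]
        nlinarith
      exact mul_le_mul h2 min_one_le_biasPotential
        (le_min zero_le_one (accumulate_pos q hw _ _).le) (by positivity)
    have hsmall : min 1 (K.bias q w θ b e (t + 1)) ≤ 2 * w :=
      (min_le_right _ _).trans (K.bias_restart_le b e hw h0 h1 ht)
    have hw' : biasPotential w = w := by simp [biasPotential, hw1]
    rw [hw'] at hpot
    unfold leak
    have e1 := K.move_nonneg (e (t + 1)) (previous e (t + 1))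
    have e2 := K.move_le (b (t + 1)) (b t)
    set g := min 1 (K.bias q w θ b e (t + 1))
    set g0 := min 1 (K.bias q w θ b e t)
    have e3 : 0 ≤ g * K.move (e (t + 1)) (previous e (t + 1)) := by positivity
    have e4 : g * K.move (b (t + 1)) (b t) ≤ g * K.diam := mul_le_mul_of_nonneg_left e2 hg.le
    have e5 : g * K.diam ≤ 2 * w * K.diam := mul_le_mul_of_nonneg_right hsmall hD
    have e6 : 0 ≤ g * (K.diam * θ) := by positivity
    simp only [previous] at hpot e3
    nlinarith
  · have hmove := K.integral_move_mix_le (q := q) (θ := θ) b e hw t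
    have hb : K.bias q w θ b e (t + 1)
        = K.bias q w θ b e t * Real.exp (K.advantage θ b e (t + 1)) :=
      accumulate_succ w (K.advantage θ b e) ht
    have hpot := K.potential_step b e h0 (accumulate_pos q hw (K.advantage θ b e) t) hb
    have hvar := abs_min_one_sub_le (accumulate_pos q hw (K.advantage θ b e) t) h1
      (K.abs_advantage_le h0.le h1 b e (t + 1))
    have hleak := K.leak_nonneg hw.le h0.le
    change |min 1 (K.bias q w θ b e t * _) - min 1 (K.bias q w θ b e t)|
      ≤ θ * min 1 (K.bias q w θ b e t * _) at hvar
    rw [← hb] at hvar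
    have hvar' := mul_le_mul_of_nonneg_left hvar hD
    change K.potential q w θ b e (t + 1) - K.potential q w θ b e t ≤ _ at hpot
    simp only [previous] at hpot
    nlinarith

/-- The advantage contains the moves into round `a`, which the cost of the interval does not. The
one of `b` is weighted by a bias of at most `2 * w` and goes into the leak. -/
theorem integral_cost_start (hw : 0 < w) (hw1 : w ≤ 1) (h0 : 0 < θ) (h1 : θ ≤ 1) {a : ℕ}
    (ha : a % q = 0) :
    ∫ v, K.loss a (K.mix q w θ b e v a)
      ≤ K.loss a (b a) - K.potential q w θ b e a + K.leak w θ := by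
  have hD := K.diam_nonneg
  rw [K.integral_loss_mix b e hw]
  have hg : 0 < min 1 (K.bias q w θ b e a) := lt_min one_pos (accumulate_pos q hw _ _)
  have hpot := K.potential_step b e h0 hw (accumulate_restart w (K.advantage θ b e) ha)
  have hsmall : min 1 (K.bias q w θ b e a) ≤ 2 * w :=
    (min_le_right _ _).trans (K.bias_restart_le b e hw h0 h1 ha)
  have hw' : biasPotential w = w := by simp [biasPotential, hw1]
  rw [hw'] at hpot
  unfold leak
  have e1 := K.move_nonneg (e a) (previous e a)
  have e2 := K.move_le (b a) (previous b a)
  set g := min 1 (K.bias q w θ b e a)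
  have e3 : 0 ≤ g * K.move (e a) (previous e a) := by positivity
  have e4 : g * K.move (b a) (previous b a) ≤ g * K.diam := mul_le_mul_of_nonneg_left e2 hg.le
  have e5 : g * K.diam ≤ 2 * w * K.diam := mul_le_mul_of_nonneg_right hsmall hD
  have e6 : 0 ≤ g * (K.diam * θ) := by positivity
  have e7 : 0 ≤ w * K.diam := by positivity
  nlinarith

/-- The mixture costs hardly more than `b` on every interval that begins with a restart. -/
theorem integral_cost_mix_le (hw : 0 < w) (hw1 : w ≤ 1) (h0 : 0 < θ) (h1 : θ ≤ 1) {a : ℕ}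
    (ha : a % q = 0) (k : ℕ) :
    ∫ v, K.cost (K.mix q w θ b e v) a (k + 1)
      ≤ K.cost b a (k + 1) - K.potential q w θ b e (a + k) + (k + 1) * K.leak w θ := by
  induction k with
  | zero =>
    simp only [zero_add, cost_one]
    have := K.integral_cost_start b e hw hw1 h0 h1 ha
    simpa using this
  | succ k ih =>
    rw [K.integral_cost_succ _ (K.measurable_mix b e), K.cost_succ b]
    have := K.integral_cost_step (q := q) b e hw hw1 h0 h1 (a + k)
    rw [← Nat.add_assoc a k 1]
    push_cast at *
    linarith

/-- On an interval between two restarts, the mixture competes with `e`. -/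
theorem integral_cost_mix_le' (hw : 0 < w) (hw1 : w ≤ 1) (h0 : 0 < θ) (h1 : θ ≤ 1) {a : ℕ}
    (ha : q ∣ a) {k : ℕ} (hk : k + 1 ≤ q) :
    ∫ v, K.cost (K.mix q w θ b e v) a (k + 1)
      ≤ K.cost e a (k + 1) + (4 * (1 + K.diam) / θ * Real.log (1 / w) + K.diam
        + (k + 1) * (K.diam * θ + K.leak w θ)) := by
  have hD := K.diam_nonneg
  have hmix := K.integral_cost_mix_le b e hw hw1 h0 h1 (Nat.mod_eq_zero_of_dvd ha) k
  have hη : 0 < 4 * (1 + K.diam) / θ := by positivity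
  -- The potential is at least the scaled logarithm of the bias, that is, the total unscaled
  -- advantage minus the scaled `log (1 / w)`. Inserted into `hmix`, this replaces the cost of `b`
  -- by that of `e`.
  have hpot : 4 * (1 + K.diam) / θ * (-Real.log (1 / w))
      + ∑ t ∈ Finset.Ico a (a + (k + 1)), (K.loss t (b t) + K.move (b t) (previous b t)
        - (K.loss t (e t) + K.move (e t) (previous e t)) - K.diam * θ)
      ≤ K.potential q w θ b e (a + k) := by
    have hb : K.bias q w θ b e (a + k) = _ := accumulate_block w (K.advantage θ b e) ha hk
    have hlog := one_add_log_le_biasPotential (accumulate_pos q hw (K.advantage θ b e) (a + k))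
    change 1 + Real.log (K.bias q w θ b e (a + k)) ≤ biasPotential (K.bias q w θ b e (a + k))
      at hlog
    have h2 : -Real.log (1 / w) + ∑ t ∈ Finset.Ico a (a + (k + 1)), K.advantage θ b e t
        ≤ biasPotential (K.bias q w θ b e (a + k)) := by
      rw [hb, Real.log_mul hw.ne' (Real.exp_pos _).ne', Real.log_exp, ← hb] at hlog
      rw [one_div, Real.log_inv]
      linarith
    have h3 := mul_le_mul_of_nonneg_left h2 hη.le
    rw [mul_add, Finset.mul_sum] at h3
    refine le_trans (le_of_eq ?_) h3
    congr 1
    refine Finset.sum_congr rfl fun t _ => ?_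
    unfold advantage
    field_simp
  have hsum : ∀ p : ℕ → ℕ, ∑ t ∈ Finset.Ico a (a + (k + 1)),
      (K.loss t (p t) + K.move (p t) (previous p t))
        = K.cost p a (k + 1) + K.move (p a) (previous p a) := by
    intro p
    unfold cost
    rw [Finset.sum_add_distrib, Finset.sum_eq_sum_Ico_succ_bot (by omega : a < a + (k + 1))
      (fun t => K.move (p t) (previous p t))]
    have : ∑ t ∈ Finset.Ico (a + 1) (a + (k + 1)), K.move (p t) (previous p t)
        = ∑ t ∈ Finset.Ico (a + 1) (a + (k + 1)), K.move (p t) (p (t - 1)) := by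
      refine Finset.sum_congr rfl fun t ht => ?_
      obtain ⟨s, rfl⟩ : ∃ s, t = s + 1 := ⟨t - 1, by have := Finset.mem_Ico.1 ht; omega⟩
      simp [previous]
    rw [this]
    ring
  rw [Finset.sum_sub_distrib, Finset.sum_sub_distrib, hsum, hsum] at hpot
  simp only [Finset.sum_const, Nat.card_Ico, nsmul_eq_mul] at hpot
  rw [show a + (k + 1) - a = k + 1 by omega] at hpot
  -- Of the moves into round `a`, the one of `b` has the favourable sign and the one of `e` costs at
  -- most the additive diameter.
  have e1 := K.move_nonneg (b a) (previous b a)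
  have e2 := K.move_le (e a) (previous e a)
  push_cast at hpot
  nlinarith

end Mix

end CodedTask

/-! ### Resampling one coordinate of a product measure -/

section Resample

variable {Y : Type*} [MeasurableSpace Y] (μ : Measure Y) [IsProbabilityMeasure μ]

theorem measurable_update_pair (p : ℕ) :
    Measurable fun z : (ℕ → Y) × Y => Function.update z.1 p z.2 := by
  refine measurable_pi_lambda _ fun i => ?_
  by_cases h : i = p
  · subst h
    simpa using measurable_snd
  · simp only [Function.update_of_ne h]
    exact (measurable_pi_apply i).comp measurable_fst

/-- Replacing a coordinate by an independent copy preserves the law; on a finite cylinder, the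
factor at `p` comes from the new variable. -/
theorem map_update_infinitePi (p : ℕ) :
    ((Measure.infinitePi fun _ : ℕ => μ).prod μ).map
      (fun z : (ℕ → Y) × Y => Function.update z.1 p z.2) = Measure.infinitePi fun _ : ℕ => μ := by
  refine Measure.eq_infinitePi (fun _ : ℕ => μ) fun s t ht => ?_
  rw [Measure.map_apply (measurable_update_pair p) (MeasurableSet.pi s.countable_toSet
    fun i _ => ht i)]
  by_cases hp : p ∈ s
  · have : (fun z : (ℕ → Y) × Y => Function.update z.1 p z.2) ⁻¹' (Set.pi s t)
        = (Set.pi (s.erase p) t) ×ˢ t p := by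
      ext z
      simp only [Set.mem_preimage, Set.mem_pi, Set.mem_prod, Finset.coe_erase, Set.mem_sdiff,
        Finset.mem_coe, Set.mem_singleton_iff]
      constructor
      · intro h
        refine ⟨fun i hi => ?_, ?_⟩
        · simpa [Function.update_of_ne hi.2] using h i hi.1
        · simpa using h p hp
      · rintro ⟨h1, h2⟩ i hi
        by_cases hip : i = p
        · subst hip
          simpa using h2
        · simpa [Function.update_of_ne hip] using h1 i ⟨hi, hip⟩
    rw [this, Measure.prod_prod, Measure.infinitePi_pi _ fun i _ => ht i, mul_comm,
      Finset.mul_prod_erase s (fun i => μ (t i)) hp]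
  · have : (fun z : (ℕ → Y) × Y => Function.update z.1 p z.2) ⁻¹' (Set.pi s t)
        = (Set.pi s t) ×ˢ Set.univ := by
      ext z
      simp only [Set.mem_preimage, Set.mem_pi, Set.mem_prod, Finset.mem_coe, Set.mem_univ, and_true]
      refine forall₂_congr fun i hi => ?_
      rw [Function.update_of_ne (ne_of_mem_of_not_mem hi hp)]
    rw [this, Measure.prod_prod, Measure.infinitePi_pi _ fun i _ => ht i, measure_univ, mul_one]

theorem measurable_update_right (p : ℕ) (c : ℕ → Y) :
    Measurable fun v : Y => Function.update c p v :=
  (measurable_update_pair p).comp (measurable_const.prodMk measurable_id)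

theorem integrable_update {F : (ℕ → Y) → ℝ} {B : ℝ} (hF : Measurable F) (hB : ∀ c, |F c| ≤ B)
    (p : ℕ) : Integrable (fun c => ∫ v, F (Function.update c p v) ∂μ)
      (Measure.infinitePi fun _ : ℕ => μ) := by
  have h : Integrable (fun z : (ℕ → Y) × Y => F (Function.update z.1 p z.2))
      ((Measure.infinitePi fun _ : ℕ => μ).prod μ) :=
    Integrable.of_bound (hF.comp (measurable_update_pair p)).aestronglyMeasurable B
      (Filter.Eventually.of_forall fun z => hB _)
  exact h.integral_prod_left

theorem integral_update {F : (ℕ → Y) → ℝ} {B : ℝ} (hF : Measurable F) (hB : ∀ c, |F c| ≤ B)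
    (p : ℕ) : ∫ c, F c ∂(Measure.infinitePi fun _ : ℕ => μ)
      = ∫ c, ∫ v, F (Function.update c p v) ∂μ ∂(Measure.infinitePi fun _ : ℕ => μ) := by
  have h : Integrable (fun z : (ℕ → Y) × Y => F (Function.update z.1 p z.2))
      ((Measure.infinitePi fun _ : ℕ => μ).prod μ) :=
    Integrable.of_bound (hF.comp (measurable_update_pair p)).aestronglyMeasurable B
      (Filter.Eventually.of_forall fun z => hB _)
  rw [← integral_prod _ h]
  conv_lhs => rw [← map_update_infinitePi μ p]
  exact integral_map (measurable_update_pair p).aemeasurable hF.aestronglyMeasurable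

/-- An inequality between conditional expectations given all coordinates but one implies the
inequality between the expectations. -/
theorem integral_le_of_update {F G : (ℕ → Y) → ℝ} {B B' : ℝ} (hF : Measurable F)
    (hFB : ∀ c, |F c| ≤ B) (hG : Measurable G) (hGB : ∀ c, |G c| ≤ B') (p : ℕ)
    (h : ∀ c, ∫ v, F (Function.update c p v) ∂μ ≤ ∫ v, G (Function.update c p v) ∂μ) :
    ∫ c, F c ∂(Measure.infinitePi fun _ : ℕ => μ)
      ≤ ∫ c, G c ∂(Measure.infinitePi fun _ : ℕ => μ) := by
  rw [integral_update μ hF hFB p, integral_update μ hG hGB p]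
  exact integral_mono (integrable_update μ hF hFB p) (integrable_update μ hG hGB p) h

end Resample

/-! ### The index of a minimum -/

open Classical in
/-- The last index of a minimum of `v 0, …, v (n - 1)`. -/
noncomputable def minIndex (v : ℕ → ℝ) : ℕ → ℕ
  | 0 => 0
  | n + 1 => if v n ≤ v (minIndex v n) then n else minIndex v n

theorem minIndex_lt (v : ℕ → ℝ) {n : ℕ} (hn : 0 < n) : minIndex v n < n := by
  induction n with
  | zero => omega
  | succ n ih =>
    simp only [minIndex]
    split_ifs with h
    · omega
    · rcases Nat.eq_zero_or_pos n with rfl | h'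
      · simp [minIndex] at h
      · exact (ih h').trans (Nat.lt_succ_self n)

theorem minIndex_le (v : ℕ → ℝ) {n i : ℕ} (hi : i < n) : v (minIndex v n) ≤ v i := by
  induction n with
  | zero => omega
  | succ n ih =>
    simp only [minIndex]
    split_ifs with h
    · rcases Nat.lt_succ_iff_lt_or_eq.1 hi with h' | rfl
      · exact h.trans (ih h')
      · exact le_rfl
    · rcases Nat.lt_succ_iff_lt_or_eq.1 hi with h' | rfl
      · exact ih h'
      · exact (not_le.1 h).le

theorem minIndex_lt_of_lt (v : ℕ → ℝ) {n i : ℕ} (hi : i < n) (h : minIndex v n < i) :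
    v (minIndex v n) < v i := by
  induction n with
  | zero => omega
  | succ n ih =>
    simp only [minIndex] at h ⊢
    split_ifs at h ⊢ with h1
    · omega
    · rcases Nat.lt_succ_iff_lt_or_eq.1 hi with h' | rfl
      · exact ih h' h
      · exact not_le.1 h1

/-- Ties go to the largest index, so strictness is needed only beyond `i`. -/
theorem minIndex_eq (v : ℕ → ℝ) {n i : ℕ} (hi : i < n) (h : ∀ j < n, v i ≤ v j)
    (h' : ∀ j < n, i < j → v i < v j) : minIndex v n = i := by
  have hlt := minIndex_lt v (Nat.zero_lt_of_lt hi)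
  rcases lt_trichotomy (minIndex v n) i with hc | hc | hc
  · exact absurd (h _ hlt) (not_le.2 (minIndex_lt_of_lt v hi hc))
  · exact hc
  · exact absurd (minIndex_le v hi) (not_le.2 (h' _ hlt hc))

theorem minIndex_congr {v v' : ℕ → ℝ} {n : ℕ} (h : ∀ i < n, v i = v' i) :
    minIndex v n = minIndex v' n := by
  induction n with
  | zero => rfl
  | succ n ih =>
    have ih' := ih fun i hi => h i (by omega)
    rcases Nat.eq_zero_or_pos n with rfl | hn
    · simp [minIndex]
    · simp only [minIndex, ih', h n (by omega), h (minIndex v' n)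
        ((minIndex_lt v' hn).trans (Nat.lt_succ_self n))]

theorem measurable_minIndex {Ω : Type*} [MeasurableSpace Ω] {v : Ω → ℕ → ℝ}
    (hv : ∀ i, Measurable fun ω => v ω i) (n : ℕ) : Measurable fun ω => minIndex (v ω) n := by
  induction n with
  | zero => exact measurable_const
  | succ n ih =>
    exact Measurable.ite (measurableSet_le (hv n)
      (measurable_pick (F := fun k ω => v ω k) ih hv)) measurable_const ih

/-! ### Following the perturbed leader -/

/-- `B` is an initial interval with supremum `s`, and `h` forces `A` into `[(s + δ) * exp (-η) - δ,
s]`. Its length is `(s + δ) * (1 - exp (-η)) ≤ η * (s + δ)`. -/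
theorem volume_le_of_lower_interval {A B : Set unitInterval} {δ η : ℝ} (hδ : 0 ≤ δ) (hη : 0 ≤ η)
    (hAB : A ⊆ B) (hB : ∀ x ∈ B, ∀ y ≤ x, y ∈ B)
    (h : ∀ x ∈ A, ∀ y ∈ B, (y : ℝ) + δ ≤ ((x : ℝ) + δ) * Real.exp η) :
    volume.real A ≤ η * (volume.real B + δ) := by
  rcases A.eq_empty_or_nonempty with rfl | ⟨x₀, hx₀⟩
  · simp only [measureReal_empty]
    positivity
  have hBne : ((↑) '' B : Set ℝ).Nonempty := ⟨x₀, x₀, hAB hx₀, rfl⟩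
  have hBdd : BddAbove ((↑) '' B : Set ℝ) := ⟨1, by rintro _ ⟨y, _, rfl⟩; exact y.2.2⟩
  set s : ℝ := sSup ((↑) '' B : Set ℝ) with hs
  have hs0 : 0 ≤ s := x₀.2.1.trans (le_csSup hBdd ⟨x₀, hAB hx₀, rfl⟩)
  have hA : ((↑) '' A : Set ℝ) ⊆ Set.Icc ((s + δ) * Real.exp (-η) - δ) s := by
    rintro _ ⟨x, hx, rfl⟩
    refine ⟨?_, le_csSup hBdd ⟨x, hAB hx, rfl⟩⟩
    have h1 : s ≤ ((x : ℝ) + δ) * Real.exp η - δ := by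
      refine csSup_le hBne ?_
      rintro _ ⟨y, hy, rfl⟩
      linarith [h x hx y hy]
    have h2 : (s + δ) * Real.exp (-η) ≤ (((x : ℝ) + δ) * Real.exp η) * Real.exp (-η) :=
      mul_le_mul_of_nonneg_right (by linarith) (Real.exp_pos _).le
    rw [mul_assoc, ← Real.exp_add, add_neg_cancel, Real.exp_zero, mul_one] at h2
    linarith
  have hB' : Set.Ico 0 s ⊆ ((↑) '' B : Set ℝ) := by
    rintro y ⟨hy0, hys⟩
    obtain ⟨_, ⟨x, hx, rfl⟩, hxy⟩ := exists_lt_of_lt_csSup hBne hys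
    exact ⟨⟨y, hy0, hxy.le.trans x.2.2⟩, hB x hx _ hxy.le, rfl⟩
  have hvolA : volume.real A ≤ η * (s + δ) := by
    rw [measureReal_def, unitInterval.volume_apply]
    have h1 : volume ((↑) '' A : Set ℝ) ≤ ENNReal.ofReal (η * (s + δ)) := by
      refine (measure_mono hA).trans ?_
      rw [Real.volume_Icc]
      refine ENNReal.ofReal_le_ofReal ?_
      nlinarith [Real.add_one_le_exp (-η)]
    exact ENNReal.toReal_le_of_le_ofReal (by positivity) h1
  have hvolB : s ≤ volume.real B := by
    have h1 : ENNReal.ofReal s ≤ volume B := by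
      rw [unitInterval.volume_apply]
      refine le_trans ?_ (measure_mono hB')
      rw [Real.volume_Ico, sub_zero]
    rw [measureReal_def]
    exact (ENNReal.ofReal_le_iff_le_toReal (measure_ne_top _ _)).1 h1
  refine hvolA.trans ?_
  gcongr

namespace CodedTask

variable (K : CodedTask)

/-- The perturbed cumulative loss of the state `i` since the last restart, exponentiated. -/
noncomputable def perturbed (N q : ℕ) (η : ℝ) (c : ℕ → unitInterval) (t i : ℕ) : ℝ :=
  accumulate q ((c i : ℝ) + 1 / N) (fun t => η * K.loss t i) t

/-- The state with the least perturbed cumulative loss. -/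
noncomputable def leader (N q : ℕ) (η : ℝ) (c : ℕ → unitInterval) (t : ℕ) : ℕ :=
  minIndex (K.perturbed N q η c t) N

section Leader

variable {N q : ℕ} {η : ℝ}

theorem leader_lt (hN : 0 < N) (c : ℕ → unitInterval) (t : ℕ) : K.leader N q η c t < N :=
  minIndex_lt _ hN

theorem perturbed_pos (hN : 0 < N) (c : ℕ → unitInterval) (t i : ℕ) :
    0 < K.perturbed N q η c t i := by
  refine accumulate_pos _ ?_ _ _
  have : (0 : ℝ) < 1 / N := by positivity
  linarith [(c i).2.1]

theorem measurable_perturbed (t i : ℕ) : Measurable fun c => K.perturbed N q η c t i := by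
  have h : Measurable fun c : ℕ → unitInterval => ((c i : unitInterval) : ℝ) :=
    measurable_subtype_coe.comp (measurable_pi_apply i)
  have hz : ∀ s, Measurable fun _ : ℕ → unitInterval => η * K.loss s i := fun s =>
    measurable_const
  exact measurable_accumulate q (h.add measurable_const) hz t

theorem measurable_leader (t : ℕ) : Measurable fun c => K.leader N q η c t :=
  measurable_minIndex (fun i => K.measurable_perturbed t i) N

theorem leader_congr {c c' : ℕ → unitInterval} (h : ∀ i < N, c i = c' i) (t : ℕ) :
    K.leader N q η c t = K.leader N q η c' t :=
  minIndex_congr fun i hi => by simp only [perturbed, h i hi]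

/-- The leader, which is chosen with knowledge of the current loss, hardly loses against a fixed
state. -/
theorem sum_loss_leader_le (hN : 0 < N) (hη : 0 < η) (c : ℕ → unitInterval) {a k : ℕ}
    (ha : q ∣ a) (hk : k + 1 ≤ q) {x : ℕ} (hx : x < N) :
    ∑ t ∈ Finset.Ico a (a + (k + 1)), K.loss t (K.leader N q η c t)
      ≤ ∑ t ∈ Finset.Ico a (a + (k + 1)), K.loss t x + Real.log (2 * N) / η := by
  have hN' : (0 : ℝ) < N := by exact_mod_cast hN
  have hN1 : (1 : ℝ) ≤ N := by exact_mod_cast hN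
  have hδ : (0 : ℝ) < 1 / N := by positivity
  set e := K.leader N q η c with he
  -- Be-the-leader induction: before the loss of a new round is added, the new leader is no better
  -- than the old one. The noise lies between `1 / N` and `2`, which produces the term `log (2 *
  -- N)`.
  have hlow : ∀ k < q, -Real.log N + η * ∑ t ∈ Finset.Ico a (a + (k + 1)), K.loss t (e t)
      ≤ Real.log (K.perturbed N q η c (a + k) (e (a + k))) := by
    intro k hk
    induction k with
    | zero =>
      simp only [Nat.add_zero]
      unfold perturbed
      have hp : 0 < (c (e a) : ℝ) + 1 / N := by linarith [(c (e a)).2.1]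
      rw [accumulate_restart _ _ (Nat.mod_eq_zero_of_dvd ha),
        Real.log_mul hp.ne' (Real.exp_pos _).ne', Real.log_exp]
      have : -Real.log N ≤ Real.log ((c (e a) : ℝ) + 1 / N) := by
        rw [← Real.log_inv, ← one_div]
        exact Real.log_le_log hδ (by linarith [(c (e a)).2.1])
      simpa using this
    | succ k ih =>
      have hstep : K.perturbed N q η c (a + (k + 1)) (e (a + (k + 1)))
          = K.perturbed N q η c (a + k) (e (a + (k + 1)))
            * Real.exp (η * K.loss (a + (k + 1)) (e (a + (k + 1)))) := by
        have h := add_mod_ne_zero ha hk (Nat.succ_ne_zero k)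
        exact accumulate_succ _ _ h
      rw [hstep, Real.log_mul (K.perturbed_pos hN c _ _).ne' (Real.exp_pos _).ne', Real.log_exp,
        ← Nat.add_assoc a (k + 1) 1, Finset.sum_Ico_succ_top (by omega : a ≤ a + (k + 1)), mul_add]
      have hmin := Real.log_le_log (K.perturbed_pos hN c (a + k) (e (a + k)))
        (minIndex_le (K.perturbed N q η c (a + k)) (K.leader_lt (q := q) (η := η) hN c _ :
          e (a + (k + 1)) < N))
      have := ih (by omega)
      linarith
  have hupp : Real.log (K.perturbed N q η c (a + k) (e (a + k)))
      ≤ Real.log 2 + η * ∑ t ∈ Finset.Ico a (a + (k + 1)), K.loss t x := by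
    refine (Real.log_le_log (K.perturbed_pos hN c _ _) (minIndex_le _ hx)).trans ?_
    have hp : 0 < (c x : ℝ) + 1 / N := by linarith [(c x).2.1]
    rw [perturbed, accumulate_block _ _ ha hk,
      Real.log_mul hp.ne' (Real.exp_pos _).ne', Real.log_exp, ← Finset.mul_sum]
    have : Real.log ((c x : ℝ) + 1 / N) ≤ Real.log 2 := by
      refine Real.log_le_log hp ?_
      have : (1 : ℝ) / N ≤ 1 := by rw [div_le_one hN']; exact hN1
      linarith [(c x).2.2]
    linarith
  have h := (hlow k hk).trans hupp
  rw [Real.log_mul two_ne_zero hN'.ne']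
  have h2 : η * ∑ t ∈ Finset.Ico a (a + (k + 1)), K.loss t (e t)
      ≤ η * (∑ t ∈ Finset.Ico a (a + (k + 1)), K.loss t x + (Real.log 2 + Real.log N) / η) := by
    rw [mul_add, mul_div_cancel₀ _ hη.ne']
    linarith
  exact le_of_mul_le_mul_left h2 hη

/-- With all other noise fixed, the noise values at which `i` leads form a lower interval, and
those at which it loses the lead in the next round lie close to its end. -/
theorem volume_lead_lost_le (hN : 0 < N) (hη : 0 ≤ η) {t : ℕ} (ht : (t + 1) % q ≠ 0)
    (c : ℕ → unitInterval) {i : ℕ} (hi : i < N) :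
    volume.real {v : unitInterval | K.leader N q η (Function.update c i v) t = i ∧
        K.leader N q η (Function.update c i v) (t + 1) ≠ i}
      ≤ η * (volume.real {v : unitInterval | K.leader N q η (Function.update c i v) t = i}
        + 1 / N) := by
  have hN' : (0 : ℝ) < N := by exact_mod_cast hN
  have hδ : (0 : ℝ) < 1 / N := by positivity
  have hself : ∀ v t, K.perturbed N q η (Function.update c i v) t i
      = ((v : ℝ) + 1 / N) * accumulate q 1 (fun t => η * K.loss t i) t := by
    intro v t
    rw [perturbed, accumulate_eq_mul, Function.update_self]
  have hother : ∀ v t j, j ≠ i → K.perturbed N q η (Function.update c i v) t j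
      = K.perturbed N q η c t j := by
    intro v t j hj
    simp only [perturbed, Function.update_of_ne hj]
  have hacc : 0 < accumulate q 1 (fun t => η * K.loss t i) t := accumulate_pos q one_pos _ t
  refine volume_le_of_lower_interval hδ.le hη (fun v hv => hv.1) ?_ ?_
  -- Less noise on `i` only improves `i` against the other states.
  · intro x hx y hyx
    have hx' : minIndex (K.perturbed N q η (Function.update c i x) t) N = i := hx
    have hle : K.perturbed N q η (Function.update c i y) t i
        ≤ K.perturbed N q η (Function.update c i x) t i := by
      rw [hself, hself]
      refine mul_le_mul_of_nonneg_right ?_ hacc.le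
      have : (y : ℝ) ≤ x := hyx
      linarith
    refine minIndex_eq _ hi (fun j hj => ?_) fun j hj hij => ?_
    · rcases eq_or_ne j i with rfl | hji
      · exact le_rfl
      · have := minIndex_le (K.perturbed N q η (Function.update c i x) t) hj
        rw [hx', hother x t j hji] at this
        rw [hother y t j hji]
        exact hle.trans this
    · have := minIndex_lt_of_lt (K.perturbed N q η (Function.update c i x) t) hj
        (by rw [hx']; exact hij)
      rw [hx', hother x t j hij.ne'] at this
      rw [hother y t j hij.ne']
      exact hle.trans_lt this
  -- The state `j` that overtakes `i` under the noise `x` is not resampled. Its perturbed loss in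
  -- round `t` is an upper bound for that of `i` under `y`, and its perturbed loss in round `t + 1`
  -- a lower bound for that of `i` under `x`; in one round the latter grows at most by the factor
  -- `exp η`.
  · rintro x ⟨-, hx'⟩ y hy
    have hy' : minIndex (K.perturbed N q η (Function.update c i y) t) N = i := hy
    set j := K.leader N q η (Function.update c i x) (t + 1) with hj
    have hjN : j < N := K.leader_lt hN _ _
    have h1 : K.perturbed N q η (Function.update c i y) t i ≤ K.perturbed N q η c t j := by
      have := minIndex_le (K.perturbed N q η (Function.update c i y) t) hjN
      rwa [hy', hother y t j hx'] at this
    have h2 : K.perturbed N q η c t j ≤ K.perturbed N q η c (t + 1) j := by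
      rw [perturbed, perturbed, accumulate_succ _ _ ht]
      refine le_mul_of_one_le_right (K.perturbed_pos hN c t j).le ?_
      exact Real.one_le_exp (mul_nonneg hη (K.loss_nonneg _ _))
    have h3 : K.perturbed N q η c (t + 1) j
        ≤ K.perturbed N q η (Function.update c i x) (t + 1) i := by
      have := minIndex_le (K.perturbed N q η (Function.update c i x) (t + 1)) hi
      rwa [show minIndex (K.perturbed N q η (Function.update c i x) (t + 1)) N = j from rfl,
        hother x (t + 1) j hx'] at this
    have h4 := h1.trans (h2.trans h3)
    rw [hself, hself, accumulate_succ _ _ ht, mul_comm (accumulate _ _ _ _), ← mul_assoc] at h4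
    refine (le_of_mul_le_mul_right h4 hacc).trans ?_
    have h5 : Real.exp (η * K.loss (t + 1) i) ≤ Real.exp η :=
      Real.exp_le_exp.2 (mul_le_of_le_one_right hη (K.loss_le_one _ _))
    exact mul_le_mul_of_nonneg_left h5 (by linarith [x.2.1])

/-- The law of the coins. -/
noncomputable abbrev coinLaw : Measure (ℕ → unitInterval) :=
  Measure.infinitePi fun _ => volume

/-- If the leader moves, some state `i` loses the lead. Resampling the noise of `i` bounds the
probability of this by `η` times the probability that `i` leads plus `1 / N`. Summed over the
states, the lead probabilities and the offsets contribute `η` each. -/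
theorem integral_move_leader_le (hN : 0 < N) (hη : 0 ≤ η) {t : ℕ} (ht : (t + 1) % q ≠ 0) :
    ∫ c, K.move (K.leader N q η c (t + 1)) (K.leader N q η c t) ∂coinLaw ≤ K.diam * (2 * η) := by
  have hN' : (0 : ℝ) < N := by exact_mod_cast hN
  have hD := K.diam_nonneg
  have hm := fun t => K.measurable_leader (N := N) (q := q) (η := η) t
  let A : ℕ → Set (ℕ → unitInterval) := fun i =>
    {c | K.leader N q η c t = i ∧ K.leader N q η c (t + 1) ≠ i}
  let B : ℕ → Set (ℕ → unitInterval) := fun i => {c | K.leader N q η c t = i}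
  have hB : ∀ i, MeasurableSet (B i) := fun i => hm t (MeasurableSet.singleton i)
  have hA : ∀ i, MeasurableSet (A i) := fun i =>
    (hB i).inter (hm (t + 1) (MeasurableSet.singleton i).compl)
  have hAB : ∀ i < N, ∫ c, (A i).indicator (fun _ => (1 : ℝ)) c ∂coinLaw
      ≤ ∫ c, η * ((B i).indicator (fun _ => (1 : ℝ)) c + 1 / N) ∂coinLaw := by
    intro i hi
    have hind : ∀ (S : Set (ℕ → unitInterval)) c, |S.indicator (fun _ => (1 : ℝ)) c| ≤ 1 := by
      intro S c
      by_cases hc : c ∈ S <;> simp [hc]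
    refine integral_le_of_update volume (B := 1) (B' := η * (1 + 1 / N))
      (measurable_const.indicator (hA i)) (hind _)
      (((measurable_const.indicator (hB i)).add measurable_const).const_mul η) (fun c => ?_) i
      fun c => ?_
    · rw [abs_mul, abs_of_nonneg hη]
      refine mul_le_mul_of_nonneg_left ((abs_add_le _ _).trans ?_) hη
      rw [abs_of_pos (by positivity : (0 : ℝ) < 1 / N)]
      linarith [hind (B i) c]
    · have hu := measurable_update_right (Y := unitInterval) i c
      have h1 : ∫ v, (A i).indicator (fun _ => (1 : ℝ)) (Function.update c i v)
          = volume.real {v : unitInterval | K.leader N q η (Function.update c i v) t = i ∧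
            K.leader N q η (Function.update c i v) (t + 1) ≠ i} := by
        have := integral_indicator_one (μ := (volume : Measure unitInterval)) (hu (hA i))
        exact this
      have h2 : ∫ v, (B i).indicator (fun _ => (1 : ℝ)) (Function.update c i v)
          = volume.real {v : unitInterval | K.leader N q η (Function.update c i v) t = i} := by
        have := integral_indicator_one (μ := (volume : Measure unitInterval)) (hu (hB i))
        exact this
      have hint : Integrable fun v => (B i).indicator (fun _ => (1 : ℝ)) (Function.update c i v) :=
        Integrable.of_bound
          ((measurable_const.indicator (hB i)).comp hu).aestronglyMeasurable 1
          (Filter.Eventually.of_forall fun v => hind _ _)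
      rw [h1, integral_const_mul, integral_add hint (integrable_const _), h2]
      simpa using K.volume_lead_lost_le hN hη ht c hi
  have hintA : ∀ i, Integrable ((A i).indicator fun _ => (1 : ℝ)) coinLaw :=
    fun i => (integrable_const _).indicator (hA i)
  have hintB : ∀ i, Integrable ((B i).indicator fun _ => (1 : ℝ)) coinLaw :=
    fun i => (integrable_const _).indicator (hB i)
  have hsumB : ∑ i ∈ Finset.range N, ∫ c, (B i).indicator (fun _ => (1 : ℝ)) c ∂coinLaw = 1 := by
    rw [← integral_finsetSum _ fun i _ => hintB i]
    have : (fun c => ∑ i ∈ Finset.range N, (B i).indicator (fun _ => (1 : ℝ)) c)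
        = fun _ => (1 : ℝ) := by
      funext c
      rw [Finset.sum_eq_single_of_mem (K.leader N q η c t)
        (Finset.mem_range.2 (K.leader_lt hN c t))]
      · simp [B]
      · intro i _ hi
        simp [B, hi.symm]
    rw [this]
    simp
  calc ∫ c, K.move (K.leader N q η c (t + 1)) (K.leader N q η c t) ∂coinLaw
      ≤ ∫ c, K.diam * ∑ i ∈ Finset.range N, (A i).indicator (fun _ => (1 : ℝ)) c ∂coinLaw := by
        refine integral_mono (K.integrable_move _ (hm _) (hm _))
          ((integrable_finsetSum _ fun i _ => hintA i).const_mul _) fun c => ?_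
        have hnn : ∀ i ∈ Finset.range N, 0 ≤ (A i).indicator (fun _ => (1 : ℝ)) c :=
          fun i _ => Set.indicator_nonneg (fun _ _ => zero_le_one) c
        by_cases hc : K.leader N q η c (t + 1) = K.leader N q η c t
        · simp only [hc, K.move_self]
          exact mul_nonneg hD (Finset.sum_nonneg hnn)
        · refine (K.move_le _ _).trans (le_mul_of_one_le_right hD ?_)
          refine le_trans ?_ (Finset.single_le_sum hnn
            (Finset.mem_range.2 (K.leader_lt hN c t : K.leader N q η c t < N)))
          have : c ∈ A (K.leader N q η c t) := ⟨rfl, hc⟩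
          rw [Set.indicator_of_mem this]
    _ = K.diam * ∑ i ∈ Finset.range N, ∫ c, (A i).indicator (fun _ => (1 : ℝ)) c ∂coinLaw := by
        rw [integral_const_mul, integral_finsetSum _ fun i _ => hintA i]
    _ ≤ K.diam * ∑ i ∈ Finset.range N, ∫ c, η * ((B i).indicator (fun _ => (1 : ℝ)) c + 1 / N)
          ∂coinLaw :=
        mul_le_mul_of_nonneg_left (Finset.sum_le_sum fun i hi => hAB i (Finset.mem_range.1 hi)) hD
    _ = K.diam * (2 * η) := by
        congr 1
        have : ∀ i, ∫ c, η * ((B i).indicator (fun _ => (1 : ℝ)) c + 1 / N) ∂coinLaw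
            = η * (∫ c, (B i).indicator (fun _ => (1 : ℝ)) c ∂coinLaw) + η * (1 / N) := by
          intro i
          rw [integral_const_mul, integral_add (hintB i) (integrable_const _), mul_add]
          simp
        simp only [this]
        rw [Finset.sum_add_distrib, ← Finset.mul_sum, hsumB, Finset.sum_const, Finset.card_range,
          nsmul_eq_mul]
        field_simp
        norm_num

/-- The regret of the perturbed leader between two restarts. -/
theorem integral_cost_leader_le (hN : 0 < N) (hη : 0 < η) {a k : ℕ} (ha : q ∣ a)
    (hk : k + 1 ≤ q) {x : ℕ} (hx : x < N) :
    ∫ c, K.cost (K.leader N q η c) a (k + 1) ∂coinLaw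
      ≤ ∑ t ∈ Finset.Ico a (a + (k + 1)), K.loss t x
        + (Real.log (2 * N) / η + (k + 1) * (K.diam * (2 * η))) := by
  have hm := fun t => K.measurable_leader (N := N) (q := q) (η := η) t
  have hD := K.diam_nonneg
  have hil : Integrable (fun c => ∑ t ∈ Finset.Ico a (a + (k + 1)),
      K.loss t (K.leader N q η c t)) coinLaw :=
    integrable_finsetSum _ fun t _ => K.integrable_loss _ hm t
  have him : ∀ t, Integrable (fun c => K.move (K.leader N q η c t)
      (K.leader N q η c (t - 1))) coinLaw := fun t => K.integrable_move _ (hm _) (hm _)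
  unfold cost
  rw [integral_add hil (integrable_finsetSum _ fun t _ => him t),
    integral_finsetSum _ fun t _ => him t]
  have h1 : ∫ c, ∑ t ∈ Finset.Ico a (a + (k + 1)), K.loss t (K.leader N q η c t) ∂coinLaw
      ≤ ∑ t ∈ Finset.Ico a (a + (k + 1)), K.loss t x + Real.log (2 * N) / η := by
    refine (integral_mono hil (integrable_const _) fun c =>
      K.sum_loss_leader_le hN hη c ha hk hx).trans ?_
    simp
  have h2 : ∑ t ∈ Finset.Ico (a + 1) (a + (k + 1)),
      ∫ c, K.move (K.leader N q η c t) (K.leader N q η c (t - 1)) ∂coinLaw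
        ≤ ∑ t ∈ Finset.Ico (a + 1) (a + (k + 1)), K.diam * (2 * η) := by
    refine Finset.sum_le_sum fun t ht => ?_
    obtain ⟨s, rfl⟩ : ∃ s, t = a + s + 1 := ⟨t - a - 1, by have := Finset.mem_Ico.1 ht; omega⟩
    refine K.integral_move_leader_le hN hη.le ?_
    have := Finset.mem_Ico.1 ht
    exact add_mod_ne_zero (i := s + 1) ha (by omega) (Nat.succ_ne_zero s)
  rw [Finset.sum_const, Nat.card_Ico, nsmul_eq_mul,
    show a + (k + 1) - (a + 1) = k by omega] at h2
  have : 0 ≤ K.diam * (2 * η) := by positivity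
  linarith

end Leader

end CodedTask

namespace CodedTask

variable (K : CodedTask)

section MixMeasurable

variable {Ω : Type*} [MeasurableSpace Ω]

theorem measurable_previous {p : Ω → ℕ → ℕ} (hp : ∀ t, Measurable fun ω => p ω t) (t : ℕ) :
    Measurable fun ω => previous (p ω) t := by
  cases t with
  | zero => exact measurable_const
  | succ t => exact hp t

theorem measurable_mix_of {q : ℕ} {w θ : ℝ} {b e : Ω → ℕ → ℕ} {v : Ω → unitInterval}
    (hb : ∀ t, Measurable fun ω => b ω t) (he : ∀ t, Measurable fun ω => e ω t)
    (hv : Measurable v) (t : ℕ) : Measurable fun ω => K.mix q w θ (b ω) (e ω) (v ω) t := by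
  have hadv : ∀ t, Measurable fun ω => K.advantage θ (b ω) (e ω) t := by
    intro t
    have h1 := K.measurable_loss hb t
    have h2 := K.measurable_loss he t
    have h3 := K.measurable_move (hb t) (measurable_previous hb t)
    have h4 := K.measurable_move (he t) (measurable_previous he t)
    exact ((((h1.add h3).sub (h2.add h4)).sub measurable_const).const_mul θ).div_const _
  have hbias := measurable_accumulate q (measurable_const (a := w)) hadv t
  have hv' : Measurable fun ω => ((v ω : unitInterval) : ℝ) := measurable_subtype_coe.comp hv
  exact Measurable.ite (measurableSet_le hv' hbias) (he t) (hb t)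

end MixMeasurable

/-! ### Stacking mixtures over all dyadic scales -/

/-- The learning rate of the mixture on the time scale `2 ^ j`. -/
noncomputable def mixRate (L j : ℕ) : ℝ := Real.sqrt (L / (2 ^ j + L))

/-- The learning rate of the perturbed leader on the time scale `2 ^ j`. -/
noncomputable def leaderRate (m j : ℕ) : ℝ := Real.sqrt (m / ((K.diam + 1) * 2 ^ j))

/-- Starting from `b`, mix in the perturbed leaders on the time scales `2 ^ (L - 1), 2 ^ (L - 2), …`
one after the other. The coins `0, …, N - 1` are the noise of the leaders, and coin `N + j` is the
threshold on the time scale `2 ^ j`. -/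
noncomputable def stack (N L m : ℕ) (w : ℝ) (b : ℕ → ℕ) (c : ℕ → unitInterval) : ℕ → ℕ → ℕ
  | 0 => b
  | n + 1 => K.mix (2 ^ (L - (n + 1))) w (mixRate L (L - (n + 1))) (stack N L m w b c n)
      (K.leader N (2 ^ (L - (n + 1))) (K.leaderRate m (L - (n + 1))) c) (c (N + (L - (n + 1))))

section Stack

variable {N L m : ℕ} {w : ℝ} (b : ℕ → ℕ)

/-- Only the thresholds of the scales treated so far enter, so the threshold of the next scale is
fresh and can be resampled alone. -/
theorem stack_congr {c c' : ℕ → unitInterval} {n : ℕ} (hn : n ≤ L) (hN : ∀ i < N, c i = c' i)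
    (hL : ∀ j, L - n ≤ j → c (N + j) = c' (N + j)) :
    K.stack N L m w b c n = K.stack N L m w b c' n := by
  induction n with
  | zero => rfl
  | succ n ih =>
    have hlead : K.leader N (2 ^ (L - (n + 1))) (K.leaderRate m (L - (n + 1))) c
        = K.leader N (2 ^ (L - (n + 1))) (K.leaderRate m (L - (n + 1))) c' :=
      funext fun t => K.leader_congr hN t
    simp only [stack]
    rw [ih (by omega) fun j hj => hL j (by omega), hlead, hL _ le_rfl]

theorem measurable_stack (n t : ℕ) : Measurable fun c => K.stack N L m w b c n t := by
  induction n generalizing t with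
  | zero => exact measurable_const
  | succ n ih =>
    exact K.measurable_mix_of ih (fun t => K.measurable_leader t) (measurable_pi_apply _) t

theorem stack_succ_update (n : ℕ) (hn : n < L) (c : ℕ → unitInterval) (v : unitInterval) :
    K.stack N L m w b (Function.update c (N + (L - (n + 1))) v) (n + 1)
      = K.mix (2 ^ (L - (n + 1))) w (mixRate L (L - (n + 1))) (K.stack N L m w b c n)
        (K.leader N (2 ^ (L - (n + 1))) (K.leaderRate m (L - (n + 1))) c) v := by
  have h1 : K.stack N L m w b (Function.update c (N + (L - (n + 1))) v) n
      = K.stack N L m w b c n :=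
    K.stack_congr b hn.le (fun i hi => Function.update_of_ne (by omega) _ _)
      fun j hj => Function.update_of_ne (by omega) _ _
  have h2 : K.leader N (2 ^ (L - (n + 1))) (K.leaderRate m (L - (n + 1)))
      (Function.update c (N + (L - (n + 1))) v)
      = K.leader N (2 ^ (L - (n + 1))) (K.leaderRate m (L - (n + 1))) c :=
    funext fun t => K.leader_congr (N := N) (fun i hi => Function.update_of_ne
      (show i ≠ N + (L - (n + 1)) by omega) _ _) t
  simp only [stack]
  rw [h1, h2, Function.update_self]

theorem mixRate_pos (hL : 0 < L) (j : ℕ) : 0 < mixRate L j := by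
  have : (0 : ℝ) < L := by exact_mod_cast hL
  exact Real.sqrt_pos.2 (by positivity)

theorem mixRate_le_one (L j : ℕ) : mixRate L j ≤ 1 := by
  refine Real.sqrt_le_one.2 ?_
  refine div_le_one_of_le₀ ?_ (by positivity)
  have : (0 : ℝ) < 2 ^ j := by positivity
  linarith

theorem abs_cost_le (p : ℕ → ℕ) (a k : ℕ) : |K.cost p a k| ≤ (1 + K.diam) * k := by
  rw [abs_of_nonneg (K.cost_nonneg _ _ _)]
  exact K.cost_le _ _ _

theorem measurable_cost_stack (n a k : ℕ) :
    Measurable fun c => K.cost (K.stack N L m w b c n) a k :=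
  K.measurable_cost (fun t => K.measurable_stack b n t) a k

/-- With all coins but the threshold of the new scale fixed, both ingredients of the mixture are
fixed sequences. So `integral_cost_mix_le` applies, and its nonnegative potential is dropped. -/
theorem integral_cost_stack_succ_le (hw : 0 < w) (hw1 : w ≤ 1) {n : ℕ} (hn : n < L) {a : ℕ}
    (ha : 2 ^ (L - (n + 1)) ∣ a) (k : ℕ) :
    ∫ c, K.cost (K.stack N L m w b c (n + 1)) a k ∂coinLaw
      ≤ ∫ c, K.cost (K.stack N L m w b c n) a k ∂coinLaw
        + k * K.leak w (mixRate L (L - (n + 1))) := by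
  cases k with
  | zero => simp [cost_zero]
  | succ k =>
    have hL : 0 < L := by omega
    have hD := K.diam_nonneg
    set ε := K.leak w (mixRate L (L - (n + 1))) with hε
    have hε0 : 0 ≤ ε := K.leak_nonneg hw.le (mixRate_pos hL _).le
    have hconst : ∫ c, K.cost (K.stack N L m w b c n) a (k + 1) ∂coinLaw + ((k + 1 : ℕ) : ℝ) * ε
        = ∫ c, (K.cost (K.stack N L m w b c n) a (k + 1) + ((k + 1 : ℕ) : ℝ) * ε) ∂coinLaw := by
      rw [integral_add (K.integrable_cost _ (fun t => K.measurable_stack b n t) _ _)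
        (integrable_const _)]
      simp
    rw [hconst]
    refine integral_le_of_update volume (K.measurable_cost_stack b _ _ _)
      (fun c => K.abs_cost_le _ _ _) ((K.measurable_cost_stack b _ _ _).add measurable_const)
      (B' := (1 + K.diam) * (k + 1 : ℕ) + (k + 1 : ℕ) * ε) (fun c => ?_)
      (N + (L - (n + 1))) fun c => ?_
    · refine (abs_add_le _ _).trans (add_le_add (K.abs_cost_le _ _ _) (le_of_eq ?_))
      exact abs_of_nonneg (by positivity)
    · simp only [K.stack_succ_update b n hn]
      have h1 : ∀ v, K.stack N L m w b (Function.update c (N + (L - (n + 1))) v) n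
          = K.stack N L m w b c n := fun v =>
        K.stack_congr b hn.le (fun i hi => Function.update_of_ne (by omega) _ _)
          fun j hj => Function.update_of_ne (by omega) _ _
      simp only [h1]
      refine (K.integral_cost_mix_le _ _ hw hw1 (mixRate_pos hL _) (mixRate_le_one _ _)
        (Nat.mod_eq_zero_of_dvd ha) k).trans ?_
      have hpot : 0 ≤ K.potential (2 ^ (L - (n + 1))) w (mixRate L (L - (n + 1)))
          (K.stack N L m w b c n)
          (K.leader N (2 ^ (L - (n + 1))) (K.leaderRate m (L - (n + 1))) c) (a + k) := by
        have := mixRate_pos hL (L - (n + 1))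
        refine mul_nonneg (by positivity) (le_trans ?_ min_one_le_biasPotential)
        exact le_min zero_le_one (accumulate_pos _ hw _ _).le
      simp only [integral_const, probReal_univ, one_smul]
      push_cast
      linarith

/-- The same conditioning, now with `integral_cost_mix_le'`; the leader depends only on the coins
that are kept fixed. -/
theorem integral_cost_stack_succ_le' (hw : 0 < w) (hw1 : w ≤ 1) {n : ℕ} (hn : n < L) {a : ℕ}
    (ha : 2 ^ (L - (n + 1)) ∣ a) :
    ∫ c, K.cost (K.stack N L m w b c (n + 1)) a (2 ^ (L - (n + 1))) ∂coinLaw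
      ≤ ∫ c, K.cost (K.leader N (2 ^ (L - (n + 1))) (K.leaderRate m (L - (n + 1))) c) a
          (2 ^ (L - (n + 1))) ∂coinLaw
        + (4 * (1 + K.diam) / mixRate L (L - (n + 1)) * Real.log (1 / w) + K.diam
          + 2 ^ (L - (n + 1)) * (K.diam * mixRate L (L - (n + 1))
            + K.leak w (mixRate L (L - (n + 1))))) := by
  have hL : 0 < L := by omega
  have hD := K.diam_nonneg
  obtain ⟨k, hk⟩ : ∃ k, 2 ^ (L - (n + 1)) = k + 1 :=
    ⟨2 ^ (L - (n + 1)) - 1, by have := Nat.two_pow_pos (L - (n + 1)); omega⟩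
  have hkr : (2 : ℝ) ^ (L - (n + 1)) = (k : ℝ) + 1 := by exact_mod_cast hk
  rw [hkr]
  set R := 4 * (1 + K.diam) / mixRate L (L - (n + 1)) * Real.log (1 / w) + K.diam
          + ((k : ℝ) + 1) * (K.diam * mixRate L (L - (n + 1))
            + K.leak w (mixRate L (L - (n + 1)))) with hR
  have hm : Measurable fun c => K.cost (K.leader N (2 ^ (L - (n + 1)))
      (K.leaderRate m (L - (n + 1))) c) a (2 ^ (L - (n + 1))) :=
    K.measurable_cost (fun t => K.measurable_leader t) _ _
  have hconst : ∫ c, K.cost (K.leader N (2 ^ (L - (n + 1))) (K.leaderRate m (L - (n + 1))) c) a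
        (2 ^ (L - (n + 1))) ∂coinLaw + R
      = ∫ c, (K.cost (K.leader N (2 ^ (L - (n + 1))) (K.leaderRate m (L - (n + 1))) c) a
        (2 ^ (L - (n + 1))) + R) ∂coinLaw := by
    rw [integral_add (K.integrable_cost _ (fun t => K.measurable_leader t) _ _)
      (integrable_const _)]
    simp
  rw [hconst]
  refine integral_le_of_update volume (K.measurable_cost_stack b _ _ _)
    (fun c => K.abs_cost_le _ _ _) (hm.add measurable_const)
    (B' := (1 + K.diam) * (2 ^ (L - (n + 1)) : ℕ) + |R|) (fun c => ?_)
    (N + (L - (n + 1))) fun c => ?_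
  · exact (abs_add_le _ _).trans (add_le_add (K.abs_cost_le _ _ _) le_rfl)
  · simp only [K.stack_succ_update b n hn]
    have h1 : ∀ v, K.leader N (2 ^ (L - (n + 1))) (K.leaderRate m (L - (n + 1)))
        (Function.update c (N + (L - (n + 1))) v)
        = K.leader N (2 ^ (L - (n + 1))) (K.leaderRate m (L - (n + 1))) c := fun v =>
      funext fun t => K.leader_congr (N := N) (fun i hi => Function.update_of_ne
      (show i ≠ N + (L - (n + 1)) by omega) _ _) t
    simp only [h1]
    have := K.integral_cost_mix_le' (K.stack N L m w b c n)
      (K.leader N (2 ^ (L - (n + 1))) (K.leaderRate m (L - (n + 1))) c) hw hw1 (mixRate_pos hL _)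
      (mixRate_le_one L (L - (n + 1))) ha (k := k) hk.ge
    rw [← hk] at this
    simp only [integral_const, probReal_univ, one_smul]
    exact this

/-- The rate is at least `1 / (2 * T)`, so the weight `1 / T ^ 3` leaves a leak of order `1 / T ^
2`. This can be summed over up to `T` rounds and up to `T` scales. -/
theorem leak_mixRate_le {T j : ℕ} (hT : 0 < T) (hL : 0 < L) (hj : 2 ^ j ≤ T) :
    K.leak (1 / (T : ℝ) ^ 3) (mixRate L j) ≤ 12 * (1 + K.diam) / (T : ℝ) ^ 2 := by
  have hD := K.diam_nonneg
  have hT1 : (1 : ℝ) ≤ T := by exact_mod_cast hT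
  have hL1 : (1 : ℝ) ≤ L := by exact_mod_cast hL
  have hjT : (2 : ℝ) ^ j ≤ T := by exact_mod_cast hj
  have hθ := mixRate_pos hL j
  have hθ1 := mixRate_le_one L j
  have hinv : 1 ≤ 2 * T * mixRate L j := by
    have hsq : mixRate L j ^ 2 = L / (2 ^ j + L) := Real.sq_sqrt (by positivity)
    have h1 : (1 : ℝ) ≤ 2 * T * (L / (2 ^ j + L)) := by
      rw [← mul_div_assoc, le_div_iff₀ (by positivity)]
      nlinarith
    rw [← hsq] at h1
    have h2 : mixRate L j ^ 2 ≤ mixRate L j := by nlinarith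
    nlinarith
  have h2 : 4 * (1 + K.diam) / mixRate L j ≤ 8 * (1 + K.diam) * T := by
    rw [div_le_iff₀ hθ]
    nlinarith
  have h3 : 4 * (1 + K.diam) / mixRate L j + 4 * K.diam ≤ 12 * (1 + K.diam) * T := by
    nlinarith
  unfold leak
  calc 1 / (T : ℝ) ^ 3 * (4 * (1 + K.diam) / mixRate L j + 4 * K.diam)
      ≤ 1 / (T : ℝ) ^ 3 * (12 * (1 + K.diam) * T) := by gcongr
    _ = 12 * (1 + K.diam) / (T : ℝ) ^ 2 := by field_simp

end Stack

/-! ### The regret on dyadic intervals -/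

section Dyadic

variable {N m T : ℕ} (b : ℕ → ℕ)

/-- The sequence of states that results from mixing in the leaders on all time scales below `T`. -/
noncomputable def output (N m T : ℕ) (b : ℕ → ℕ) (c : ℕ → unitInterval) : ℕ → ℕ :=
  K.stack N T.size m (1 / (T : ℝ) ^ 3) b c T.size

theorem weight_pos (hT : 0 < T) : 0 < 1 / (T : ℝ) ^ 3 := by
  have : (0 : ℝ) < T := by exact_mod_cast hT
  positivity

theorem weight_le_one (hT : 0 < T) : 1 / (T : ℝ) ^ 3 ≤ 1 := by
  have : (1 : ℝ) ≤ T := by exact_mod_cast hT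
  rw [div_le_one (by positivity)]
  exact one_le_pow₀ this

theorem two_pow_le_of_lt_size {j : ℕ} (hj : j < T.size) : 2 ^ j ≤ T := Nat.lt_size.1 hj

theorem size_le_self (T : ℕ) : T.size ≤ T := Nat.size_le.2 Nat.lt_two_pow_self

/-- The finer time scales cost hardly anything on intervals that are aligned to them. -/
theorem integral_cost_output_le (hT : 0 < T) {n a k : ℕ} (hn : n ≤ T.size)
    (ha : 2 ^ (T.size - (n + 1)) ∣ a) (hk : k ≤ T) :
    ∫ c, K.cost (K.output N m T b c) a k ∂coinLaw
      ≤ ∫ c, K.cost (K.stack N T.size m (1 / (T : ℝ) ^ 3) b c n) a k ∂coinLaw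
        + 12 * (1 + K.diam) := by
  have hD := K.diam_nonneg
  have hT1 : (1 : ℝ) ≤ T := by exact_mod_cast hT
  have hkT : (k : ℝ) ≤ T := by exact_mod_cast hk
  have hiter : ∀ i, n + i ≤ T.size →
      ∫ c, K.cost (K.stack N T.size m (1 / (T : ℝ) ^ 3) b c (n + i)) a k ∂coinLaw
        ≤ ∫ c, K.cost (K.stack N T.size m (1 / (T : ℝ) ^ 3) b c n) a k ∂coinLaw
          + i * (T * (12 * (1 + K.diam) / (T : ℝ) ^ 2)) := by
    intro i
    induction i with
    | zero => intro _; simp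
    | succ i ih =>
      intro hi
      have hstep := K.integral_cost_stack_succ_le (N := N) (L := T.size) (m := m) b
        (weight_pos hT) (weight_le_one hT) (n := n + i) (by omega) (a := a)
        ((Nat.pow_dvd_pow 2 (by omega)).trans ha) k
      have hleak := K.leak_mixRate_le (L := T.size) hT (Nat.size_pos.2 hT)
        (two_pow_le_of_lt_size (by omega : T.size - (n + i + 1) < T.size))
      have hleak0 := K.leak_nonneg (weight_pos hT).le
        (mixRate_pos (Nat.size_pos.2 hT) (T.size - (n + i + 1))).le
      have hmul : (k : ℝ) * K.leak (1 / (T : ℝ) ^ 3) (mixRate T.size (T.size - (n + i + 1)))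
          ≤ T * (12 * (1 + K.diam) / (T : ℝ) ^ 2) := mul_le_mul hkT hleak hleak0 (by positivity)
      have := ih (by omega)
      rw [← Nat.add_assoc n i 1]
      push_cast
      linarith
  have h := hiter (T.size - n) (by omega)
  rw [show n + (T.size - n) = T.size by omega] at h
  refine h.trans (add_le_add le_rfl ?_)
  have h1 : ((T.size - n : ℕ) : ℝ) ≤ T := by
    exact_mod_cast (Nat.sub_le _ _).trans (size_le_self T)
  calc ((T.size - n : ℕ) : ℝ) * (T * (12 * (1 + K.diam) / (T : ℝ) ^ 2))
      ≤ T * (T * (12 * (1 + K.diam) / (T : ℝ) ^ 2)) :=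
        mul_le_mul_of_nonneg_right h1 (by positivity)
    _ = 12 * (1 + K.diam) := by field_simp

theorem log_le_size (T : ℕ) : Real.log T ≤ T.size := by
  rcases Nat.eq_zero_or_pos T with rfl | hT
  · simp
  have h1 : (T : ℝ) ≤ 2 ^ T.size := by exact_mod_cast (Nat.lt_size_self T).le
  have h2 : Real.log T ≤ Real.log (2 ^ T.size) := Real.log_le_log (by exact_mod_cast hT) h1
  rw [Real.log_pow] at h2
  have := Real.log_two_lt_d9
  have h3 : (0 : ℝ) ≤ T.size := Nat.cast_nonneg _
  nlinarith

theorem mixRate_mul_sqrt_le (L j : ℕ) :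
    mixRate L j * Real.sqrt (2 ^ j) ≤ Real.sqrt L := by
  rw [mixRate, ← Real.sqrt_mul (by positivity)]
  refine Real.sqrt_le_sqrt ?_
  rw [div_mul_eq_mul_div, div_le_iff₀ (by positivity)]
  exact mul_le_mul_of_nonneg_left (le_add_of_nonneg_right (Nat.cast_nonneg _)) (Nat.cast_nonneg _)

/-- The summand `L` in the denominator, which keeps the rate below `1`, at most doubles it here; the
rate is then of order `sqrt (L / 2 ^ j)`. -/
theorem sqrt_le_mixRate_mul {L j : ℕ} (h : L ≤ 2 ^ j) :
    Real.sqrt L ≤ 2 * (mixRate L j * Real.sqrt (2 ^ j)) := by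
  have h' : (L : ℝ) ≤ 2 ^ j := by exact_mod_cast h
  have h0 : (0 : ℝ) ≤ L := Nat.cast_nonneg _
  rw [mixRate, ← Real.sqrt_mul (by positivity)]
  refine Real.sqrt_le_iff.2 ⟨by positivity, ?_⟩
  rw [mul_pow, Real.sq_sqrt (by positivity), div_mul_eq_mul_div, ← mul_div_assoc,
    le_div_iff₀ (by positivity)]
  nlinarith

/-- The rate balances the price of learning, of order `T.size / mixRate`, against the switching
charge, of order `2 ^ j * mixRate`. The constant is `24 + 1 + 1 + 12`: learning, the first move of
the leader, switching, and leaks. -/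
theorem mix_regret_le (hT : 0 < T) {j : ℕ} (hj : 2 ^ j ≤ T) (hL : T.size ≤ 2 ^ j) :
    4 * (1 + K.diam) / mixRate T.size j * Real.log (1 / (1 / (T : ℝ) ^ 3)) + K.diam
      + 2 ^ j * (K.diam * mixRate T.size j + K.leak (1 / (T : ℝ) ^ 3) (mixRate T.size j))
      ≤ 38 * ((1 + K.diam) * (Real.sqrt T.size * Real.sqrt (2 ^ j))) := by
  have hD := K.diam_nonneg
  have hL0 : 0 < T.size := Nat.size_pos.2 hT
  have hL1 : (1 : ℝ) ≤ T.size := by exact_mod_cast hL0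
  have hk1 : (1 : ℝ) ≤ 2 ^ j := one_le_pow₀ (by norm_num)
  have hkL1 : 1 ≤ Real.sqrt T.size * Real.sqrt (2 ^ j) :=
    one_le_mul_of_one_le_of_one_le (Real.one_le_sqrt.2 hL1) (Real.one_le_sqrt.2 hk1)
  have hsk := Real.mul_self_sqrt (by positivity : (0 : ℝ) ≤ 2 ^ j)
  have hsL := Real.mul_self_sqrt (by positivity : (0 : ℝ) ≤ T.size)
  have hθ := mixRate_pos hL0 j
  have hθup := mixRate_mul_sqrt_le T.size j
  have hθlow := sqrt_le_mixRate_mul hL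
  set sk := Real.sqrt (2 ^ j)
  set sL := Real.sqrt T.size
  have hsk0 : 0 ≤ sk := Real.sqrt_nonneg _
  have hsL0 : 0 ≤ sL := Real.sqrt_nonneg _
  have hlog : Real.log (1 / (1 / (T : ℝ) ^ 3)) ≤ 3 * T.size := by
    rw [one_div_one_div, Real.log_pow]
    push_cast
    linarith [log_le_size T]
  have hA : 4 * (1 + K.diam) / mixRate T.size j * Real.log (1 / (1 / (T : ℝ) ^ 3))
      ≤ 24 * ((1 + K.diam) * (sL * sk)) := by
    have h4 : (1 : ℝ) / mixRate T.size j * T.size ≤ 2 * (sL * sk) := by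
      rw [one_div, inv_mul_le_iff₀ hθ, ← hsL]
      calc sL * sL ≤ sL * (2 * (mixRate T.size j * sk)) :=
            mul_le_mul_of_nonneg_left hθlow hsL0
        _ = mixRate T.size j * (2 * (sL * sk)) := by ring
    calc 4 * (1 + K.diam) / mixRate T.size j * Real.log (1 / (1 / (T : ℝ) ^ 3))
        ≤ 4 * (1 + K.diam) / mixRate T.size j * (3 * T.size) :=
          mul_le_mul_of_nonneg_left hlog (by positivity)
      _ = 12 * (1 + K.diam) * (1 / mixRate T.size j * T.size) := by ring
      _ ≤ 12 * (1 + K.diam) * (2 * (sL * sk)) := mul_le_mul_of_nonneg_left h4 (by positivity)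
      _ = 24 * ((1 + K.diam) * (sL * sk)) := by ring
  have hB : (2 : ℝ) ^ j * (K.diam * mixRate T.size j) ≤ (1 + K.diam) * (sL * sk) := by
    calc (2 : ℝ) ^ j * (K.diam * mixRate T.size j)
        = K.diam * (mixRate T.size j * sk) * sk := by rw [← hsk]; ring
      _ ≤ (1 + K.diam) * sL * sk := by gcongr; linarith
      _ = (1 + K.diam) * (sL * sk) := by ring
  have hC : (2 : ℝ) ^ j * K.leak (1 / (T : ℝ) ^ 3) (mixRate T.size j) ≤ 12 * (1 + K.diam) := by
    have hT1 : (1 : ℝ) ≤ T := by exact_mod_cast hT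
    have hjT : (2 : ℝ) ^ j ≤ (T : ℝ) ^ 2 := by
      have : (2 : ℝ) ^ j ≤ T := by exact_mod_cast hj
      nlinarith
    calc (2 : ℝ) ^ j * K.leak (1 / (T : ℝ) ^ 3) (mixRate T.size j)
        ≤ (T : ℝ) ^ 2 * (12 * (1 + K.diam) / (T : ℝ) ^ 2) :=
          mul_le_mul hjT (K.leak_mixRate_le hT hL0 hj) (K.leak_nonneg (weight_pos hT).le hθ.le)
            (by positivity)
      _ = 12 * (1 + K.diam) := by field_simp
  have hG : 1 + K.diam ≤ (1 + K.diam) * (sL * sk) := le_mul_of_one_le_right (by positivity) hkL1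
  rw [mul_add ((2 : ℝ) ^ j)]
  linarith

/-- The rate balances the noise range against the moves, with `m` in place of `log (2 * N)` and
`K.diam + 1` in place of `K.diam`. -/
theorem leader_regret_le (hm : 0 < m) (hNm : Real.log (2 * N) ≤ m) (j : ℕ) :
    Real.log (2 * N) / K.leaderRate m j + 2 ^ j * (K.diam * (2 * K.leaderRate m j))
      ≤ 3 * (Real.sqrt ((K.diam + 1) * m) * Real.sqrt (2 ^ j)) := by
  have hD := K.diam_nonneg
  have hm0 : (0 : ℝ) < m := by exact_mod_cast hm
  have hη : 0 < K.leaderRate m j := Real.sqrt_pos.2 (by positivity)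
  have hsk := Real.mul_self_sqrt (by positivity : (0 : ℝ) ≤ 2 ^ j)
  have hlead : K.leaderRate m j * Real.sqrt (2 ^ j) = Real.sqrt (m / (K.diam + 1)) := by
    rw [leaderRate, ← Real.sqrt_mul (by positivity)]
    congr 1
    field_simp
  have h6 : (K.diam + 1) * Real.sqrt (m / (K.diam + 1)) = Real.sqrt ((K.diam + 1) * m) := by
    rw [Real.sqrt_div hm0.le, Real.sqrt_mul (by positivity), ← mul_div_assoc, div_eq_iff
      (Real.sqrt_pos.2 (by positivity)).ne', mul_right_comm, Real.mul_self_sqrt (by positivity)]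
  have h7 : Real.sqrt ((K.diam + 1) * m) * Real.sqrt (m / (K.diam + 1)) = m := by
    rw [← h6, mul_assoc, Real.mul_self_sqrt (by positivity)]
    field_simp
  have hF : Real.log (2 * N) / K.leaderRate m j
      ≤ Real.sqrt ((K.diam + 1) * m) * Real.sqrt (2 ^ j) := by
    rw [div_le_iff₀ hη]
    calc Real.log (2 * N) ≤ m := hNm
      _ = Real.sqrt ((K.diam + 1) * m) * (K.leaderRate m j * Real.sqrt (2 ^ j)) := by rw [hlead, h7]
      _ = _ := by ring
  have hE : (2 : ℝ) ^ j * (K.diam * (2 * K.leaderRate m j))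
      ≤ 2 * (Real.sqrt ((K.diam + 1) * m) * Real.sqrt (2 ^ j)) := by
    calc (2 : ℝ) ^ j * (K.diam * (2 * K.leaderRate m j))
        = 2 * (K.diam * (K.leaderRate m j * Real.sqrt (2 ^ j)) * Real.sqrt (2 ^ j)) := by
          rw [← hsk]
          simp only [Real.mul_self_sqrt (by positivity : (0 : ℝ) ≤ 2 ^ j)]
          ring_nf
          rw [Real.sq_sqrt (by positivity)]
      _ ≤ 2 * ((K.diam + 1) * (K.leaderRate m j * Real.sqrt (2 ^ j)) * Real.sqrt (2 ^ j)) := by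
          gcongr
          linarith
      _ = _ := by rw [hlead, h6]
  linarith

theorem integral_cost_output_block_le (hN : 0 < N) (hT : 0 < T) (hm : 0 < m)
    (hNm : Real.log (2 * N) ≤ m) {j a x : ℕ} (hj : 2 ^ j ≤ T) (ha : 2 ^ j ∣ a) (hx : x < N) :
    ∫ c, K.cost (K.output N m T b c) a (2 ^ j) ∂coinLaw
      ≤ ∑ t ∈ Finset.Ico a (a + 2 ^ j), K.loss t x
        + (50 * ((1 + K.diam) * Real.sqrt T.size) + 3 * Real.sqrt ((K.diam + 1) * m))
          * Real.sqrt (2 ^ j) := by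
  have hD := K.diam_nonneg
  have hL0 : 0 < T.size := Nat.size_pos.2 hT
  have hL1 : (1 : ℝ) ≤ T.size := by exact_mod_cast hL0
  have hm0 : (0 : ℝ) < m := by exact_mod_cast hm
  have hk1 : (1 : ℝ) ≤ 2 ^ j := one_le_pow₀ (by norm_num)
  have hkL1 : 1 ≤ Real.sqrt T.size * Real.sqrt (2 ^ j) :=
    one_le_mul_of_one_le_of_one_le (Real.one_le_sqrt.2 hL1) (Real.one_le_sqrt.2 hk1)
  have hsm0 : 0 ≤ Real.sqrt ((K.diam + 1) * m) * Real.sqrt (2 ^ j) := by positivity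
  have hprod : 0 ≤ (1 + K.diam) * (Real.sqrt T.size * Real.sqrt (2 ^ j)) := by positivity
  rw [add_mul, mul_assoc 50, mul_assoc (1 + K.diam), mul_assoc 3]
  -- On blocks shorter than `T.size` the trivial bound `(1 + K.diam) * 2 ^ j` already suffices.
  rcases lt_or_ge (2 ^ j) T.size with hlt | hge
  · have hsum0 : 0 ≤ ∑ t ∈ Finset.Ico a (a + 2 ^ j), K.loss t x :=
      Finset.sum_nonneg fun _ _ => K.loss_nonneg _ _
    have h1 : ∫ c, K.cost (K.output N m T b c) a (2 ^ j) ∂coinLaw ≤ (1 + K.diam) * (2 ^ j : ℕ) := by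
      refine (integral_mono (K.integrable_cost _ (fun t => K.measurable_stack b _ t) _ _)
        (integrable_const _) fun c => K.cost_le _ _ _).trans ?_
      simp
    have h3 : (2 : ℝ) ^ j ≤ Real.sqrt T.size * Real.sqrt (2 ^ j) := by
      have h2 : Real.sqrt (2 ^ j) ≤ Real.sqrt T.size :=
        Real.sqrt_le_sqrt (by exact_mod_cast hlt.le)
      calc (2 : ℝ) ^ j = Real.sqrt (2 ^ j) * Real.sqrt (2 ^ j) :=
            (Real.mul_self_sqrt (by positivity)).symm
        _ ≤ _ := mul_le_mul_of_nonneg_right h2 (Real.sqrt_nonneg _)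
    have h4 := mul_le_mul_of_nonneg_left h3 (by positivity : 0 ≤ 1 + K.diam)
    push_cast at h1
    linarith
  · have hjL : j < T.size := Nat.lt_size.2 hj
    -- The scale `2 ^ j` is treated in step `T.size - 1 - j` of the stack. The later steps concern
    -- finer scales, and their leaks raise the constant from `38` to `50`.
    have hidx : T.size - (T.size - 1 - j + 1) = j := by omega
    have h1 := K.integral_cost_output_le (N := N) (m := m) b hT (n := T.size - 1 - j + 1) (a := a)
      (k := 2 ^ j) (by omega) ((Nat.pow_dvd_pow 2 (by omega)).trans ha) hj
    have h2 := K.integral_cost_stack_succ_le' (N := N) (L := T.size) (m := m) b (weight_pos hT)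
      (weight_le_one hT) (n := T.size - 1 - j) (by omega) (a := a) (by rw [hidx]; exact ha)
    rw [hidx] at h2
    have hη : 0 < K.leaderRate m j := Real.sqrt_pos.2 (by positivity)
    obtain ⟨k, hk⟩ : ∃ k, 2 ^ j = k + 1 :=
      ⟨2 ^ j - 1, by have := Nat.two_pow_pos j; omega⟩
    have hkr : (k : ℝ) + 1 = (2 : ℝ) ^ j := by exact_mod_cast hk.symm
    have h3 := K.integral_cost_leader_le hN hη ha (k := k) hk.ge hx
    rw [← hk, hkr] at h3
    have h4 := K.mix_regret_le hT hj hge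
    have h5 := K.leader_regret_le hm hNm j
    have hG : 1 + K.diam ≤ (1 + K.diam) * (Real.sqrt T.size * Real.sqrt (2 ^ j)) :=
      le_mul_of_one_le_right (by positivity) hkL1
    linarith

/-- A subadditive function of intervals that is bounded on dyadic intervals. -/
theorem interval_le_of_dyadic_le {ρ : ℕ → ℕ → ℝ} {W : ℝ} (hW : 0 ≤ W)
    (hadd : ∀ a k n, ρ a (k + n) ≤ ρ a k + ρ (a + k) n)
    (hblock : ∀ j a, 2 ^ j ≤ T → 2 ^ j ∣ a → ρ a (2 ^ j) ≤ W * Real.sqrt (2 ^ j))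
    {a k : ℕ} (hk : 0 < k) (hkT : k ≤ T) : ρ a k ≤ 6 * W * Real.sqrt k := by
  -- The constant `3` closes the induction: for `r < 2 ^ i` the square of `sqrt (2 ^ i) + 3 * sqrt
  -- r` is at most `7 * 2 ^ i + 9 * r`.
  have hcombine : ∀ {i r : ℕ} {A B : ℝ}, r < 2 ^ i → A ≤ W * Real.sqrt (2 ^ i) →
      B ≤ 3 * W * Real.sqrt r → A + B ≤ 3 * W * Real.sqrt ((2 ^ i + r : ℕ) : ℝ) := by
    intro i r A B hr hA hB
    have hr' : (r : ℝ) ≤ 2 ^ i := by exact_mod_cast hr.le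
    have hroot : Real.sqrt (2 ^ i) + 3 * Real.sqrt r ≤ 3 * Real.sqrt ((2 ^ i + r : ℕ) : ℝ) := by
      have h1 := Real.sq_sqrt (by positivity : (0 : ℝ) ≤ 2 ^ i)
      have h2 := Real.sq_sqrt (by positivity : (0 : ℝ) ≤ r)
      have h3 := Real.sq_sqrt (by positivity : (0 : ℝ) ≤ ((2 ^ i + r : ℕ) : ℝ))
      have h4 := Real.sqrt_le_sqrt hr'
      have h5 := Real.sqrt_nonneg (r : ℝ)
      have h6 := Real.sqrt_nonneg ((2 : ℝ) ^ i)
      refine abs_le_of_sq_le_sq' ?_ (by positivity) |>.2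
      push_cast at *
      nlinarith [mul_nonneg h5 (sub_nonneg.2 h4)]
    nlinarith
  -- From an aligned left end, the largest dyadic block is cut off first; its right end is aligned
  -- for the rest.
  have hleft : ∀ k, 0 < k → k ≤ T → ∀ j a, 2 ^ j ∣ a → k < 2 ^ (j + 1) →
      ρ a k ≤ 3 * W * Real.sqrt k := by
    intro k
    induction k using Nat.strong_induction_on with
    | _ k ih =>
      intro hk hkT j a ha hkj
      obtain ⟨i, hi1, hi2⟩ : ∃ i, 2 ^ i ≤ k ∧ k < 2 ^ (i + 1) :=
        ⟨Nat.log 2 k, Nat.pow_log_le_self 2 hk.ne', Nat.lt_pow_succ_log_self (by norm_num) k⟩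
      obtain ⟨r, rfl⟩ := Nat.exists_eq_add_of_le hi1
      have hij : i < j + 1 := (Nat.pow_lt_pow_iff_right (by norm_num : 1 < 2)).1 (hi1.trans_lt hkj)
      have hia : 2 ^ i ∣ a := (Nat.pow_dvd_pow 2 (by omega)).trans ha
      have hr : r < 2 ^ i := by rw [pow_succ] at hi2; omega
      have hb := hblock i a (hi1.trans hkT) hia
      have h2i := Nat.two_pow_pos i
      rcases Nat.eq_zero_or_pos r with rfl | hr0
      · have := Real.sqrt_nonneg ((2 : ℝ) ^ i)
        have : 0 ≤ W * Real.sqrt (2 ^ i) := by positivity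
        simp only [Nat.add_zero]
        push_cast
        linarith
      · refine (hadd a (2 ^ i) r).trans (hcombine hr hb ?_)
        exact ih r (by omega) hr0 (by omega) i (a + 2 ^ i) (hia.add (dvd_refl _))
          (hr.trans (by rw [pow_succ]; omega))
  -- The mirror image, with the blocks cut off at an aligned right end.
  have hright : ∀ k, 0 < k → k ≤ T → ∀ j a, 2 ^ j ∣ a + k → k < 2 ^ (j + 1) →
      ρ a k ≤ 3 * W * Real.sqrt k := by
    intro k
    induction k using Nat.strong_induction_on with
    | _ k ih =>
      intro hk hkT j a ha hkj
      obtain ⟨i, hi1, hi2⟩ : ∃ i, 2 ^ i ≤ k ∧ k < 2 ^ (i + 1) :=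
        ⟨Nat.log 2 k, Nat.pow_log_le_self 2 hk.ne', Nat.lt_pow_succ_log_self (by norm_num) k⟩
      obtain ⟨r, rfl⟩ := Nat.exists_eq_add_of_le hi1
      have hij : i < j + 1 := (Nat.pow_lt_pow_iff_right (by norm_num : 1 < 2)).1 (hi1.trans_lt hkj)
      have hia : 2 ^ i ∣ a + r := by
        have h1 : 2 ^ i ∣ a + (2 ^ i + r) := (Nat.pow_dvd_pow 2 (by omega)).trans ha
        rw [show a + (2 ^ i + r) = (a + r) + 2 ^ i by omega] at h1
        exact (Nat.dvd_add_left (dvd_refl _)).1 h1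
      have hr : r < 2 ^ i := by rw [pow_succ] at hi2; omega
      have hb := hblock i (a + r) (hi1.trans hkT) hia
      have h2i := Nat.two_pow_pos i
      rcases Nat.eq_zero_or_pos r with rfl | hr0
      · have := Real.sqrt_nonneg ((2 : ℝ) ^ i)
        have : 0 ≤ W * Real.sqrt (2 ^ i) := by positivity
        simp only [Nat.add_zero] at hb ⊢
        push_cast
        linarith
      · have h1 := hcombine hr hb (ih r (by omega) hr0 (by omega) i a hia
          (hr.trans (by rw [pow_succ]; omega)))
        have h2 := hadd a r (2 ^ i)
        rw [Nat.add_comm r] at h2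
        linarith
  obtain ⟨i, hi1, hi2⟩ : ∃ i, 2 ^ i ≤ k ∧ k < 2 ^ (i + 1) :=
    ⟨Nat.log 2 k, Nat.pow_log_le_self 2 hk.ne', Nat.lt_pow_succ_log_self (by norm_num) k⟩
  have h2i := Nat.two_pow_pos i
  -- Cutting at the first multiple of `2 ^ i` leaves one part with an aligned right end and one with
  -- an aligned left end, each at constant `3`.
  obtain ⟨s, hs, hsa⟩ : ∃ s, s < 2 ^ i ∧ 2 ^ i ∣ a + s := by
    refine ⟨(2 ^ i - a % 2 ^ i) % 2 ^ i, Nat.mod_lt _ h2i, ?_⟩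
    have hlt := Nat.mod_lt a h2i
    have hda := Nat.div_add_mod a (2 ^ i)
    rcases Nat.eq_zero_or_pos (a % 2 ^ i) with h0 | h0
    · rw [h0, Nat.sub_zero, Nat.mod_self, Nat.add_zero]
      exact Nat.dvd_of_mod_eq_zero h0
    · rw [Nat.mod_eq_of_lt (by omega : 2 ^ i - a % 2 ^ i < 2 ^ i)]
      exact ⟨a / 2 ^ i + 1, by rw [mul_add]; omega⟩
  obtain ⟨r, rfl⟩ := Nat.exists_eq_add_of_le (hs.le.trans hi1)
  have hroot : ∀ n : ℕ, n ≤ s + r → 3 * W * Real.sqrt n ≤ 3 * W * Real.sqrt ((s + r : ℕ) : ℝ) := by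
    intro n hn
    exact mul_le_mul_of_nonneg_left (Real.sqrt_le_sqrt (by exact_mod_cast hn)) (by positivity)
  have h1 := hleft r (by omega) (by omega) i (a + s) hsa (by omega)
  have h3 := hroot r (by omega)
  rcases Nat.eq_zero_or_pos s with rfl | hs0
  · simp only [Nat.zero_add, Nat.add_zero] at *
    have : 0 ≤ W * Real.sqrt r := by positivity
    linarith
  · have h2 := hright s hs0 (by omega) i a hsa (hs.trans (by rw [pow_succ]; omega))
    have h4 := hroot s (by omega)
    have := hadd a s r
    linarith

theorem integral_cost_output_interval_le (hN : 0 < N) (hT : 0 < T) (hm : 0 < m)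
    (hNm : Real.log (2 * N) ≤ m) {a k x : ℕ} (hk : k ≤ T) (hx : x < N) :
    ∫ c, K.cost (K.output N m T b c) a k ∂coinLaw
      ≤ ∑ t ∈ Finset.Ico a (a + k), K.loss t x
        + 6 * (51 * ((1 + K.diam) * Real.sqrt T.size) + 3 * Real.sqrt ((K.diam + 1) * m))
          * Real.sqrt k := by
  have hD := K.diam_nonneg
  rcases Nat.eq_zero_or_pos k with rfl | hk0
  · simp [cost_zero]
  have hint := fun a k => K.integrable_cost (coinLaw)
    (fun t => K.measurable_stack (N := N) (L := T.size) (m := m) (w := 1 / (T : ℝ) ^ 3) b T.size t)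
    a k
  -- By `cost_add_le`, the regret plus one diameter is subadditive. The added diameter raises the
  -- constant from `50` to `51`.
  have h := interval_le_of_dyadic_le (T := T)
    (ρ := fun a k => ∫ c, K.cost (K.output N m T b c) a k ∂coinLaw
      - ∑ t ∈ Finset.Ico a (a + k), K.loss t x + K.diam)
    (W := 51 * ((1 + K.diam) * Real.sqrt T.size) + 3 * Real.sqrt ((K.diam + 1) * m))
    (by positivity) (fun a k n => ?_) (fun j a hj ha => ?_) (a := a) hk0 hk
  · linarith
  · have h1 : ∫ c, K.cost (K.output N m T b c) a (k + n) ∂coinLaw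
        ≤ ∫ c, (K.cost (K.output N m T b c) a k + K.cost (K.output N m T b c) (a + k) n
          + K.diam) ∂coinLaw :=
      integral_mono (hint _ _) (((hint _ _).add (hint _ _)).add (integrable_const _))
        fun c => K.cost_add_le _ _ _ _
    have h2 : ∫ c, (K.cost (K.output N m T b c) a k + K.cost (K.output N m T b c) (a + k) n
          + K.diam) ∂coinLaw = ∫ c, K.cost (K.output N m T b c) a k ∂coinLaw
          + ∫ c, K.cost (K.output N m T b c) (a + k) n ∂coinLaw + K.diam := by
      have h3 : Integrable (fun c => K.cost (K.output N m T b c) a k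
          + K.cost (K.output N m T b c) (a + k) n) coinLaw := (hint _ _).add (hint _ _)
      have h4 : ∫ c, (K.cost (K.output N m T b c) a k + K.cost (K.output N m T b c) (a + k) n)
          ∂coinLaw = ∫ c, K.cost (K.output N m T b c) a k ∂coinLaw
          + ∫ c, K.cost (K.output N m T b c) (a + k) n ∂coinLaw :=
        integral_add (hint _ _) (hint _ _)
      rw [integral_add h3 (integrable_const _), h4]
      simp
    have h4 := Finset.sum_Ico_consecutive (fun t => K.loss t x) (by omega : a ≤ a + k)
      (by omega : a + k ≤ a + k + n)
    rw [← Nat.add_assoc a k n]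
    simp only [Nat.add_assoc] at *
    linarith
  · have h1 := K.integral_cost_output_block_le b hN hT hm hNm hj ha hx
    have hL1 : (1 : ℝ) ≤ T.size := by exact_mod_cast Nat.size_pos.2 hT
    have h2 : 1 ≤ Real.sqrt T.size * Real.sqrt (2 ^ j) :=
      one_le_mul_of_one_le_of_one_le (Real.one_le_sqrt.2 hL1)
        (Real.one_le_sqrt.2 (one_le_pow₀ (by norm_num)))
    nlinarith

end Dyadic

end CodedTask

/-! ### Reasoning about programs -/

/-- `s'` differs from `s` at most in the integer arrays `I`, the real arrays `R`, the number of
draws, and the time. -/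
structure Store.Frame (I R : List ℕ) (s s' : Store) : Prop where
  int : ∀ a ∉ I, s'.int a = s.int a
  real : ∀ a ∉ R, s'.real a = s.real a

theorem Store.Frame.trans {I R I' R' : List ℕ} {s s' s'' : Store} (h : Store.Frame I R s s')
    (h' : Store.Frame I' R' s' s'') : Store.Frame (I ++ I') (R ++ R') s s'' where
  int a ha := by
    simp only [List.mem_append, not_or] at ha
    rw [h'.int a ha.2, h.int a ha.1]
  real a ha := by
    simp only [List.mem_append, not_or] at ha
    rw [h'.real a ha.2, h.real a ha.1]

theorem Store.Frame.mono {I R I' R' : List ℕ} {s s' : Store} (h : Store.Frame I R s s')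
    (hI : I ⊆ I') (hR : R ⊆ R') : Store.Frame I' R' s s' :=
  ⟨fun a ha => h.int a fun h' => ha (hI h'), fun a ha => h.real a fun h' => ha (hR h')⟩

@[simp] theorem IExp.eval_tick (i : IExp) (s : Store) (k : ℕ) : i.eval (s.tick k) = i.eval s := by
  induction i with
  | lit n => rfl
  | get a i ih => simp only [IExp.eval, ih]; rfl
  | add i j hi hj => simp only [IExp.eval, hi, hj]
  | sub i j hi hj => simp only [IExp.eval, hi, hj]
  | mul i j hi hj => simp only [IExp.eval, hi, hj]

@[simp] theorem RExp.eval_tick (x : RExp) (s : Store) (k : ℕ) : x.eval (s.tick k) = x.eval s := by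
  induction x with
  | ofInt i => simp only [RExp.eval, IExp.eval_tick]
  | get a i => simp only [RExp.eval, IExp.eval_tick]; rfl
  | add x y hx hy => simp only [RExp.eval, hx, hy]
  | sub x y hx hy => simp only [RExp.eval, hx, hy]
  | mul x y hx hy => simp only [RExp.eval, hx, hy]
  | div x y hx hy => simp only [RExp.eval, hx, hy]
  | exp x hx => simp only [RExp.eval, hx]
  | pow x y hx hy => simp only [RExp.eval, hx, hy]
  | erf x hx => simp only [RExp.eval, hx]

namespace Program

variable (coins : ℕ → unitInterval) (s : Store)

theorem exec_seq (c d : Program) : (seq c d).exec coins s = d.exec coins (c.exec coins s) := rfl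

theorem int_setInt (a : ℕ) (i v : IExp) : ((setInt a i v).exec coins s).int
    = Function.update s.int a (Function.update (s.int a) (i.eval s) (v.eval s)) := rfl

theorem real_setInt (a : ℕ) (i v : IExp) : ((setInt a i v).exec coins s).real = s.real := rfl

theorem int_setReal (a : ℕ) (i : IExp) (v : RExp) :
    ((setReal a i v).exec coins s).int = s.int := rfl

theorem real_setReal (a : ℕ) (i : IExp) (v : RExp) : ((setReal a i v).exec coins s).real
    = Function.update s.real a (Function.update (s.real a) (i.eval s) (v.eval s)) := rfl

/-- Assign to an integer entry if `b` holds. -/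
def condInt (b : Test) (a : ℕ) (i v : IExp) : Program := ite b (setInt a i v) skip

/-- Assign to a real entry if `b` holds. -/
def condReal (b : Test) (a : ℕ) (i : IExp) (v : RExp) : Program := ite b (setReal a i v) skip

theorem real_condInt (b : Test) (a : ℕ) (i v : IExp) :
    ((condInt b a i v).exec coins s).real = s.real := by
  simp only [condInt, exec]
  split_ifs <;> rfl

open Classical in
theorem int_condInt (b : Test) (a : ℕ) (i v : IExp) : ((condInt b a i v).exec coins s).int
    = Function.update s.int a (Function.update (s.int a) (i.eval s)
      (if b.Holds s then v.eval s else s.int a (i.eval s))) := by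
  by_cases h : b.Holds s
  · simp only [condInt, exec, if_pos h, IExp.eval_tick]
    rfl
  · simp only [condInt, exec, if_neg h, Function.update_eq_self]
    rfl

theorem int_condReal (b : Test) (a : ℕ) (i : IExp) (v : RExp) :
    ((condReal b a i v).exec coins s).int = s.int := by
  simp only [condReal, exec]
  split_ifs <;> rfl

open Classical in
theorem real_condReal (b : Test) (a : ℕ) (i : IExp) (v : RExp) :
    ((condReal b a i v).exec coins s).real
    = Function.update s.real a (Function.update (s.real a) (i.eval s)
      (if b.Holds s then v.eval s else s.real a (i.eval s))) := by
  by_cases h : b.Holds s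
  · simp only [condReal, exec, if_pos h, IExp.eval_tick, RExp.eval_tick]
    rfl
  · simp only [condReal, exec, if_neg h, Function.update_eq_self]
    rfl

/-- Programs without loops. -/
def Flat : Program → Prop
  | skip | setInt _ _ _ | setReal _ _ _ | draw _ _ => True
  | seq c d => c.Flat ∧ d.Flat
  | ite _ c d => c.Flat ∧ d.Flat
  | loop _ _ _ => False

/-- A bound on the time of a program without loops. -/
def flatCost : Program → ℕ
  | skip => 1
  | setInt _ i v => i.cost + v.cost + 1
  | setReal _ i v => i.cost + v.cost + 1
  | draw _ i => i.cost + 1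
  | seq c d => c.flatCost + d.flatCost
  | ite b c d => b.cost + (c.flatCost + d.flatCost)
  | loop _ _ _ => 0

theorem time_exec_le {c : Program} (hc : c.Flat) (s : Store) :
    (c.exec coins s).time ≤ s.time + c.flatCost := by
  induction c generalizing s with
  | skip => exact le_rfl
  | setInt a i v => exact le_rfl
  | setReal a i v => exact le_rfl
  | draw a i => exact (Nat.add_assoc _ _ _).le
  | seq c d ihc ihd =>
    have h1 := ihc hc.1 s
    have h2 := ihd hc.2 (c.exec coins s)
    simp only [exec_seq, flatCost]
    omega
  | ite b c d ihc ihd =>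
    have h1 := ihc hc.1 (s.tick b.cost)
    have h2 := ihd hc.2 (s.tick b.cost)
    simp only [exec, flatCost, Store.tick] at *
    split_ifs <;> omega
  | loop n b c => exact hc.elim

end Program

/-- For a loop that ends after exactly `k` iterations. If the counter is exhausted there is no final
test, otherwise the failing test is paid for; therefore `Q` is needed with and without the tick. -/
theorem whileUpTo_rule {b : Test} {body : Store → Store} (I : ℕ → Store → Prop) {Q : Store → Prop}
    {k n : ℕ} (hkn : k ≤ n) {s : Store} (h0 : I 0 s)
    (hstep : ∀ i < k, ∀ s, I i s → b.Holds s ∧ I (i + 1) (body (s.tick b.cost)))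
    (hend : ∀ s, I k s → k < n → ¬ b.Holds s)
    (hQ : ∀ s, I k s → Q s ∧ Q (s.tick b.cost)) : Q (whileUpTo b body n s) := by
  induction k generalizing n s I with
  | zero =>
    cases n with
    | zero => exact (hQ s h0).1
    | succ n =>
      rw [whileUpTo, if_neg (hend s h0 (Nat.succ_pos n))]
      exact (hQ s h0).2
  | succ k ih =>
    cases n with
    | zero => omega
    | succ n =>
      have h := hstep 0 (Nat.succ_pos k) s h0
      rw [whileUpTo, if_pos h.1]
      exact ih (fun i => I (i + 1)) (by omega) h.2 (fun i hi => hstep (i + 1) (by omega))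
        (fun s hs hk => hend s hs (by omega)) hQ

/-- A test that always holds. -/
def Test.always : Test := .intLE (.lit 0) (.lit 0)

theorem Test.holds_always (s : Store) : Test.always.Holds s := by simp [Test.always, Test.Holds]

theorem forLoop_rule {body : Store → Store} (I : ℕ → Store → Prop) {n : ℕ} {s : Store} (h0 : I 0 s)
    (hstep : ∀ i < n, ∀ s, I i s → I (i + 1) (body (s.tick 3))) :
    I n (whileUpTo Test.always body n s) := by
  induction n generalizing s I with
  | zero => exact h0
  | succ n ih =>
    rw [whileUpTo, if_pos (Test.holds_always s)]
    exact ih (fun i => I (i + 1)) (hstep 0 (Nat.succ_pos n) s h0)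
      fun i hi => hstep (i + 1) (by omega)

/-! ### The program -/

namespace Overlay

/-- Entry `0` of an integer array. -/
def cell (a : ℕ) : IExp := .get a (.lit 0)

def one : RExp := .ofInt (.lit 1)

def diameter : RExp := .get 0 (.lit 0)

def sqrt (x : RExp) : RExp := .pow x (.div one (.ofInt (.lit 2)))

theorem eval_sqrt (x : RExp) (s : Store) : (sqrt x).eval s = Real.sqrt (x.eval s) := by
  simp only [sqrt, RExp.eval, one, IExp.eval, positivePow]
  split_ifs with h
  · rw [Real.sqrt_eq_rpow]
    norm_num
  · rw [Real.sqrt_eq_zero_of_nonpos (not_lt.1 h)]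

/-- The number of states `N`. -/
def states : IExp := cell 0

/-- The horizon `T`. -/
def horizon : IExp := cell 1

/-- The current output. -/
def current : IExp := cell 3

/-- The index of a state. -/
def index : IExp := cell 11

/-- The index of a time scale. -/
def scale : IExp := cell 12

/-- The state with the least perturbed loss so far. -/
def best : IExp := cell 13

def scaleLength : IExp := .get 4 scale

/-- One step of the computation of a binary length. -/
def sizeStep (a : ℕ) : Program :=
  .seq (.setInt 4 (cell a) (cell 14))
    (.seq (.setInt 14 (.lit 0) (.mul (cell 14) (.lit 2)))
      (.setInt a (.lit 0) (.add (cell a) (.lit 1))))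

/-- Compute the binary length of `x` in entry `0` of the integer array `a`, and store the powers
of `2` that do not exceed `x` in the integer array `4`. -/
def computeSize (x : IExp) (a : ℕ) : Program :=
  .seq (.setInt a (.lit 0) (.lit 0))
    (.seq (.setInt 14 (.lit 0) (.lit 1))
      (.loop x (.intLE (cell 14) x) (sizeStep a)))

def drawStep : Program :=
  .seq (.draw 3 index) (.setInt 11 (.lit 0) (.add index (.lit 1)))

/-- Draw all the coins. -/
def drawCoins : Program :=
  .seq (.setInt 11 (.lit 0) (.lit 0))
    (.seq (.loop (.add states (cell 8)) .always drawStep) (.setInt 10 (.lit 0) (.lit 1)))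

/-- The test whether the current time scale is restarted. -/
def restart : Test := .intLE (.get 5 scale) (.lit 0)

/-- The real array `4` holds the exponentiated perturbed losses, one row of length `N` per time
scale. -/
def leaderIndex : IExp := .add (.mul scale states) index

def leaderRateExp : RExp :=
  sqrt (.div (.ofInt (cell 9)) (.mul (.add diameter one) (.ofInt scaleLength)))

def leaderStep : Program :=
  .seq (.condReal restart 4 leaderIndex (.add (.get 3 index) (.div one (.ofInt states))))
    (.seq (.setReal 4 leaderIndex
        (.mul (.get 4 leaderIndex) (.exp (.mul leaderRateExp (.get 2 index)))))
      (.seq (.condInt (.realLE (.get 4 leaderIndex) (.get 4 (.add (.mul scale states) best)))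
          13 (.lit 0) index)
        (.setInt 11 (.lit 0) (.add index (.lit 1)))))

/-- Compute the perturbed leader on the current time scale. -/
def computeLeader : Program := .loop states .always leaderStep

def mixRateExp : RExp :=
  sqrt (.div (.ofInt (cell 8)) (.add (.ofInt scaleLength) (.ofInt (cell 8))))

/-- The cost of being in the state `i` after the state `j`. -/
def stateCost (i j : IExp) : RExp :=
  .add (.get 2 i) (.get 1 (.add (.mul i states) j))

def advantageExp : RExp :=
  .div (.mul mixRateExp (.sub
      (.sub (stateCost current (.get 6 scale)) (stateCost best (.get 7 scale)))
      (.mul diameter mixRateExp)))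
    (.mul (.ofInt (.lit 4)) (.add one diameter))

def weightExp : RExp :=
  .div one (.mul (.mul (.ofInt horizon) (.ofInt horizon)) (.ofInt horizon))

def updateBias : Program :=
  .seq (.condReal restart 5 scale weightExp)
    (.setReal 5 scale (.mul (.get 5 scale) (.exp advantageExp)))

def remember : Program :=
  .seq (.setInt 6 scale current) (.setInt 7 scale best)

def choose : Program :=
  .condInt (.realLE (.get 3 (.add states scale)) (.get 5 scale)) 3 (.lit 0) best

/-- Maintains the round number modulo `2 ^ j`, as the machine has no remainder operation. -/
def updateCount : Program :=
  .seq (.setInt 5 scale (.add (.get 5 scale) (.lit 1)))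
    (.condInt (.intLE scaleLength (.get 5 scale)) 5 scale (.lit 0))

def beginScale : Program :=
  .seq (.setInt 12 (.lit 0) (.sub scale (.lit 1)))
    (.seq (.setInt 11 (.lit 0) (.lit 0)) (.setInt 13 (.lit 0) (.lit 0)))

/-- The order matters: `updateBias` reads the states remembered from the previous round, and
`remember` has to save the unmixed state before `choose` overwrites it. -/
def endScale : Program := .seq updateBias (.seq remember (.seq choose updateCount))

/-- Mix in the perturbed leader on the next time scale. -/
def scaleStep : Program := .seq beginScale (.seq computeLeader endScale)

def beginRound : Program :=
  .seq (.setInt 3 (.lit 0) (cell 2)) (.setInt 12 (.lit 0) (cell 8))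

/-- The program of one round. -/
def program : Program :=
  .seq (computeSize (.mul states horizon) 9)
    (.seq (computeSize horizon 8)
      (.seq (.ite (.intLE (cell 10) (.lit 0)) drawCoins .skip)
        (.seq beginRound (.loop (cell 8) .always scaleStep))))

/-! ### Its effect on the store -/

section Correctness

variable (K : CodedTask) (N T : ℕ) (b : ℕ → ℕ) (U : ℕ → unitInterval)

/-- The sequence of states before mixing in the leader on the time scale `2 ^ j`. -/
noncomputable def coarse (j : ℕ) : ℕ → ℕ :=
  K.stack N T.size (N * T).size (1 / (T : ℝ) ^ 3) b U (T.size - (j + 1))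

/-- The leader on the time scale `2 ^ j`. -/
noncomputable def lead (j : ℕ) : ℕ → ℕ :=
  K.leader N (2 ^ j) (K.leaderRate (N * T).size j) U

/-- The data that do not change during a round. -/
structure Input (t : ℕ) (s : Store) : Prop where
  states : s.int 0 0 = N
  horizon : s.int 1 0 = T
  diam : s.real 0 0 = K.diam
  move : ∀ i < N, ∀ j < N, s.real 1 (i * N + j) = K.move i j
  loss : ∀ i < N, s.real 2 i = K.loss t i

/-- The data that are computed at the beginning of a round. -/
structure Prepared (s : Store) : Prop where
  scales : s.int 8 0 = T.size
  size : s.int 9 0 = (N * T).size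
  power : ∀ j < T.size, s.int 4 j = 2 ^ j
  coins : ∀ i < N + T.size, s.real 3 i = U i

/-- The data of the time scale `2 ^ j` before round `t`. -/
structure ScaleData (j t : ℕ) (s : Store) : Prop where
  count : s.int 5 j = t % 2 ^ j
  coarse : s.int 6 j = CodedTask.previous (coarse K N T b U j) t
  lead : s.int 7 j = CodedTask.previous (lead K N T U j) t
  bias : ∀ r, t = r + 1 → s.real 5 j = K.bias (2 ^ j) (1 / (T : ℝ) ^ 3)
    (CodedTask.mixRate T.size j) (Overlay.coarse K N T b U j) (Overlay.lead K N T U j) r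
  perturbed : ∀ r, t = r + 1 → ∀ i < N, s.real 4 (j * N + i)
    = K.perturbed N (2 ^ j) (K.leaderRate (N * T).size j) U r i

variable {K N T b U} {t : ℕ} {s s' : Store}

theorem Input.of_frame {I R : List ℕ} (h : Input K N T t s) (hf : Store.Frame I R s s')
    (hI : 0 ∉ I ∧ 1 ∉ I) (hR : 0 ∉ R ∧ 1 ∉ R ∧ 2 ∉ R) : Input K N T t s' where
  states := by rw [hf.int 0 hI.1, h.states]
  horizon := by rw [hf.int 1 hI.2, h.horizon]
  diam := by rw [hf.real 0 hR.1, h.diam]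
  move := by rw [hf.real 1 hR.2.1]; exact h.move
  loss := by rw [hf.real 2 hR.2.2]; exact h.loss

theorem Prepared.of_frame {I R : List ℕ} (h : Prepared N T U s) (hf : Store.Frame I R s s')
    (hI : 8 ∉ I ∧ 9 ∉ I ∧ 4 ∉ I) (hR : 3 ∉ R) : Prepared N T U s' where
  scales := by rw [hf.int 8 hI.1, h.scales]
  size := by rw [hf.int 9 hI.2.1, h.size]
  power := by rw [hf.int 4 hI.2.2]; exact h.power
  coins := by rw [hf.real 3 hR]; exact h.coins

theorem ScaleData.of_eq {j : ℕ} (h : ScaleData K N T b U j t s) (h5 : s'.int 5 j = s.int 5 j)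
    (h6 : s'.int 6 j = s.int 6 j) (h7 : s'.int 7 j = s.int 7 j) (hb : s'.real 5 j = s.real 5 j)
    (hp : ∀ i < N, s'.real 4 (j * N + i) = s.real 4 (j * N + i)) :
    ScaleData K N T b U j t s' where
  count := by rw [h5, h.count]
  coarse := by rw [h6, h.coarse]
  lead := by rw [h7, h.lead]
  bias r hr := by rw [hb, h.bias r hr]
  perturbed r hr i hi := by rw [hp i hi, h.perturbed r hr i hi]

/-- Nothing is assumed of `y` for `t = 0`: the first round is a restart, so the initial memory
content is irrelevant. -/
theorem accumulate_eq_of {q : ℕ} {w y : ℝ} {z : ℕ → ℝ}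
    (hy : ∀ r, t = r + 1 → y = accumulate q w z r) :
    accumulate q w z t = (if t % q = 0 then w else y) * Real.exp (z t) := by
  cases t with
  | zero => simp [accumulate]
  | succ t => rw [accumulate, hy t rfl]

theorem frame_tick (s : Store) (k : ℕ) : Store.Frame [] [] s (s.tick k) :=
  ⟨fun _ _ => rfl, fun _ _ => rfl⟩

theorem frame_leaderStep (coins : ℕ → unitInterval) (s : Store) :
    Store.Frame [11, 13] [4] s (leaderStep.exec coins s) where
  int a ha := by
    simp only [List.mem_cons, List.not_mem_nil, or_false, not_or] at ha
    simp only [leaderStep, Program.exec_seq, Program.int_setInt, Program.int_condInt,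
      Program.int_setReal, Program.int_condReal, Function.update_of_ne ha.1,
      Function.update_of_ne ha.2]
  real a ha := by
    simp only [List.mem_cons, List.not_mem_nil, or_false] at ha
    simp only [leaderStep, Program.exec_seq, Program.real_setInt, Program.real_condInt,
      Program.real_setReal, Program.real_condReal, Function.update_of_ne ha]

/-- One step of the scan is one step of the recursion for `minIndex`, provided that the entries
before `i` already belong to round `t` while entry `i` still belongs to the round before. -/
theorem leaderStep_spec (coins : ℕ → unitInterval) {j i : ℕ} (hi : i < N) (hj : j < T.size)
    (hin : Input K N T t s) (hpr : Prepared N T U s) (h12 : s.int 12 0 = j) (h11 : s.int 11 0 = i)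
    (h5 : s.int 5 j = t % 2 ^ j)
    (hpert : ∀ r, t = r + 1 → s.real 4 (j * N + i)
      = K.perturbed N (2 ^ j) (K.leaderRate (N * T).size j) U r i)
    (hprev : ∀ k < i, s.real 4 (j * N + k)
      = K.perturbed N (2 ^ j) (K.leaderRate (N * T).size j) U t k)
    (h13 : s.int 13 0 = minIndex (K.perturbed N (2 ^ j) (K.leaderRate (N * T).size j) U t) i) :
    (leaderStep.exec coins s).real 4 = Function.update (s.real 4) (j * N + i)
        (K.perturbed N (2 ^ j) (K.leaderRate (N * T).size j) U t i) ∧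
      (leaderStep.exec coins s).int 11 0 = i + 1 ∧
      (leaderStep.exec coins s).int 13 0
        = minIndex (K.perturbed N (2 ^ j) (K.leaderRate (N * T).size j) U t) (i + 1) := by
  set v := K.perturbed N (2 ^ j) (K.leaderRate (N * T).size j) U with hv
  have hval : v t i = (if t % 2 ^ j = 0 then (U i : ℝ) + 1 / N else s.real 4 (j * N + i))
      * Real.exp (K.leaderRate (N * T).size j * K.loss t i) := accumulate_eq_of hpert
  have hreal : (leaderStep.exec coins s).real 4 = Function.update (s.real 4) (j * N + i) (v t i) := by
    simp [leaderStep, Program.exec_seq, Program.int_condReal, Program.real_setInt,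
      Program.real_condInt, Program.real_setReal, Program.real_condReal, restart, leaderIndex, leaderRateExp, eval_sqrt,
      IExp.eval, RExp.eval, Test.Holds, scale, states, index, cell, one, diameter, scaleLength,
      hin.states, hin.diam, hin.loss i hi, hpr.size, hpr.power j hj, hpr.coins i (by omega),
      h12, h11, h5, hval, CodedTask.leaderRate]
  refine ⟨hreal, ?_, ?_⟩
  · simp [leaderStep, Program.exec_seq, Program.int_setInt, Program.int_condInt,
      Program.int_setReal, Program.int_condReal, IExp.eval, index, cell, h11]
  · have hbest : Function.update (s.real 4) (j * N + i) (v t i)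
        (j * N + minIndex (v t) i) = v t (minIndex (v t) i) := by
      -- For `i = 0` the best index is `0` as well, so the new entry is compared with itself.
      rcases Nat.eq_zero_or_pos i with rfl | h0
      · simp [minIndex]
      · have := minIndex_lt (v t) h0
        rw [Function.update_of_ne (by omega), hprev _ this]
    have h : (leaderStep.exec coins s).int 13 0
        = if (leaderStep.exec coins s).real 4 (j * N + i)
            ≤ (leaderStep.exec coins s).real 4 (j * N + s.int 13 0) then i else s.int 13 0 := by
      simp [leaderStep, Program.exec_seq, Program.int_setInt, Program.int_condInt,
        Program.int_setReal, Program.int_condReal, Program.real_setInt, Program.real_condInt,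
        leaderIndex, IExp.eval, RExp.eval, Test.Holds, scale, states, index, best, cell,
        hin.states, h12, h11]
    rw [h, hreal, h13, hbest, Function.update_self, minIndex]

theorem computeLeader_spec (coins : ℕ → unitInterval) {j : ℕ} (hj : j < T.size)
    (hin : Input K N T t s) (hpr : Prepared N T U s) (hsc : ScaleData K N T b U j t s)
    (h12 : s.int 12 0 = j) (h11 : s.int 11 0 = 0) (h13 : s.int 13 0 = 0) :
    Store.Frame [11, 13] [4] s (computeLeader.exec coins s) ∧
      (computeLeader.exec coins s).int 13 0 = lead K N T U j t ∧
      (∀ i < N, (computeLeader.exec coins s).real 4 (j * N + i)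
        = K.perturbed N (2 ^ j) (K.leaderRate (N * T).size j) U t i) ∧
      (∀ x, (∀ i < N, x ≠ j * N + i) → (computeLeader.exec coins s).real 4 x = s.real 4 x) ∧
      (computeLeader.exec coins s).time ≤ s.time + 3 + N * (3 + leaderStep.flatCost) := by
  set v := K.perturbed N (2 ^ j) (K.leaderRate (N * T).size j) U with hv
  have hloop := forLoop_rule (body := leaderStep.exec coins) (n := N) (s := s.tick 3)
    (fun i s' => Store.Frame [11, 13] [4] s s' ∧ s'.int 11 0 = i ∧
      s'.int 13 0 = minIndex (v t) i ∧ (∀ k < i, s'.real 4 (j * N + k) = v t k) ∧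
      (∀ x, (∀ k < i, x ≠ j * N + k) → s'.real 4 x = s.real 4 x) ∧
      s'.time ≤ s.time + 3 + i * (3 + leaderStep.flatCost))
    ⟨(frame_tick s 3).mono (by simp) (by simp), h11, h13, by simp, fun _ _ => rfl,
      by simp [Store.tick]⟩ ?_
  · obtain ⟨hf, -, hbest, hpert, hother, htime⟩ := hloop
    have hexec : computeLeader.exec coins s
        = whileUpTo Test.always (leaderStep.exec coins) N (s.tick 3) := by
      simp only [computeLeader, Program.exec, states, cell, IExp.eval, hin.states, IExp.cost]
    rw [hexec]
    exact ⟨hf, hbest, hpert, hother, htime⟩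
  · rintro i hi s' ⟨hf, hidx, hbest, hpert, hother, htime⟩
    have hft := (hf.trans (frame_tick s' 3)).mono (I' := [11, 13]) (R' := [4]) (by simp) (by simp)
    have hstep := leaderStep_spec (K := K) (N := N) (T := T) (U := U) (t := t) (s := s'.tick 3)
      coins hi hj (hin.of_frame hft (by simp) (by simp)) (hpr.of_frame hft (by simp) (by simp))
      (by rw [hft.int 12 (by simp), h12]) hidx
      (by rw [hft.int 5 (by simp), hsc.count])
      (fun r hr => by
        rw [← hsc.perturbed r hr i hi]
        exact hother _ fun k hk => by omega)
      hpert hbest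
    refine ⟨(hft.trans (frame_leaderStep coins _)).mono (by simp) (by simp), hstep.2.1,
      hstep.2.2, ?_, ?_, ?_⟩
    · intro k hk
      rw [hstep.1]
      rcases Nat.lt_succ_iff_lt_or_eq.1 hk with h | rfl
      · rw [Function.update_of_ne (by omega)]
        exact hpert k h
      · rw [Function.update_self]
    · intro x hx
      rw [hstep.1, Function.update_of_ne (hx i (Nat.lt_succ_self i))]
      exact hother x fun k hk => hx k (by omega)
    · have := Program.time_exec_le coins (c := leaderStep)
        (by simp [leaderStep, Program.Flat, Program.condReal, Program.condInt]) (s'.tick 3)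
      simp only [Store.tick] at this ⊢
      rw [Nat.add_mul, one_mul]
      omega

end Correctness

end Overlay

/-! ### Processing one time scale, and all time scales of a round. -/

theorem succ_mod_eq (t q : ℕ) (hq : 0 < q) :
    (t + 1) % q = if q ≤ t % q + 1 then 0 else t % q + 1 := by
  have hlt := Nat.mod_lt t hq
  rw [Nat.add_mod]
  split_ifs with h
  · rcases Nat.lt_or_ge 1 q with h1 | h1
    · rw [Nat.mod_eq_of_lt h1, show t % q + 1 = q by omega, Nat.mod_self]
    · rw [show q = 1 by omega, Nat.mod_one]
  · rw [Nat.mod_eq_of_lt (by omega : 1 < q), Nat.mod_eq_of_lt (by omega)]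

namespace Overlay

section Correctness

variable {K : CodedTask} {N T : ℕ} {b : ℕ → ℕ} {U : ℕ → unitInterval} {t : ℕ} {s s' : Store}

theorem coarse_succ {n : ℕ} (hn : n < T.size) :
    K.stack N T.size (N * T).size (1 / (T : ℝ) ^ 3) b U (n + 1)
      = K.mix (2 ^ (T.size - (n + 1))) (1 / (T : ℝ) ^ 3) (CodedTask.mixRate T.size
        (T.size - (n + 1))) (coarse K N T b U (T.size - (n + 1)))
        (lead K N T U (T.size - (n + 1))) (U (N + (T.size - (n + 1)))) := by
  rw [coarse, show T.size - (T.size - (n + 1) + 1) = n by omega]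
  rfl

/-- Losses and distances are stored only for codes below `N`. -/
theorem stack_lt (hN : 0 < N) (hb : ∀ t, b t < N) (L m : ℕ) (w : ℝ) (n t : ℕ) :
    K.stack N L m w b U n t < N := by
  induction n generalizing t with
  | zero => exact hb t
  | succ n ih =>
    simp only [CodedTask.stack, CodedTask.mix]
    split_ifs
    · exact K.leader_lt hN _ _
    · exact ih t

theorem previous_lt (hN : 0 < N) {p : ℕ → ℕ} (hp : ∀ t, p t < N) (t : ℕ) :
    CodedTask.previous p t < N := by
  cases t with
  | zero => exact hN
  | succ t => exact hp t

theorem frame_updateBias (coins : ℕ → unitInterval) (s : Store) :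
    Store.Frame [] [5] s (updateBias.exec coins s) where
  int a ha := by
    simp only [updateBias, Program.exec_seq, Program.int_setReal, Program.int_condReal]
  real a ha := by
    simp only [List.mem_cons, List.not_mem_nil, or_false] at ha
    simp only [updateBias, Program.exec_seq, Program.real_setReal, Program.real_condReal,
      Function.update_of_ne ha]

theorem updateBias_spec (coins : ℕ → unitInterval) (hN : 0 < N) (hb : ∀ t, b t < N) {j : ℕ}
    (hj : j < T.size) (hin : Input K N T t s) (hpr : Prepared N T U s)
    (h12 : s.int 12 0 = j) (h3 : s.int 3 0 = coarse K N T b U j t)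
    (h13 : s.int 13 0 = lead K N T U j t) (h5 : s.int 5 j = t % 2 ^ j)
    (h6 : s.int 6 j = CodedTask.previous (coarse K N T b U j) t)
    (h7 : s.int 7 j = CodedTask.previous (lead K N T U j) t)
    (hbias : ∀ r, t = r + 1 → s.real 5 j = K.bias (2 ^ j) (1 / (T : ℝ) ^ 3)
      (CodedTask.mixRate T.size j) (coarse K N T b U j) (lead K N T U j) r) :
    (updateBias.exec coins s).real 5 = Function.update (s.real 5) j
      (K.bias (2 ^ j) (1 / (T : ℝ) ^ 3) (CodedTask.mixRate T.size j) (coarse K N T b U j)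
        (lead K N T U j) t) := by
  have hx : ∀ t, coarse K N T b U j t < N := fun t => stack_lt hN hb _ _ _ _ _
  have hy : ∀ t, lead K N T U j t < N := fun t => K.leader_lt hN _ _
  have hval : K.bias (2 ^ j) (1 / (T : ℝ) ^ 3) (CodedTask.mixRate T.size j) (coarse K N T b U j)
      (lead K N T U j) t = (if t % 2 ^ j = 0 then 1 / (T : ℝ) ^ 3 else s.real 5 j)
        * Real.exp (K.advantage (CodedTask.mixRate T.size j) (coarse K N T b U j)
          (lead K N T U j) t) := accumulate_eq_of hbias
  have hx' := previous_lt hN hx t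
  have hy' := previous_lt hN hy t
  have hcube : (T : ℝ) * T * T = (T : ℝ) ^ 3 := by ring
  rw [hval]
  simp [updateBias, Program.exec_seq, Program.int_condReal, Program.real_setReal,
    Program.real_condReal, restart, advantageExp, stateCost, mixRateExp, weightExp, eval_sqrt,
    IExp.eval, RExp.eval, Test.Holds, scale, states, horizon, current, best, cell, one, diameter,
    scaleLength, hin.states, hin.horizon, hin.diam, hpr.scales, hpr.power j hj, h12, h3, h13, h5,
    h6, h7, hcube, CodedTask.advantage, hin.loss _ (hx t), hin.loss _ (hy t),
    hin.move _ (hx t) _ hx', hin.move _ (hy t) _ hy', CodedTask.mixRate]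

theorem frame_endScale (coins : ℕ → unitInterval) (s : Store) :
    Store.Frame [3, 5, 6, 7] [5] s (endScale.exec coins s) where
  int a ha := by
    simp only [List.mem_cons, List.not_mem_nil, or_false, not_or] at ha
    simp only [endScale, remember, choose, updateCount, Program.exec_seq, Program.int_setInt,
      Program.int_condInt, Function.update_of_ne ha.1, Function.update_of_ne ha.2.1,
      Function.update_of_ne ha.2.2.1, Function.update_of_ne ha.2.2.2,
      (frame_updateBias coins s).int a (by simp)]
  real a ha := by
    simp only [List.mem_cons, List.not_mem_nil, or_false] at ha
    simp only [endScale, remember, choose, updateCount, Program.exec_seq, Program.real_setInt,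
      Program.real_condInt, (frame_updateBias coins s).real a (by simpa using ha)]

theorem endScale_spec (coins : ℕ → unitInterval) (hN : 0 < N) (hb : ∀ t, b t < N) {j : ℕ}
    (hj : j < T.size) (hin : Input K N T t s) (hpr : Prepared N T U s)
    (h12 : s.int 12 0 = j) (h3 : s.int 3 0 = coarse K N T b U j t)
    (h13 : s.int 13 0 = lead K N T U j t) (h5 : s.int 5 j = t % 2 ^ j)
    (h6 : s.int 6 j = CodedTask.previous (coarse K N T b U j) t)
    (h7 : s.int 7 j = CodedTask.previous (lead K N T U j) t)
    (hbias : ∀ r, t = r + 1 → s.real 5 j = K.bias (2 ^ j) (1 / (T : ℝ) ^ 3)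
      (CodedTask.mixRate T.size j) (coarse K N T b U j) (lead K N T U j) r) :
    (endScale.exec coins s).real 5 = Function.update (s.real 5) j
        (K.bias (2 ^ j) (1 / (T : ℝ) ^ 3) (CodedTask.mixRate T.size j) (coarse K N T b U j)
          (lead K N T U j) t) ∧
      (endScale.exec coins s).int 5 = Function.update (s.int 5) j ((t + 1) % 2 ^ j) ∧
      (endScale.exec coins s).int 6 = Function.update (s.int 6) j (coarse K N T b U j t) ∧
      (endScale.exec coins s).int 7 = Function.update (s.int 7) j (lead K N T U j t) ∧
      (endScale.exec coins s).int 3 0 = K.mix (2 ^ j) (1 / (T : ℝ) ^ 3)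
        (CodedTask.mixRate T.size j) (coarse K N T b U j) (lead K N T U j) (U (N + j)) t := by
  have hspec := updateBias_spec coins hN hb hj hin hpr h12 h3 h13 h5 h6 h7 hbias
  have hf := frame_updateBias coins s
  have hin' := hin.of_frame hf (by simp) (by simp)
  have hpr' := hpr.of_frame hf (by simp) (by simp)
  set s1 := updateBias.exec coins s with hs1
  have hexec : endScale.exec coins s
      = updateCount.exec coins (choose.exec coins (remember.exec coins s1)) := rfl
  have g12 : s1.int 12 0 = j := by rw [hf.int 12 (by simp), h12]
  have g3 : s1.int 3 0 = coarse K N T b U j t := by rw [hf.int 3 (by simp), h3]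
  have g13 : s1.int 13 0 = lead K N T U j t := by rw [hf.int 13 (by simp), h13]
  have g5 : s1.int 5 j = t % 2 ^ j := by rw [hf.int 5 (by simp), h5]
  have e5 := hf.int 5 (by simp)
  have e6 := hf.int 6 (by simp)
  have e7 := hf.int 7 (by simp)
  rw [hexec]
  refine ⟨?_, ?_, ?_, ?_, ?_⟩
  · simp [updateCount, choose, remember, Program.exec_seq, Program.real_setInt,
      Program.real_condInt, hspec]
  · simp [updateCount, choose, remember, Program.exec_seq, Program.int_setInt,
      Program.int_condInt, IExp.eval, Test.Holds, scale, scaleLength, cell,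
      g12, g5, hpr'.power j hj, e5, succ_mod_eq t (2 ^ j) (Nat.two_pow_pos j)]
  · simp [updateCount, choose, remember, Program.exec_seq, Program.int_setInt,
      Program.int_condInt, IExp.eval, scale, current, cell, g12, g3, e6]
  · simp [updateCount, choose, remember, Program.exec_seq, Program.int_setInt,
      Program.int_condInt, IExp.eval, scale, best, cell, g12, g13, e7]
  · simp [updateCount, choose, remember, Program.exec_seq, Program.int_setInt,
      Program.int_condInt, Program.real_setInt, IExp.eval, RExp.eval, Test.Holds, scale,
      best, cell, states, g12, g13, g3, hin'.states, hpr'.coins (N + j) (by omega), hspec,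
      CodedTask.mix]

theorem frame_beginScale (coins : ℕ → unitInterval) (s : Store) :
    Store.Frame [11, 12, 13] [] s (beginScale.exec coins s) where
  int a ha := by
    simp only [List.mem_cons, List.not_mem_nil, or_false, not_or] at ha
    simp only [beginScale, Program.exec_seq, Program.int_setInt, Function.update_of_ne ha.1,
      Function.update_of_ne ha.2.1, Function.update_of_ne ha.2.2]
  real a _ := by simp only [beginScale, Program.exec_seq, Program.real_setInt]

/-- The data of all time scales after the `n` coarsest ones have been treated in round `t`. -/
def Progress (K : CodedTask) (N T : ℕ) (b : ℕ → ℕ) (U : ℕ → unitInterval) (t n : ℕ)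
    (s : Store) : Prop :=
  ∀ j < T.size, ScaleData K N T b U j (if T.size - n ≤ j then t + 1 else t) s

theorem scaleStep_spec (coins : ℕ → unitInterval) (hN : 0 < N) (hb : ∀ t, b t < N) {n : ℕ}
    (hn : n < T.size) (hin : Input K N T t s) (hpr : Prepared N T U s)
    (hsc : Progress K N T b U t n s) (h12 : s.int 12 0 = T.size - n)
    (h3 : s.int 3 0 = K.stack N T.size (N * T).size (1 / (T : ℝ) ^ 3) b U n t) :
    Store.Frame [3, 5, 6, 7, 11, 12, 13] [4, 5] s (scaleStep.exec coins s) ∧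
      Progress K N T b U t (n + 1) (scaleStep.exec coins s) ∧
      (scaleStep.exec coins s).int 12 0 = T.size - (n + 1) ∧
      (scaleStep.exec coins s).int 3 0
        = K.stack N T.size (N * T).size (1 / (T : ℝ) ^ 3) b U (n + 1) t ∧
      (scaleStep.exec coins s).time ≤ s.time + (beginScale.flatCost + endScale.flatCost + 3
        + N * (3 + leaderStep.flatCost)) := by
  set j := T.size - (n + 1) with hjdef
  have hj : j < T.size := by omega
  have hscj : ScaleData K N T b U j t s := by
    have := hsc j hj
    rwa [if_neg (by omega)] at this
  have hf1 := frame_beginScale coins s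
  have htime1 := Program.time_exec_le coins (c := beginScale) (by simp [beginScale, Program.Flat]) s
  set s1 := beginScale.exec coins s with hs1
  have a12 : s1.int 12 0 = j := by
    simp [hs1, beginScale, Program.exec_seq, Program.int_setInt, IExp.eval, scale, cell, h12]
    omega
  have a11 : s1.int 11 0 = 0 := by
    simp [hs1, beginScale, Program.exec_seq, Program.int_setInt, IExp.eval]
  have a13 : s1.int 13 0 = 0 := by
    simp [hs1, beginScale, Program.exec_seq, Program.int_setInt, IExp.eval]
  have hin1 := hin.of_frame hf1 (by simp) (by simp)
  have hpr1 := hpr.of_frame hf1 (by simp) (by simp)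
  have hsc1 : ScaleData K N T b U j t s1 := hscj.of_eq (by rw [hf1.int 5 (by simp)])
    (by rw [hf1.int 6 (by simp)]) (by rw [hf1.int 7 (by simp)]) (by rw [hf1.real 5 (by simp)])
    (fun i _ => by rw [hf1.real 4 (by simp)])
  obtain ⟨hf2, c13, cpert, cother, htime2⟩ :=
    computeLeader_spec coins hj hin1 hpr1 hsc1 a12 a11 a13
  set s2 := computeLeader.exec coins s1 with hs2
  have hin2 := hin1.of_frame hf2 (by simp) (by simp)
  have hpr2 := hpr1.of_frame hf2 (by simp) (by simp)
  have c12 : s2.int 12 0 = j := by rw [hf2.int 12 (by simp), a12]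
  have c3 : s2.int 3 0 = coarse K N T b U j t := by
    rw [hf2.int 3 (by simp), hf1.int 3 (by simp), h3, coarse,
      show T.size - (j + 1) = n by omega]
  have i5 : s2.int 5 = s.int 5 := by rw [hf2.int 5 (by simp), hf1.int 5 (by simp)]
  have i6 : s2.int 6 = s.int 6 := by rw [hf2.int 6 (by simp), hf1.int 6 (by simp)]
  have i7 : s2.int 7 = s.int 7 := by rw [hf2.int 7 (by simp), hf1.int 7 (by simp)]
  have r5 : s2.real 5 = s.real 5 := by rw [hf2.real 5 (by simp), hf1.real 5 (by simp)]
  obtain ⟨d5, dc, d6, d7, d3⟩ := endScale_spec coins hN hb hj hin2 hpr2 c12 c3 c13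
    (by rw [i5, hscj.count]) (by rw [i6, hscj.coarse]) (by rw [i7, hscj.lead])
    (fun r hr => by rw [r5, hscj.bias r hr])
  have hf3 := frame_endScale coins s2
  have htime3 := Program.time_exec_le coins (c := endScale) (by
    simp [endScale, updateBias, remember, choose, updateCount, Program.Flat, Program.condReal,
      Program.condInt]) s2
  have hexec : scaleStep.exec coins s = endScale.exec coins s2 := rfl
  rw [hexec]
  refine ⟨((hf1.trans hf2).trans hf3).mono (by simp) (by simp), ?_, ?_, ?_, by omega⟩
  · intro i hi
    have r4 : (endScale.exec coins s2).real 4 = s2.real 4 := hf3.real 4 (by simp)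
    rcases eq_or_ne i j with rfl | hij
    · rw [if_pos hjdef.ge]
      refine ⟨?_, ?_, ?_, ?_, ?_⟩
      · rw [dc, Function.update_self]
      · rw [d6, Function.update_self]
        rfl
      · rw [d7, Function.update_self]
        rfl
      · intro r hr
        obtain rfl : t = r := by omega
        rw [d5, Function.update_self]
      · intro r hr x hx
        obtain rfl : t = r := by omega
        rw [r4, cpert x hx]
    · have hcond : (if T.size - (n + 1) ≤ i then t + 1 else t)
          = (if T.size - n ≤ i then t + 1 else t) :=
        if_congr (by omega) rfl rfl
      rw [hcond]
      refine (hsc i hi).of_eq ?_ ?_ ?_ ?_ ?_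
      · rw [dc, Function.update_of_ne hij, i5]
      · rw [d6, Function.update_of_ne hij, i6]
      · rw [d7, Function.update_of_ne hij, i7]
      · rw [d5, Function.update_of_ne hij, r5]
      · intro x hx
        rw [r4, cother _ fun y hy => ?_, hf1.real 4 (by simp)]
        -- Rows of different scales are disjoint, since the quotient of a position by `N` is the
        -- scale.
        intro h
        apply hij
        have h1 : (i * N + x) / N = i := by
          rw [mul_comm, Nat.mul_add_div hN, Nat.div_eq_of_lt hx, add_zero]
        have h2 : (j * N + y) / N = j := by
          rw [mul_comm, Nat.mul_add_div hN, Nat.div_eq_of_lt hy, add_zero]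
        rw [← h1, h, h2]
  · rw [hf3.int 12 (by simp), c12]
  · rw [d3, coarse_succ hn]

theorem scales_spec (coins : ℕ → unitInterval) (hN : 0 < N) (hb : ∀ t, b t < N)
    (hin : Input K N T t s) (hpr : Prepared N T U s)
    (hsc : ∀ j < T.size, ScaleData K N T b U j t s) (h12 : s.int 12 0 = T.size)
    (h3 : s.int 3 0 = b t) :
    Store.Frame [3, 5, 6, 7, 11, 12, 13] [4, 5] s
        ((Program.loop (cell 8) .always scaleStep).exec coins s) ∧
      (∀ j < T.size, ScaleData K N T b U j (t + 1)
        ((Program.loop (cell 8) .always scaleStep).exec coins s)) ∧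
      ((Program.loop (cell 8) .always scaleStep).exec coins s).int 3 0
        = K.output N (N * T).size T b U t ∧
      ((Program.loop (cell 8) .always scaleStep).exec coins s).time
        ≤ s.time + 3 + T.size * (beginScale.flatCost + endScale.flatCost + 6
        + N * (3 + leaderStep.flatCost)) := by
  have hexec : (Program.loop (cell 8) .always scaleStep).exec coins s
      = whileUpTo Test.always (scaleStep.exec coins) T.size (s.tick 3) := by
    simp only [Program.exec, cell, IExp.eval, hpr.scales, IExp.cost]
  have hloop := forLoop_rule (body := scaleStep.exec coins) (n := T.size) (s := s.tick 3)
    (fun n s' => Store.Frame [3, 5, 6, 7, 11, 12, 13] [4, 5] s s' ∧ Progress K N T b U t n s' ∧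
      s'.int 12 0 = T.size - n ∧
      s'.int 3 0 = K.stack N T.size (N * T).size (1 / (T : ℝ) ^ 3) b U n t ∧
      s'.time ≤ s.time + 3 + n * (beginScale.flatCost + endScale.flatCost + 6
        + N * (3 + leaderStep.flatCost)))
    ⟨(frame_tick s 3).mono (by simp) (by simp), fun j hj => ?_, h12, h3, by simp [Store.tick]⟩ ?_
  · obtain ⟨hf, hp, -, hout, htime⟩ := hloop
    rw [hexec]
    refine ⟨hf, fun j hj => ?_, hout, htime⟩
    have := hp j hj
    rwa [if_pos (by omega)] at this
  · rw [if_neg (by omega)]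
    exact (hsc j hj).of_eq rfl rfl rfl rfl fun _ _ => rfl
  · rintro n hn s' ⟨hf, hp, hidx, hout, htime⟩
    have hft := (hf.trans (frame_tick s' 3)).mono (I' := [3, 5, 6, 7, 11, 12, 13]) (R' := [4, 5])
      (by simp) (by simp)
    obtain ⟨hf', hp', hidx', hout', htime'⟩ := scaleStep_spec coins hN hb hn
      (hin.of_frame hft (by simp) (by simp)) (hpr.of_frame hft (by simp) (by simp))
      (s := s'.tick 3) (fun j hj => (hp j hj).of_eq rfl rfl rfl rfl fun _ _ => rfl) hidx hout
    refine ⟨(hft.trans hf').mono (by simp) (by simp), hp', hidx', hout', ?_⟩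
    simp only [Store.tick] at htime'
    rw [Nat.add_mul, one_mul]
    simp only [Store.tick]
    omega

end Correctness

end Overlay

/-! ### A full round: binary lengths, coins, and the invariant between rounds. -/

namespace Overlay

section Correctness

variable {K : CodedTask} {N T : ℕ} {b : ℕ → ℕ} {U : ℕ → unitInterval} {t : ℕ} {s s' : Store}

/-- After `k` iterations entry `0` of the integer array `14` is `2 ^ k`, so the test first fails at
`k = v.size`. The loop bound `v` allows this many iterations. The value of `x` stays fixed because
the arrays `0` and `1` are not touched. -/
theorem computeSize_spec (coins : ℕ → unitInterval) {x : IExp} {a v : ℕ} (ha : a = 8 ∨ a = 9)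
    (hx : ∀ s' : Store, s'.int 0 = s.int 0 → s'.int 1 = s.int 1 → x.eval s' = v) :
    Store.Frame [a, 4, 14] [] s ((computeSize x a).exec coins s) ∧
      ((computeSize x a).exec coins s).int a 0 = v.size ∧
      (∀ j < v.size, ((computeSize x a).exec coins s).int 4 j = 2 ^ j) ∧
      ((computeSize x a).exec coins s).drawn = s.drawn ∧
      ((computeSize x a).exec coins s).time
        ≤ s.time + 10 + 2 * x.cost + v.size * (x.cost + (sizeStep a).flatCost + 3) := by
  have h0 : (0 : ℕ) ≠ a := by omega
  have h1 : (1 : ℕ) ≠ a := by omega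
  have h4 : a ≠ 4 := by omega
  have h14 : a ≠ 14 := by omega
  set s1 := (Program.setInt 14 (.lit 0) (.lit 1)).exec coins
    ((Program.setInt a (.lit 0) (.lit 0)).exec coins s) with hs1
  have hI : s1.int
      = Function.update (Function.update s.int a (Function.update (s.int a) 0 0)) 14
        (Function.update (s.int 14) 0 1) := by
    simp [hs1, Program.int_setInt, IExp.eval, Function.update_of_ne h14.symm]
  have hR : s1.real = s.real := rfl
  have hD : s1.drawn = s.drawn := rfl
  have hT : s1.time = s.time + 3 + 3 := rfl
  have hf1 : Store.Frame [a, 4, 14] [] s s1 := by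
    refine ⟨fun c hc => ?_, fun _ _ => by rw [hR]⟩
    simp only [List.mem_cons, List.not_mem_nil, or_false, not_or] at hc
    rw [hI, Function.update_of_ne hc.2.2, Function.update_of_ne hc.1]
  have hexec : (computeSize x a).exec coins s = whileUpTo (.intLE (cell 14) x)
      ((sizeStep a).exec coins) v (s1.tick (x.cost + 1)) := by
    have : x.eval s1 = v := hx s1 (hf1.int 0 (by simp [h0])) (hf1.int 1 (by simp [h1]))
    simp only [computeSize, Program.exec_seq, ← hs1]
    rw [Program.exec, this]
  have hcost : (Test.intLE (cell 14) x).cost = x.cost + 3 := by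
    simp only [Test.cost, cell, IExp.cost]
    omega
  rw [hexec]
  refine whileUpTo_rule (k := v.size)
    (I := fun k s' => Store.Frame [a, 4, 14] [] s s' ∧ s'.int 14 0 = 2 ^ k ∧ s'.int a 0 = k ∧
      (∀ j < k, s'.int 4 j = 2 ^ j) ∧ s'.drawn = s.drawn ∧
      s'.time ≤ s.time + 7 + x.cost + k * (x.cost + (sizeStep a).flatCost + 3))
    (Q := fun s' => Store.Frame [a, 4, 14] [] s s' ∧ s'.int a 0 = v.size ∧
      (∀ j < v.size, s'.int 4 j = 2 ^ j) ∧ s'.drawn = s.drawn ∧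
      s'.time ≤ s.time + 10 + 2 * x.cost + v.size * (x.cost + (sizeStep a).flatCost + 3))
    (CodedTask.size_le_self v) ⟨(hf1.trans (frame_tick _ _)).mono (by simp) (by simp), ?_, ?_,
      by simp, hD, ?_⟩ ?_ ?_ ?_
  · change s1.int 14 0 = 1
    simp [hI]
  · change s1.int a 0 = 0
    simp [hI, Function.update_of_ne h14]
  · simp only [Store.tick, hT]
    omega
  · rintro k hk s' ⟨hf, hpow, hidx, hpows, hdrawn, htime⟩
    refine ⟨?_, ?_⟩
    · have hxe : x.eval s' = v := hx s' (hf.int 0 (by simp [h0])) (hf.int 1 (by simp [h1]))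
      simp only [Test.Holds, cell, IExp.eval, hpow, hxe]
      exact Nat.lt_size.1 hk
    · set s2 := s'.tick (Test.intLE (cell 14) x).cost with hs2
      have e14 : s2.int 14 0 = 2 ^ k := hpow
      have ea : s2.int a 0 = k := hidx
      have e4 : s2.int 4 = s'.int 4 := rfl
      refine ⟨⟨fun c hc => ?_, fun c hc => ?_⟩, ?_, ?_, ?_, hdrawn, ?_⟩
      · have hc' := hc
        simp only [List.mem_cons, List.not_mem_nil, or_false, not_or] at hc
        simp only [sizeStep, Program.exec_seq, Program.int_setInt, Function.update_of_ne hc.1,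
          Function.update_of_ne hc.2.1, Function.update_of_ne hc.2.2]
        exact hf.int c hc'
      · simp only [sizeStep, Program.exec_seq, Program.real_setInt]
        exact hf.real c hc
      · simp [sizeStep, Program.exec_seq, Program.int_setInt, IExp.eval, cell, e14,
          Function.update_of_ne h14.symm, pow_succ]
      · simp [sizeStep, Program.exec_seq, Program.int_setInt, IExp.eval, cell, ea,
          Function.update_of_ne h14, Function.update_of_ne h4]
      · intro j hj
        have : ((sizeStep a).exec coins s2).int 4 = Function.update (s2.int 4) k (2 ^ k) := by
          simp [sizeStep, Program.exec_seq, Program.int_setInt, IExp.eval, cell, ea, e14,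
            Function.update_of_ne h4.symm]
        rw [this]
        rcases Nat.lt_succ_iff_lt_or_eq.1 hj with h | rfl
        · rw [Function.update_of_ne h.ne, e4]
          exact hpows j h
        · rw [Function.update_self]
      · have := Program.time_exec_le coins (c := sizeStep a) (by simp [sizeStep, Program.Flat]) s2
        have e : s2.time = s'.time + (x.cost + 3) := by rw [hs2, hcost]; rfl
        rw [Nat.add_mul, one_mul]
        omega
  · rintro s' ⟨hf, hpow, -⟩ -
    have hxe : x.eval s' = v := hx s' (hf.int 0 (by simp [h0])) (hf.int 1 (by simp [h1]))
    simp only [Test.Holds, cell, IExp.eval, hpow, hxe, not_le]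
    exact Nat.lt_size_self v
  · rintro s' ⟨hf, -, hidx, hpows, hdrawn, htime⟩
    refine ⟨⟨hf, hidx, hpows, hdrawn, by omega⟩,
      ⟨(hf.trans (frame_tick _ _)).mono (by simp) (by simp), hidx, hpows, hdrawn, ?_⟩⟩
    rw [hcost]
    simp only [Store.tick]
    omega

/-- As nothing was drawn before, the array position of a coin is its index in the coin sequence,
which is the indexing used by `stack`. -/
theorem drawCoins_spec (h0 : s.int 0 0 = N) (h8 : s.int 8 0 = T.size) (hd : s.drawn = 0) :
    Store.Frame [10, 11] [3] s (drawCoins.exec U s) ∧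
      (drawCoins.exec U s).int 10 0 = 1 ∧
      (∀ i < N + T.size, (drawCoins.exec U s).real 3 i = U i) ∧
      (drawCoins.exec U s).time ≤ s.time + 12 + (N + T.size) * (drawStep.flatCost + 3) := by
  set s1 := (Program.setInt 11 (.lit 0) (.lit 0)).exec U s with hs1
  have hI : s1.int = Function.update s.int 11 (Function.update (s.int 11) 0 0) := rfl
  have hT : s1.time = s.time + 3 := rfl
  have hloop := forLoop_rule (body := drawStep.exec U) (n := N + T.size) (s := s1.tick 6)
    (fun i s' => Store.Frame [11] [3] s s' ∧ s'.int 11 0 = i ∧ s'.drawn = i ∧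
      (∀ k < i, s'.real 3 k = U k) ∧
      s'.time ≤ s.time + 9 + i * (drawStep.flatCost + 3))
    ⟨⟨fun c hc => ?_, fun _ _ => rfl⟩, ?_, hd, by simp, ?_⟩ ?_
  · have hexec : drawCoins.exec U s = (Program.setInt 10 (.lit 0) (.lit 1)).exec U
        (whileUpTo Test.always (drawStep.exec U) (N + T.size) (s1.tick 6)) := by
      have e : (IExp.add states (cell 8)).eval s1 = N + T.size := by
        simp [IExp.eval, states, cell, hI, h0, h8]
      have hl : (Program.loop (.add states (cell 8)) .always drawStep).exec U s1
          = whileUpTo Test.always (drawStep.exec U) (N + T.size) (s1.tick 6) := by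
        rw [Program.exec, e]
        rfl
      simp only [drawCoins, Program.exec_seq, ← hs1, hl]
    rw [hexec]
    obtain ⟨hf, -, -, hcoins, htime⟩ := hloop
    set s2 := whileUpTo Test.always (drawStep.exec U) (N + T.size) (s1.tick 6)
    refine ⟨⟨fun c hc => ?_, fun c hc => ?_⟩, ?_, hcoins, ?_⟩
    · simp only [List.mem_cons, List.not_mem_nil, or_false, not_or] at hc
      rw [Program.int_setInt, Function.update_of_ne hc.1]
      exact hf.int c (by simpa using hc.2)
    · exact hf.real c hc
    · simp [Program.int_setInt, IExp.eval]
    · have : ((Program.setInt 10 (.lit 0) (.lit 1)).exec U s2).time = s2.time + 3 := rfl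
      omega
  · simp only [List.mem_cons, List.not_mem_nil, or_false] at hc
    change s1.int c = s.int c
    rw [hI, Function.update_of_ne hc]
  · change s1.int 11 0 = 0
    simp [hI]
  · simp only [Store.tick, hT]
    omega
  · rintro i hi s' ⟨hf, hidx, hdrawn, hcoins, htime⟩
    have eI : (drawStep.exec U (s'.tick 3)).int
        = Function.update s'.int 11 (Function.update (s'.int 11) 0 (i + 1)) := by
      rw [← hidx]
      rfl
    have eR : (drawStep.exec U (s'.tick 3)).real
        = Function.update s'.real 3 (Function.update (s'.real 3) i (U i)) := by
      conv_rhs => rw [← hdrawn]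
      conv_rhs => rw [hdrawn, ← hidx]
      have : (drawStep.exec U (s'.tick 3)).real = Function.update s'.real 3
        (Function.update (s'.real 3) (s'.int 11 0) (U s'.drawn)) := rfl
      rw [this, hdrawn, hidx]
    refine ⟨⟨fun c hc => ?_, fun c hc => ?_⟩, ?_, ?_, ?_, ?_⟩
    · have hc' := hc
      simp only [List.mem_cons, List.not_mem_nil, or_false] at hc
      rw [eI, Function.update_of_ne hc]
      exact hf.int c hc'
    · have hc' := hc
      simp only [List.mem_cons, List.not_mem_nil, or_false] at hc
      rw [eR, Function.update_of_ne hc]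
      exact hf.real c hc'
    · simp [eI]
    · rw [← hdrawn]
      rfl
    · intro k hk
      rw [eR, Function.update_self]
      rcases Nat.lt_succ_iff_lt_or_eq.1 hk with h | rfl
      · rw [Function.update_of_ne h.ne]
        exact hcoins k h
      · rw [Function.update_self]
    · have := Program.time_exec_le U (c := drawStep) (by simp [drawStep, Program.Flat]) (s'.tick 3)
      simp only [Store.tick] at this
      rw [Nat.add_mul, one_mul]
      simp only [Store.tick]
      omega

/-- The data that are kept between the rounds, before round `t`. -/
structure Ready (K : CodedTask) (N T : ℕ) (b : ℕ → ℕ) (U : ℕ → unitInterval) (t : ℕ)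
    (s : Store) : Prop where
  first : t = 0 → s.int 10 0 = 0 ∧ s.drawn = 0
  later : t ≠ 0 → s.int 10 0 = 1 ∧ ∀ i < N + T.size, s.real 3 i = U i
  scales : ∀ j < T.size, ScaleData K N T b U j t s

/-- The time of a round, up to the factor `N * T.size`. -/
def roundCost : ℕ :=
  200 + 2 * (sizeStep 9).flatCost + (sizeStep 8).flatCost + 2 * drawStep.flatCost
    + beginScale.flatCost + endScale.flatCost + leaderStep.flatCost

theorem program_spec (hN : 0 < N) (hT : 0 < T) (hb : ∀ t, b t < N) (hin : Input K N T t s)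
    (hr : Ready K N T b U t s) (h2 : s.int 2 0 = b t) :
    Ready K N T b U (t + 1) (program.exec U s) ∧ Input K N T t (program.exec U s) ∧
      (program.exec U s).int 3 0 = K.output N (N * T).size T b U t ∧
      (program.exec U s).time ≤ s.time + roundCost * (N * T.size) := by
  obtain ⟨hf1, hm, -, hd1, ht1⟩ := computeSize_spec U (s := s) (x := .mul states horizon)
    (v := N * T) (Or.inr rfl) (fun s' h0 h1 => by
      simp only [IExp.eval, states, horizon, cell, h0, h1, hin.states, hin.horizon])
  set s1 := (computeSize (.mul states horizon) 9).exec U s with hs1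
  have hin1 := hin.of_frame hf1 (by simp) (by simp)
  obtain ⟨hf2, hL, hpow, hd2, ht2⟩ := computeSize_spec U (s := s1) (x := horizon)
    (v := T) (Or.inl rfl) (fun s' h0 h1 => by
      simp only [IExp.eval, horizon, cell, h1, hin1.horizon])
  set s2 := (computeSize horizon 8).exec U s1 with hs2
  have hin2 := hin1.of_frame hf2 (by simp) (by simp)
  have h9 : s2.int 9 0 = (N * T).size := by rw [hf2.int 9 (by simp), hm]
  have h10 : s2.int 10 0 = s.int 10 0 := by rw [hf2.int 10 (by simp), hf1.int 10 (by simp)]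
  have hsc2 : ∀ j < T.size, ScaleData K N T b U j t s2 := fun j hj =>
    (hr.scales j hj).of_eq (by rw [hf2.int 5 (by simp), hf1.int 5 (by simp)])
      (by rw [hf2.int 6 (by simp), hf1.int 6 (by simp)])
      (by rw [hf2.int 7 (by simp), hf1.int 7 (by simp)])
      (by rw [hf2.real 5 (by simp), hf1.real 5 (by simp)])
      (fun i _ => by rw [hf2.real 4 (by simp), hf1.real 4 (by simp)])
  have hdraw : ∃ s3, (Program.ite (.intLE (cell 10) (.lit 0)) drawCoins .skip).exec U s2 = s3 ∧
      Store.Frame [10, 11] [3] s2 s3 ∧ s3.int 10 0 = 1 ∧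
      (∀ i < N + T.size, s3.real 3 i = U i) ∧
      s3.time ≤ s2.time + 16 + (N + T.size) * (drawStep.flatCost + 3) := by
    have hcost : (Test.intLE (cell 10) (.lit 0)).cost = 4 := rfl
    refine ⟨_, rfl, ?_⟩
    -- The flag in the integer array `10` makes the coins be drawn only in round `0`; later rounds
    -- reuse them.
    rcases eq_or_ne t 0 with h0 | h0
    · obtain ⟨g1, g2⟩ := hr.first h0
      have hh : (Test.intLE (cell 10) (.lit 0)).Holds s2 := by
        simp [Test.Holds, IExp.eval, cell, h10, g1]
      obtain ⟨k1, k2, k3, k4⟩ := drawCoins_spec (N := N) (T := T) (U := U)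
        (s := s2.tick 4) hin2.states hL (by rw [← g2, ← hd1, ← hd2]; rfl)
      rw [Program.exec, if_pos hh, hcost]
      refine ⟨((frame_tick s2 4).trans k1).mono (by simp) (by simp), k2, k3, ?_⟩
      simp only [Store.tick] at k4
      simp only [Store.tick]
      omega
    · obtain ⟨g1, g2⟩ := hr.later h0
      have hh : ¬ (Test.intLE (cell 10) (.lit 0)).Holds s2 := by
        simp [Test.Holds, IExp.eval, cell, h10, g1]
      rw [Program.exec, if_neg hh, hcost]
      refine ⟨⟨fun _ _ => rfl, fun _ _ => rfl⟩, ?_, fun i hi => ?_, ?_⟩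
      · change s2.int 10 0 = 1
        rw [h10, g1]
      · change s2.real 3 i = U i
        rw [hf2.real 3 (by simp), hf1.real 3 (by simp), g2 i hi]
      · simp only [Program.exec, Store.tick]
        omega
  obtain ⟨s3, hs3, hf3, hflag, hcoins, ht3⟩ := hdraw
  have hin3 := hin2.of_frame hf3 (by simp) (by simp)
  set s4 := beginRound.exec U s3 with hs4
  have hf4 : Store.Frame [3, 12] [] s3 s4 := by
    refine ⟨fun c hc => ?_, fun c _ => rfl⟩
    simp only [List.mem_cons, List.not_mem_nil, or_false, not_or] at hc
    simp only [hs4, beginRound, Program.exec_seq, Program.int_setInt, Function.update_of_ne hc.1,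
      Function.update_of_ne hc.2]
  have ht4 : s4.time = s3.time + 4 + 4 := rfl
  have h3 : s4.int 3 0 = b t := by
    simp [hs4, beginRound, Program.exec_seq, Program.int_setInt, IExp.eval, cell,
      hf3.int 2 (by simp), hf2.int 2 (by simp), hf1.int 2 (by simp), h2]
  have h12 : s4.int 12 0 = T.size := by
    simp [hs4, beginRound, Program.exec_seq, Program.int_setInt, IExp.eval, cell,
      hf3.int 8 (by simp), hL]
  have hin4 := hin3.of_frame hf4 (by simp) (by simp)
  have hpr4 : Prepared N T U s4 := by
    refine ⟨?_, ?_, fun j hj => ?_, fun i hi => ?_⟩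
    · rw [hf4.int 8 (by simp), hf3.int 8 (by simp), hL]
    · rw [hf4.int 9 (by simp), hf3.int 9 (by simp), h9]
    · rw [hf4.int 4 (by simp), hf3.int 4 (by simp), hpow j hj]
    · rw [hf4.real 3 (by simp), hcoins i hi]
  have hsc4 : ∀ j < T.size, ScaleData K N T b U j t s4 := fun j hj =>
    (hsc2 j hj).of_eq (by rw [hf4.int 5 (by simp), hf3.int 5 (by simp)])
      (by rw [hf4.int 6 (by simp), hf3.int 6 (by simp)])
      (by rw [hf4.int 7 (by simp), hf3.int 7 (by simp)])
      (by rw [hf4.real 5 (by simp), hf3.real 5 (by simp)])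
      (fun i _ => by rw [hf4.real 4 (by simp), hf3.real 4 (by simp)])
  obtain ⟨hf5, hsc5, hout, ht5⟩ := scales_spec U hN hb hin4 hpr4 hsc4 h12 h3
  have hexec : program.exec U s = (Program.loop (cell 8) .always scaleStep).exec U s4 := by
    rw [hs4, ← hs3]
    rfl
  rw [hexec]
  set s5 := (Program.loop (cell 8) .always scaleStep).exec U s4
  refine ⟨⟨by omega, fun _ => ⟨?_, fun i hi => ?_⟩, hsc5⟩, hin4.of_frame hf5 (by simp) (by simp),
    hout, ?_⟩
  · rw [hf5.int 10 (by simp), hf4.int 10 (by simp), hflag]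
  · rw [hf5.real 3 (by simp), hpr4.coins i hi]
  · have hc1 : (IExp.mul states horizon).cost = 5 := rfl
    have hc2 : horizon.cost = 2 := rfl
    rw [hc1] at ht1
    rw [hc2] at ht2
    have hLpos : 0 < T.size := Nat.size_pos.2 hT
    -- The time for the binary length of `N * T` fits into the budget because `N + T.size ≤ 2 * (N *
    -- T.size)`.
    have hm' : (N * T).size ≤ N + T.size := by
      rw [Nat.size_le, pow_add]
      exact Nat.mul_lt_mul'' Nat.lt_two_pow_self (Nat.lt_size_self T)
    have hp1 : 1 ≤ N * T.size := Nat.mul_pos hN hLpos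
    have hp2 : N ≤ N * T.size := Nat.le_mul_of_pos_right N hLpos
    have hp3 : T.size ≤ N * T.size := Nat.le_mul_of_pos_left T.size hN
    have q1 : (N * T).size * (5 + (sizeStep 9).flatCost + 3)
        ≤ (2 * (N * T.size)) * (5 + (sizeStep 9).flatCost + 3) :=
      Nat.mul_le_mul_right _ (by omega)
    have q2 : T.size * (2 + (sizeStep 8).flatCost + 3)
        ≤ (N * T.size) * (2 + (sizeStep 8).flatCost + 3) := Nat.mul_le_mul_right _ hp3
    have q3 : (N + T.size) * (drawStep.flatCost + 3)
        ≤ (2 * (N * T.size)) * (drawStep.flatCost + 3) := Nat.mul_le_mul_right _ (by omega)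
    have q4 : T.size * (beginScale.flatCost + endScale.flatCost + 6)
        ≤ (N * T.size) * (beginScale.flatCost + endScale.flatCost + 6) :=
      Nat.mul_le_mul_right _ hp3
    have q5 : T.size * (N * (3 + leaderStep.flatCost))
        = (N * T.size) * (3 + leaderStep.flatCost) := by ring
    rw [Nat.mul_add T.size] at ht5
    unfold roundCost
    generalize (sizeStep 9).flatCost = c1 at *
    generalize (sizeStep 8).flatCost = c2 at *
    generalize drawStep.flatCost = c3 at *
    generalize beginScale.flatCost = c4 at *
    generalize endScale.flatCost = c5 at *
    generalize leaderStep.flatCost = c6 at *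
    generalize N * T.size = p at *
    linarith

end Correctness

/-! ### The run of the program -/

section Run

theorem decode_code {X : Type u} [Fintype X] [Nonempty X] (e : X ≃ Fin (Fintype.card X)) (x : X) :
    decode e (e x : ℕ) = x := by
  simp [decode]

variable {X : Type u} [Fintype X] [Nonempty X] [PseudoMetricSpace X] {M : MTS X}

/-- The task with the states coded by their numbers. -/
noncomputable def task (e : X ≃ Fin (Fintype.card X)) (l : ℕ → M.losses) : CodedTask where
  diam := Metric.diam (Set.univ : Set X)
  loss t i := (l t : X → ℝ) (decode e i)
  move i j := dist (decode e i) (decode e j)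
  loss_nonneg t _ := (M.bounded _ (l t).2 _).1
  loss_le_one t _ := (M.bounded _ (l t).2 _).2
  move_nonneg _ _ := dist_nonneg
  move_le _ _ := Metric.dist_le_diam_of_mem Set.finite_univ.isBounded (Set.mem_univ _)
    (Set.mem_univ _)
  move_self _ := dist_self _

variable (e : X ≃ Fin (Fintype.card X)) (l : ℕ → M.losses)

theorem cost_task (p : ℕ → ℕ) (a k : ℕ) :
    (task e l).cost p a k = pathCost l (fun t => decode e (p t)) a k := rfl

theorem cost_task_code (p : ℕ → X) (a k : ℕ) :
    (task e l).cost (fun t => (e (p t) : ℕ)) a k = pathCost l p a k := by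
  simp only [cost_task, decode_code]

/-- The invariant survives from round to round because `feed` changes only the integer array `2`,
the real array `2` and the clock. -/
theorem round_spec (T : ℕ) (hT : 0 < T) (x : ℕ → X) (U : ℕ → unitInterval) (t : ℕ) :
    let s := feed e (l t : X → ℝ) (x t) (runRounds program e T (fun t => (l t : X → ℝ)) x U t)
    Input (task e l) (Fintype.card X) T t s ∧
      Ready (task e l) (Fintype.card X) T (fun t => (e (x t) : ℕ)) U t s ∧
      s.int 2 0 = (e (x t) : ℕ) := by
  induction t with
  | zero =>
    refine ⟨⟨rfl, rfl, rfl, fun i hi j hj => ?_, fun i hi => ?_⟩, ⟨fun _ => ⟨rfl, rfl⟩,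
      fun h => absurd rfl h, fun j _ => ⟨?_, rfl, rfl, ?_, ?_⟩⟩, ?_⟩
    · have hlt : i * Fintype.card X + j < Fintype.card X * Fintype.card X := by nlinarith
      have h1 : (i * Fintype.card X + j) / Fintype.card X = i := by
        rw [mul_comm, Nat.mul_add_div (by omega), Nat.div_eq_of_lt hj, add_zero]
      have h2 : (i * Fintype.card X + j) % Fintype.card X = j := by
        rw [mul_comm, Nat.mul_add_mod, Nat.mod_eq_of_lt hj]
      simp [feed, runRounds, startStore, hlt, h1, h2, task]
    · simp [feed, hi, task]
    · simp [feed, runRounds, startStore]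
    · intro r hr
      omega
    · intro r hr
      omega
    · simp [feed]
  | succ t ih =>
    obtain ⟨hin, hr, h2⟩ := ih
    obtain ⟨hr', hin', -, -⟩ := program_spec Fintype.card_pos hT (fun t => (e (x t)).2) hin hr h2
    simp only [runRounds]
    set s := program.exec U (feed e (l t : X → ℝ) (x t)
      (runRounds program e T (fun t => (l t : X → ℝ)) x U t)) with hs
    have hint : ∀ a, a ≠ 2 → (feed e (l (t + 1) : X → ℝ) (x (t + 1)) s).int a = s.int a := by
      intro a ha
      simp [feed, Function.update_of_ne ha]
    have hreal : ∀ a, a ≠ 2 → (feed e (l (t + 1) : X → ℝ) (x (t + 1)) s).real a = s.real a := by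
      intro a ha
      simp [feed, Function.update_of_ne ha]
    refine ⟨⟨?_, ?_, ?_, ?_, fun i hi => ?_⟩, ⟨by omega, ?_, fun j hj => ?_⟩, ?_⟩
    · rw [hint 0 (by omega), hin'.states]
    · rw [hint 1 (by omega), hin'.horizon]
    · rw [hreal 0 (by omega), hin'.diam]
    · rw [hreal 1 (by omega)]
      exact hin'.move
    · simp [feed, hi, task]
    · intro h
      rw [hint 10 (by omega), hreal 3 (by omega)]
      exact hr'.later h
    · exact (hr'.scales j hj).of_eq (by rw [hint 5 (by omega)]) (by rw [hint 6 (by omega)])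
        (by rw [hint 7 (by omega)]) (by rw [hreal 5 (by omega)])
        (fun i _ => by rw [hreal 4 (by omega)])
    · simp [feed]

theorem runRounds_output (T : ℕ) (hT : 0 < T) (x : ℕ → X) (U : ℕ → unitInterval) (t : ℕ) :
    (runRounds program e T (fun t => (l t : X → ℝ)) x U (t + 1)).int 3 0
      = (task e l).output (Fintype.card X) (Fintype.card X * T).size T
        (fun t => (e (x t) : ℕ)) U t := by
  obtain ⟨hin, hr, h2⟩ := round_spec e l T hT x U t
  exact (program_spec Fintype.card_pos hT (fun t => (e (x t)).2) hin hr h2).2.2.1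

theorem overheadTime_le (T : ℕ) (hT : 0 < T) (x : ℕ → X) (U : ℕ → unitInterval) (t : ℕ) :
    overheadTime program e T (fun t => (l t : X → ℝ)) x U t
      ≤ roundCost * (Fintype.card X * T.size) := by
  obtain ⟨hin, hr, h2⟩ := round_spec e l T hT x U t
  have := (program_spec Fintype.card_pos hT (fun t => (e (x t)).2) hin hr h2).2.2.2
  simpa [overheadTime, runRounds, feed] using this

end Run

end Overlay

/-! ### Expected cost and regret of the overlay. -/

namespace Overlay

/-- Both `(n.size - 1) * log 2` and `log 2` are at most `log n`, and `2 / log 2 < 3`. -/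
theorem size_le_log {n : ℕ} (hn : 2 ≤ n) : (n.size : ℝ) ≤ 3 * Real.log n := by
  have hpos : 0 < n.size := Nat.size_pos.2 (by omega)
  have h1 : 2 ^ (n.size - 1) ≤ n := Nat.lt_size.1 (by omega)
  have h2 : Real.log (2 ^ (n.size - 1)) ≤ Real.log n :=
    Real.log_le_log (by positivity) (by exact_mod_cast h1)
  rw [Real.log_pow, Nat.cast_sub hpos] at h2
  have h3 : Real.log 2 ≤ Real.log n := Real.log_le_log two_pos (by exact_mod_cast hn)
  have h4 := Real.log_two_gt_d9
  push_cast at h2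
  have h5 : (1 : ℝ) ≤ n.size := by exact_mod_cast hpos
  nlinarith

/-- The part of `(1 + D) * sqrt (k * A)` without the factor `D` is absorbed by the second root,
since `A ≤ B`. This gives `648 = 612 + 36`. -/
theorem interval_regret_le {D L m A B k : ℝ} (hD : 0 ≤ D) (hk : 0 ≤ k)
    (hA : 0 ≤ A) (hAB : A ≤ B) (hLA : L ≤ 3 * A) (hmB : m ≤ 3 * B) :
    6 * (51 * ((1 + D) * Real.sqrt L) + 3 * Real.sqrt ((D + 1) * m)) * Real.sqrt k
      ≤ 648 * (D * Real.sqrt (k * A) + Real.sqrt ((D + 1) * k * B)) := by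
  have hB : 0 ≤ B := hA.trans hAB
  have h1 : Real.sqrt L * Real.sqrt k ≤ 2 * Real.sqrt (k * A) := by
    rw [← Real.sqrt_mul' _ hk, show (2 : ℝ) * Real.sqrt (k * A) = Real.sqrt (2 ^ 2 * (k * A)) by
      rw [Real.sqrt_mul (by positivity : (0 : ℝ) ≤ 2 ^ 2), Real.sqrt_sq two_pos.le]]
    refine Real.sqrt_le_sqrt ?_
    have := mul_le_mul_of_nonneg_right hLA hk
    have : 0 ≤ k * A := mul_nonneg hk hA
    linarith
  have h2 : Real.sqrt ((D + 1) * m) * Real.sqrt k ≤ 2 * Real.sqrt ((D + 1) * k * B) := by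
    rw [← Real.sqrt_mul' _ hk,
      show (2 : ℝ) * Real.sqrt ((D + 1) * k * B) = Real.sqrt (2 ^ 2 * ((D + 1) * k * B)) by
        rw [Real.sqrt_mul (by positivity : (0 : ℝ) ≤ 2 ^ 2), Real.sqrt_sq two_pos.le]]
    refine Real.sqrt_le_sqrt ?_
    have h := mul_le_mul_of_nonneg_left hmB (by positivity : 0 ≤ (D + 1) * k)
    have : 0 ≤ (D + 1) * k * B := by positivity
    linarith
  have h3 : Real.sqrt (k * A) ≤ Real.sqrt ((D + 1) * k * B) := by
    refine Real.sqrt_le_sqrt ?_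
    have h := mul_le_mul_of_nonneg_left hAB hk
    have : 0 ≤ D * (k * B) := by positivity
    linarith
  have h4 := mul_le_mul_of_nonneg_left h1 (by positivity : 0 ≤ 1 + D)
  have h5 := Real.sqrt_nonneg ((D + 1) * k * B)
  have h6 := mul_nonneg hD (Real.sqrt_nonneg (k * A))
  linarith

theorem regret_bound_nonneg {X : Type u} [Fintype X] [PseudoMetricSpace X] (T k : ℕ) :
    0 ≤ Metric.diam (Set.univ : Set X) * Real.sqrt (k * Real.log T)
      + Real.sqrt ((Metric.diam (Set.univ : Set X) + 1) * k * Real.log (Fintype.card X * T)) :=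
  add_nonneg (mul_nonneg Metric.diam_nonneg (Real.sqrt_nonneg _)) (Real.sqrt_nonneg _)

theorem measurable_code {X : Type u} [Fintype X] {M : MTS X} (e : X ≃ Fin (Fintype.card X))
    (l : ℕ → M.losses) (A : OnlineAlgorithm.{u, w} M) (t : ℕ) :
    Measurable fun ω => ((e (A.act l t ω) : Fin _) : ℕ) := by
  let _ : MeasurableSpace X := ⊤
  have h : Measurable fun ω => A.act l t ω := measurable_to_countable' fun y =>
    A.measurable_act l t y
  exact (measurable_of_countable fun y : X => ((e y : Fin _) : ℕ)).comp h

theorem expectedCost_zero {X : Type u} [PseudoMetricSpace X] {M : MTS X} (l : ℕ → M.losses)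
    (A : OnlineAlgorithm.{u, w} M) (a : ℕ) : A.expectedCost l a 0 = 0 := by
  simp [OnlineAlgorithm.expectedCost, pathCost]

section Expectation

variable {X : Type u} [Fintype X] [Nonempty X] [PseudoMetricSpace X] {M : MTS X}
  (e : X ≃ Fin (Fintype.card X)) (l : ℕ → M.losses)

theorem integrable_pathCost (A : OnlineAlgorithm.{u, w} M) (a k : ℕ) :
    Integrable (fun ω => pathCost l (fun t => A.act l t ω) a k) A.law := by
  have := (task (Fintype.equivFin X) l).integrable_cost A.law
    (measurable_code (Fintype.equivFin X) l A) a k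
  simpa only [cost_task_code] using this

/-- The codes of the states of the base algorithm. -/
def codes (B : OnlineAlgorithm.{u, w} M) (ω : B.Seed) (t : ℕ) : ℕ := (e (B.act l t ω) : Fin _)

theorem pathCost_overlay {T : ℕ} (hT : 0 < T) (B : OnlineAlgorithm.{u, w} M) (a k : ℕ)
    (ω : B.Seed × (ℕ → unitInterval)) :
    pathCost l (fun t => (overlay program e T B).act l t ω) a k
      = (task e l).cost ((task e l).output (Fintype.card X) (Fintype.card X * T).size T
        (codes e l B ω.1) ω.2) a k := by
  rw [cost_task]
  congr 1
  funext t
  exact congrArg (decode e) (runRounds_output e l T hT (fun s => B.act l s ω.1) ω.2 t)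

/-- Fubini: with the seed of the base algorithm fixed, its states form a fixed sequence, to which
the bounds over the coins apply. Joint integrability comes from the measurability of the overlay as
an online algorithm. -/
theorem expectedCost_overlay {T : ℕ} (hT : 0 < T) (B : OnlineAlgorithm.{u, w} M) (a k : ℕ) :
    Integrable (fun ω => ∫ c, (task e l).cost ((task e l).output (Fintype.card X)
        (Fintype.card X * T).size T (codes e l B ω) c) a k ∂CodedTask.coinLaw) B.law ∧
      (overlay program e T B).expectedCost l a k
        = ∫ ω, ∫ c, (task e l).cost ((task e l).output (Fintype.card X)
          (Fintype.card X * T).size T (codes e l B ω) c) a k ∂CodedTask.coinLaw ∂B.law := by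
  have hint : Integrable (fun ω : B.Seed × (ℕ → unitInterval) =>
      (task e l).cost ((task e l).output (Fintype.card X) (Fintype.card X * T).size T
        (codes e l B ω.1) ω.2) a k) (B.law.prod CodedTask.coinLaw) := by
    refine (integrable_pathCost l (overlay program e T B) a k).congr
      (Filter.Eventually.of_forall fun ω => ?_)
    exact pathCost_overlay e l hT B a k ω
  refine ⟨hint.integral_prod_left, ?_⟩
  rw [← integral_prod _ hint]
  exact integral_congr_ae (Filter.Eventually.of_forall fun ω => pathCost_overlay e l hT B a k ω)

theorem expectedCost_overlay_le {T : ℕ} (hT : 0 < T) (B : OnlineAlgorithm.{u, w} M) {a k : ℕ}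
    {F : B.Seed → ℝ} (hF : Integrable F B.law)
    (h : ∀ ω, ∫ c, (task e l).cost ((task e l).output (Fintype.card X)
      (Fintype.card X * T).size T (codes e l B ω) c) a k ∂CodedTask.coinLaw ≤ F ω) :
    (overlay program e T B).expectedCost l a k ≤ ∫ ω, F ω ∂B.law := by
  obtain ⟨h1, h2⟩ := expectedCost_overlay e l hT B a k
  rw [h2]
  exact integral_mono h1 hF h

/-- Running the program on top of an algorithm adds at most a constant to its cost. -/
theorem expectedCost_overlay_le_add (T : ℕ) (B : OnlineAlgorithm.{u, w} M) :
    (overlay program e T B).expectedCost l 0 T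
      ≤ B.expectedCost l 0 T + 12 * (1 + Metric.diam (Set.univ : Set X)) := by
  rcases Nat.eq_zero_or_pos T with rfl | hT
  · rw [expectedCost_zero, expectedCost_zero]
    have := Metric.diam_nonneg (s := (Set.univ : Set X))
    linarith
  · refine (expectedCost_overlay_le e l hT B
      (F := fun ω => pathCost l (fun t => B.act l t ω) 0 T
        + 12 * (1 + Metric.diam (Set.univ : Set X)))
      ((integrable_pathCost l B 0 T).add (integrable_const _)) fun ω => ?_).trans ?_
    -- With `n = 0` the comparison is with the base sequence itself, and round `0` is aligned to
    -- every scale.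
    · refine ((task e l).integral_cost_output_le (codes e l B ω) hT (n := 0) (Nat.zero_le _)
        (dvd_zero _) le_rfl).trans ?_
      simp only [CodedTask.stack, integral_const, probReal_univ, one_smul]
      refine add_le_add (le_of_eq ?_) le_rfl
      exact cost_task_code e l (fun t => B.act l t ω) 0 T
    · rw [integral_add (integrable_pathCost l B 0 T) (integrable_const _)]
      simp [OnlineAlgorithm.expectedCost]

/-- The regret of an algorithm in a single round. -/
theorem expectedCost_one_le (A : OnlineAlgorithm.{u, w} M) (a : ℕ) (x : X) :
    A.expectedCost l a 1 ≤ (l a : X → ℝ) x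
      + 648 * (Metric.diam (Set.univ : Set X) * Real.sqrt ((1 : ℕ) * Real.log (1 : ℕ))
        + Real.sqrt ((Metric.diam (Set.univ : Set X) + 1) * (1 : ℕ)
          * Real.log (Fintype.card X * (1 : ℕ)))) := by
  have hD := Metric.diam_nonneg (s := (Set.univ : Set X))
  have hconst : ∀ c : ℝ, (∀ y, (l a : X → ℝ) y ≤ c) → A.expectedCost l a 1 ≤ c := by
    intro c hc
    refine (integral_mono (integrable_pathCost l A a 1) (integrable_const c)
      fun ω => ?_).trans (by simp)
    simpa [pathCost] using hc (A.act l a ω)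
  -- With at least two states, `log N ≥ log 2` makes the bound exceed `1`, hence the loss of a
  -- round. With a single state there is no regret.
  rcases Nat.lt_or_ge 1 (Fintype.card X) with h | h
  · have h1 := hconst 1 fun y => (M.bounded _ (l a).2 y).2
    have h0 := (M.bounded _ (l a).2 x).1
    have hN : (2 : ℝ) ≤ Fintype.card X := by exact_mod_cast h
    have hlog : Real.log 2 ≤ Real.log (Fintype.card X) := Real.log_le_log two_pos hN
    have h2 := Real.log_two_gt_d9
    have hsq : 1 / 2 ≤ Real.sqrt ((Metric.diam (Set.univ : Set X) + 1) * (1 : ℕ)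
        * Real.log (Fintype.card X * (1 : ℕ))) := by
      refine Real.le_sqrt_of_sq_le ?_
      push_cast
      rw [mul_one, mul_one]
      nlinarith
    have h3 : 0 ≤ Metric.diam (Set.univ : Set X) * Real.sqrt ((1 : ℕ) * Real.log (1 : ℕ)) :=
      mul_nonneg hD (Real.sqrt_nonneg _)
    refine h1.trans ?_
    generalize Metric.diam (Set.univ : Set X) * Real.sqrt ((1 : ℕ) * Real.log (1 : ℕ)) = p at *
    generalize Real.sqrt ((Metric.diam (Set.univ : Set X) + 1) * (1 : ℕ)
      * Real.log (Fintype.card X * (1 : ℕ))) = r at *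
    linarith
  · have := Fintype.card_le_one_iff_subsingleton.1 h
    have h1 := hconst ((l a : X → ℝ) x) fun y => by rw [Subsingleton.elim y x]
    have := regret_bound_nonneg (X := X) 1 1
    linarith

theorem regretLE_overlay (T : ℕ) (B : OnlineAlgorithm.{u, w} M) {a k : ℕ} (hak : a + k ≤ T) :
    (overlay program e T B).RegretLE a k
      (648 * (Metric.diam (Set.univ : Set X) * Real.sqrt (k * Real.log T)
        + Real.sqrt ((Metric.diam (Set.univ : Set X) + 1) * k
          * Real.log (Fintype.card X * T)))) := by
  intro l x
  have hD := Metric.diam_nonneg (s := (Set.univ : Set X))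
  rcases Nat.eq_zero_or_pos k with rfl | hk
  · rw [expectedCost_zero]
    have := regret_bound_nonneg (X := X) T 0
    simp only [Nat.add_zero, Finset.Ico_self, Finset.sum_empty]
    linarith
  -- For `T = 1` the term `log T` vanishes while `T.size` does not, so this horizon needs a separate
  -- argument.
  rcases Nat.lt_or_ge 1 T with hT | hT
  · have hT0 : 0 < T := by omega
    have hN : 0 < Fintype.card X := Fintype.card_pos
    have hN1 : (1 : ℝ) ≤ Fintype.card X := by exact_mod_cast hN
    have hT2 : (2 : ℝ) ≤ T := by exact_mod_cast hT
    have hNT : 2 ≤ Fintype.card X * T := by nlinarith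
    have hlogNT := CodedTask.log_le_size (Fintype.card X * T)
    have hsizeNT := size_le_log hNT
    rw [Nat.cast_mul] at hlogNT hsizeNT
    have hNm : Real.log (2 * Fintype.card X) ≤ (Fintype.card X * T).size := by
      refine (Real.log_le_log (by positivity) ?_).trans hlogNT
      nlinarith
    have hlog : Real.log T ≤ Real.log (Fintype.card X * T) :=
      Real.log_le_log (by positivity) (by nlinarith)
    have hbound := interval_regret_le (D := Metric.diam (Set.univ : Set X)) (k := (k : ℝ)) hD
      (Nat.cast_nonneg _) (Real.log_nonneg (by linarith : (1 : ℝ) ≤ T)) hlog (size_le_log hT)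
      hsizeNT
    have hsum : ∑ t ∈ Finset.Ico a (a + k), (task e l).loss t (e x : ℕ)
        = ∑ t ∈ Finset.Ico a (a + k), (l t : X → ℝ) x := by
      refine Finset.sum_congr rfl fun t _ => ?_
      simp [task, decode_code]
    refine (expectedCost_overlay_le e l hT0 B (integrable_const _) fun ω =>
      ((task e l).integral_cost_output_interval_le (codes e l B ω) hN hT0
        (Nat.size_pos.2 (by omega)) hNm (by omega) (e x).2)).trans ?_
    rw [hsum, integral_const, probReal_univ, one_smul]
    exact add_le_add le_rfl hbound
  · obtain rfl : T = 1 := by omega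
    obtain rfl : k = 1 := by omega
    simpa using expectedCost_one_le l (overlay program e 1 B) a x

end Expectation

end Overlay

theorem mainTheorem4 :
    ∃ (P : Program) (C : ℝ), 0 < C ∧
      ∀ (X : Type u) [Fintype X] [Nonempty X] [PseudoMetricSpace X] (M : MTS X)
        (e : X ≃ Fin (Fintype.card X)) (base : ℕ → OnlineAlgorithm.{u, w} M) (α : ℝ),
        1 ≤ α → HasCompetitiveRatio base α →
          HasCompetitiveRatio (fun T => overlay P e T (base T)) α ∧
          (∀ T a k : ℕ, a + k ≤ T →
            (overlay P e T (base T)).RegretLE a k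
              (C * (Metric.diam (Set.univ : Set X) * Real.sqrt (k * Real.log T)
                + Real.sqrt ((Metric.diam (Set.univ : Set X) + 1) * k
                    * Real.log (Fintype.card X * T))))) ∧
          (∀ (T : ℕ) (l : ℕ → M.losses) (ω : (base T).Seed) (coins : ℕ → unitInterval) (t : ℕ),
            t < T →
            (overheadTime P e T (fun s => (l s : X → ℝ)) (fun s => (base T).act l s ω) coins t : ℝ)
              ≤ C * (Fintype.card X * Real.log (T + 1))) := by
  -- `648` serves the regret, and `3 * roundCost` the running time after `T.size` is bounded by `3 *
  -- log (T + 1)`.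
  refine ⟨Overlay.program, 648 + 3 * Overlay.roundCost, by positivity, ?_⟩
  intro X _ _ _ M e base α _ hbase
  refine ⟨?_, ?_, ?_⟩
  · obtain ⟨β, hβ, h⟩ := hbase
    have hD := Metric.diam_nonneg (s := (Set.univ : Set X))
    refine ⟨β + 12 * (1 + Metric.diam (Set.univ : Set X)), by positivity, fun T l p => ?_⟩
    have h1 := Overlay.expectedCost_overlay_le_add e l T (base T)
    have h2 := h T l p
    linarith
  · intro T a k hak l x
    refine (Overlay.regretLE_overlay e T (base T) hak l x).trans ?_
    refine add_le_add le_rfl (mul_le_mul_of_nonneg_right ?_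
      (Overlay.regret_bound_nonneg (X := X) T k))
    have : (0 : ℝ) ≤ Overlay.roundCost := Nat.cast_nonneg _
    linarith
  · intro T l ω coins t ht
    have hT : 0 < T := by omega
    have h1 := Overlay.overheadTime_le e l T hT (fun s => (base T).act l s ω) coins t
    have h2 : (T.size : ℝ) ≤ 3 * Real.log (T + 1) := by
      -- Passing to `T + 1 ≥ 2` covers the horizon `T = 1` as well.
      have h3 := Overlay.size_le_log (n := T + 1) (by omega)
      have h4 : ((T.size : ℕ) : ℝ) ≤ (T + 1).size := by
        exact_mod_cast Nat.size_le_size (Nat.le_succ T)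
      push_cast at h3
      linarith
    have h0 : 0 ≤ Real.log ((T : ℝ) + 1) := Real.log_nonneg (by
      have : (0 : ℝ) ≤ T := Nat.cast_nonneg _
      linarith)
    calc (overheadTime Overlay.program e T (fun s => (l s : X → ℝ))
          (fun s => (base T).act l s ω) coins t : ℝ)
        ≤ Overlay.roundCost * (Fintype.card X * T.size) := by exact_mod_cast h1
      _ ≤ Overlay.roundCost * (Fintype.card X * (3 * Real.log (T + 1))) := by gcongr
      _ = 3 * Overlay.roundCost * (Fintype.card X * Real.log (T + 1)) := by ring
      _ ≤ (648 + 3 * Overlay.roundCost) * (Fintype.card X * Real.log (T + 1)) := by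
          gcongr
          linarith
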